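/- **Theorem 2.3.** Let $N\ge 1$ and let $B_N$ be the open unit ball of $\mathbb{C}^N$. For $s>-1$ let $A^2_s(B_N)$ be the weighted Bergman space of holomorphic functions $f$ on $B_N$ with $$\|f\|^2=\int_{B_N}|f(z)|^2\,\frac{\Gamma(N+s+1)}{\Gamma(N+1)\Gamma(s+1)}(1-|z|^2)^s\,d\nu(z)<\infty ,$$ and let $H^2(B_N)$ be the Hardy space of holomorphic functions $f$ on $B_N$ with $\|f\|^2=\sup_{0<r<1}\int_{\partial B_N}|f(r\xi)|^2\,d\sigma(\xi)<\infty$, where $\nu$ and $\sigma$ are the normalized Lebesgue measures on $B_N$ and $\partial B_N$. Let $\mathcal H$ be one of these spaces, and put $\beta=N$ if $\mathcal H=H^2(B_N)$ and $\beta=N+s+1$ if $\mathcal H=A^2_s(B_N)$. For a bounded operator $T$ on $\mathcal H$ let $\|T\|_e=\inf\{\|T-K\|: K \text{ compact on }\mathcal H\}$. Let $\varphi_1,\dots,\varphi_m$ be holomorphic maps from $B_N$ into $B_N$ such that each composition operator $C_{\varphi_j}f=f\circ\varphi_j$ is bounded on $\mathcal H$, let $c_1,\dots,c_m\in\mathbb{C}$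 and let $\zeta\in\partial B_N$. Write $$d_{\varphi}(\zeta)=\liminf_{z\to\zeta,\ z\in B_N}\frac{1-|\varphi(z)|}{1-|z|}\in[0,\infty],\qquad \varphi(\zeta)=\lim_{r\to1^-}\varphi(r\zeta).$$ For every $j$ with $d_{\varphi_j}(\zeta)<\infty$, one has $d_{\varphi_j}(\zeta)>0$, and the radial limit $\varphi_j(\zeta)$ exists and lies on $\partial B_N$. Moreover $$\Bigl\|\sum_{j=1}^m c_jC_{\varphi_j}\Bigr\|_e^2\ \ge\ \sum_{(\eta,d)}\ \Bigl|\sum_{l:\ \varphi_l(\zeta)=\eta,\ d_{\varphi_l}(\zeta)=d}c_l\Bigr|^2\,\frac1{d^{\beta}},$$ where the outer sum runs over the distinct pairs $(\eta,d)=(\varphi_j(\zeta),d_{\varphi_j}(\zeta))$ with $1\le j\le m$ and $d_{\varphi_j}(\zeta)<\infty$, each pair being counted once. -/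

import Mathlib

open MeasureTheory Filter Topology Metric
open scoped ENNReal Classical

noncomputable section

/-- The Hermitian space `ℂ^N`; its open unit ball is `ball (0 : CSpace N) 1`. -/
abbrev CSpace (N : ℕ) : Type := EuclideanSpace ℂ (Fin N)

/-- Normalized Lebesgue measure on the unit sphere of `ℂ^N`. -/
def sphereMeasure (N : ℕ) : Measure (sphere (0 : CSpace N) 1) :=
  ((volume : Measure (CSpace N)).toSphere Set.univ)⁻¹ • (volume : Measure (CSpace N)).toSphere

/-- Normalized Lebesgue volume measure on the unit ball of `ℂ^N`. -/
def ballMeasure (N : ℕ) : Measure (CSpace N) :=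
  (volume (ball (0 : CSpace N) 1))⁻¹ • volume.restrict (ball (0 : CSpace N) 1)

/-- The weight `Γ(N+s+1) / (Γ(N+1) Γ(s+1)) * (1 - |z|²)^s`. -/
def bergmanWeight (N : ℕ) (s : ℝ) (z : CSpace N) : ℝ :=
  Real.Gamma (N + s + 1) / (Real.Gamma (N + 1) * Real.Gamma (s + 1)) * (1 - ‖z‖ ^ 2) ^ s

/-- The measure `w_s dν` on the unit ball. -/
def bergmanMeasure (N : ℕ) (s : ℝ) : Measure (CSpace N) :=
  (ballMeasure N).withDensity fun z => ENNReal.ofReal (bergmanWeight N s z)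

/-- `sup_{0<r<1} (∫ |f(rζ)|² dσ(ζ))^{1/2}`. -/
def hardyENorm (N : ℕ) (f : CSpace N → ℂ) : ℝ≥0∞ :=
  ⨆ r ∈ Set.Ioo (0 : ℝ) 1,
    eLpNorm (fun ζ : sphere (0 : CSpace N) 1 => f (r • (ζ : CSpace N))) 2 (sphereMeasure N)

/-- `(∫ |f|² w_s dν)^{1/2}`. -/
def bergmanENorm (N : ℕ) (s : ℝ) (f : CSpace N → ℂ) : ℝ≥0∞ :=
  eLpNorm f 2 (bergmanMeasure N s)

/-- The norm of the scale of spaces `A²_s(B_N)`, `s ≥ -1`, where `A²_{-1}(B_N)` is the Hardy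
space `H²(B_N)`. -/
def spaceENorm (N : ℕ) (s : ℝ) (f : CSpace N → ℂ) : ℝ≥0∞ :=
  if s = -1 then hardyENorm N f else bergmanENorm N s f

lemma ballHol_continuous_slice {N : ℕ} {f : CSpace N → ℂ}
    (hf : DifferentiableOn ℂ f (ball 0 1)) {r : ℝ} (hr : r ∈ Set.Ioo (0 : ℝ) 1) :
    Continuous fun ζ : sphere (0 : CSpace N) 1 => f (r • (ζ : CSpace N)) := by
  refine hf.continuousOn.comp_continuous (by fun_prop) fun ζ => ?_
  have h1 : ‖(ζ : CSpace N)‖ = 1 := by simp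
  rw [mem_ball_zero_iff, norm_smul, h1, Real.norm_of_nonneg hr.1.le, mul_one]
  exact hr.2

lemma ballHol_aestronglyMeasurable {N : ℕ} (s : ℝ) {f : CSpace N → ℂ}
    (hf : DifferentiableOn ℂ f (ball 0 1)) :
    AEStronglyMeasurable f (bergmanMeasure N s) := by
  have h : AEStronglyMeasurable f (volume.restrict (ball (0 : CSpace N) 1)) :=
    hf.continuousOn.aestronglyMeasurable measurableSet_ball
  exact (h.smul_measure _).mono_ac (withDensity_absolutelyContinuous _ _)

lemma spaceENorm_zero (N : ℕ) (s : ℝ) : spaceENorm N s 0 = 0 := by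
  unfold spaceENorm hardyENorm bergmanENorm
  split_ifs <;> simp

lemma spaceENorm_smul {N : ℕ} (s : ℝ) (c : ℂ) (f : CSpace N → ℂ) :
    spaceENorm N s (c • f) = ‖c‖ₑ * spaceENorm N s f := by
  unfold spaceENorm
  split_ifs
  · unfold hardyENorm
    simp_rw [ENNReal.mul_iSup]
    refine iSup_congr fun r => iSup_congr fun _ => ?_
    exact eLpNorm_const_smul c (fun ζ : sphere (0 : CSpace N) 1 => f (r • (ζ : CSpace N))) 2 _
  · exact eLpNorm_const_smul c f 2 _

lemma spaceENorm_add_le {N : ℕ} (s : ℝ) {f g : CSpace N → ℂ}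
    (hf : DifferentiableOn ℂ f (ball 0 1)) (hg : DifferentiableOn ℂ g (ball 0 1)) :
    spaceENorm N s (f + g) ≤ spaceENorm N s f + spaceENorm N s g := by
  unfold spaceENorm
  split_ifs
  · unfold hardyENorm
    refine iSup₂_le fun r hr => ?_
    refine (eLpNorm_add_le (ballHol_continuous_slice hf hr).aestronglyMeasurable
      (ballHol_continuous_slice hg hr).aestronglyMeasurable (by norm_num)).trans ?_
    gcongr
    · exact le_iSup₂ (f := fun (r : ℝ) (_ : r ∈ Set.Ioo (0 : ℝ) 1) =>
        eLpNorm (fun ζ : sphere (0 : CSpace N) 1 => f (r • (ζ : CSpace N))) 2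
          (sphereMeasure N)) r hr
    · exact le_iSup₂ (f := fun (r : ℝ) (_ : r ∈ Set.Ioo (0 : ℝ) 1) =>
        eLpNorm (fun ζ : sphere (0 : CSpace N) 1 => g (r • (ζ : CSpace N))) 2
          (sphereMeasure N)) r hr
  · exact eLpNorm_add_le (ballHol_aestronglyMeasurable s hf)
      (ballHol_aestronglyMeasurable s hg) (by norm_num)

/-- The vector space of holomorphic functions on the ball with finite norm. A function on the
ball is represented by its extension by `0` to `ℂ^N`. -/
def holSubmodule (N : ℕ) (s : ℝ) : Submodule ℂ (CSpace N → ℂ) where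
  carrier := {f | DifferentiableOn ℂ f (ball 0 1) ∧ (∀ z ∉ ball (0 : CSpace N) 1, f z = 0) ∧
    spaceENorm N s f < ∞}
  zero_mem' := ⟨differentiableOn_const (0 : ℂ), fun _ _ => rfl, by simp [spaceENorm_zero]⟩
  add_mem' := fun {f g} hf hg => ⟨hf.1.add hg.1, fun z hz => by simp [hf.2.1 z hz, hg.2.1 z hz],
    (spaceENorm_add_le s hf.1 hg.1).trans_lt (ENNReal.add_lt_top.2 ⟨hf.2.2, hg.2.2⟩)⟩
  smul_mem' := fun c f hf => ⟨hf.1.const_smul c, fun z hz => by simp [hf.2.1 z hz],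
    by rw [spaceENorm_smul]; exact ENNReal.mul_lt_top (by simp) hf.2.2⟩

/-- The space `A²_s(B_N)` for `s > -1`, and the Hardy space `H²(B_N)` for `s = -1`. It is a type
of its own, so that its topology is the one of its norm. -/
def HolSpace (N : ℕ) (s : ℝ) : Type := holSubmodule N s

namespace HolSpace

variable {N : ℕ} {s : ℝ}

instance : AddCommGroup (HolSpace N s) := inferInstanceAs (AddCommGroup (holSubmodule N s))

instance : Module ℂ (HolSpace N s) := inferInstanceAs (Module ℂ (holSubmodule N s))

instance : CoeFun (HolSpace N s) fun _ => CSpace N → ℂ := ⟨fun f => f.1⟩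

instance : Norm (HolSpace N s) := ⟨fun f => (spaceENorm N s f).toReal⟩

lemma norm_def (f : HolSpace N s) : ‖f‖ = (spaceENorm N s f).toReal := rfl

lemma seminormedCore : SeminormedSpace.Core ℂ (HolSpace N s) where
  norm_nonneg _ := ENNReal.toReal_nonneg
  norm_smul c f := by
    change (spaceENorm N s (c • f.1)).toReal = _
    rw [spaceENorm_smul, ENNReal.toReal_mul, toReal_enorm, norm_def]
  norm_triangle f g := by
    change (spaceENorm N s (f.1 + g.1)).toReal ≤ _
    rw [norm_def, norm_def, ← ENNReal.toReal_add f.2.2.2.ne g.2.2.2.ne]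
    exact ENNReal.toReal_mono (ENNReal.add_lt_top.2 ⟨f.2.2.2, g.2.2.2⟩).ne
      (spaceENorm_add_le s f.2.1 g.2.1)

instance : SeminormedAddCommGroup (HolSpace N s) :=
  SeminormedAddCommGroup.ofCore seminormedCore

instance : NormedSpace ℂ (HolSpace N s) where
  norm_smul_le c f := (seminormedCore.norm_smul c f).le

/-- The norm is definite in the range of parameters of interest. -/
lemma eq_zero_of_norm_eq_zero (hN : 0 < N) (hs : -1 ≤ s) (f : HolSpace N s) (hf : ‖f‖ = 0) :
    f = 0 := by
  have h0 : spaceENorm N s f.1 = 0 := by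
    rcases (ENNReal.toReal_eq_zero_iff _).1 hf with h | h
    · exact h
    · exact absurd h f.2.2.2.ne
  have hcont : ContinuousOn f.1 (ball 0 1) := f.2.1.continuousOn
  suffices h : Set.EqOn f.1 0 (ball 0 1) by
    apply Subtype.ext
    funext z
    by_cases hz : z ∈ ball (0 : CSpace N) 1
    · exact h hz
    · exact f.2.2.1 z hz
  unfold spaceENorm at h0
  split_ifs at h0 with hs1
  · obtain ⟨n, rfl⟩ : ∃ n, N = n + 1 := ⟨N - 1, by omega⟩
    unfold hardyENorm at h0
    have hslice : ∀ r ∈ Set.Ioo (0 : ℝ) 1, ∀ ζ : sphere (0 : CSpace (n + 1)) 1,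
        f.1 (r • (ζ : CSpace (n + 1))) = 0 := by
      intro r hr ζ
      have h1 := (ENNReal.iSup_eq_zero.1 ((ENNReal.iSup_eq_zero.1 h0) r)) hr
      have hc := ballHol_continuous_slice f.2.1 hr
      rw [eLpNorm_eq_zero_iff hc.aestronglyMeasurable (by norm_num)] at h1
      unfold sphereMeasure at h1
      rw [Measure.ae_ennreal_smul_measure_eq (ENNReal.inv_ne_zero.2 (measure_ne_top _ _))] at h1
      exact congrFun (Continuous.ae_eq_iff_eq _ hc continuous_const |>.1 h1) ζ
    have hpunct : Set.EqOn f.1 0 (ball 0 1 \ {0}) := by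
      rintro z ⟨hz, hz0⟩
      have hz0' : z ≠ 0 := hz0
      have hpos : 0 < ‖z‖ := norm_pos_iff.2 hz0'
      have := hslice ‖z‖ ⟨hpos, mem_ball_zero_iff.1 hz⟩ ⟨‖z‖⁻¹ • z, by
        simp [norm_smul, hpos.ne']⟩
      simpa [smul_smul, hpos.ne'] using this
    intro z hz
    by_cases hz0 : z = 0
    · subst hz0
      have h1 : Tendsto f.1 (𝓝[≠] 0) (𝓝 (f.1 0)) :=
        ((hcont.continuousAt (isOpen_ball.mem_nhds hz)).tendsto).mono_left nhdsWithin_le_nhds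
      have : (𝓝[≠] (0 : CSpace (n + 1))).NeBot := Module.punctured_nhds_neBot ℂ _ _
      refine tendsto_nhds_unique_of_eventuallyEq h1 tendsto_const_nhds ?_
      filter_upwards [self_mem_nhdsWithin, nhdsWithin_le_nhds (isOpen_ball.mem_nhds hz)]
        with w hw0 hw using hpunct ⟨hw, hw0⟩
    · exact hpunct ⟨hz, hz0⟩
  · have hs' : 0 < s + 1 := by
      have := lt_of_le_of_ne hs (Ne.symm hs1)
      linarith
    unfold bergmanENorm at h0
    rw [eLpNorm_eq_zero_iff (ballHol_aestronglyMeasurable s f.2.1) (by norm_num)] at h0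
    unfold bergmanMeasure at h0
    have hmeas : Measurable fun z : CSpace N => ENNReal.ofReal (bergmanWeight N s z) := by
      unfold bergmanWeight
      fun_prop
    have h1 := (ae_withDensity_iff hmeas).1 h0
    unfold ballMeasure at h1
    rw [Measure.ae_ennreal_smul_measure_eq (ENNReal.inv_ne_zero.2 measure_ball_lt_top.ne)] at h1
    refine Measure.eqOn_open_of_ae_eq (μ := volume) ?_ isOpen_ball hcont continuousOn_const
    filter_upwards [h1, ae_restrict_mem measurableSet_ball] with z hz hzb
    refine hz ?_
    have hz1 : ‖z‖ < 1 := mem_ball_zero_iff.1 hzb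
    have hsq : 0 < 1 - ‖z‖ ^ 2 := by nlinarith [norm_nonneg z]
    have hN0 : (0 : ℝ) ≤ N := Nat.cast_nonneg N
    have : 0 < bergmanWeight N s z := by
      unfold bergmanWeight
      have g1 : 0 < Real.Gamma (N + s + 1) := Real.Gamma_pos_of_pos (by linarith)
      have g2 : 0 < Real.Gamma ((N : ℝ) + 1) := Real.Gamma_pos_of_pos (by linarith)
      have g3 : 0 < Real.Gamma (s + 1) := Real.Gamma_pos_of_pos hs'
      positivity
    simpa using this

end HolSpace

/-- `T` is the (bounded) composition operator `f ↦ f ∘ φ` on the space. -/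
def IsCompositionOperator {N : ℕ} {s : ℝ} (φ : CSpace N → CSpace N)
    (T : HolSpace N s →L[ℂ] HolSpace N s) : Prop :=
  ∀ f : HolSpace N s, ∀ z ∈ ball (0 : CSpace N) 1, T f z = f (φ z)

/-- `inf {‖T - K‖ : K compact}`. -/
def essentialNorm {X : Type*} [SeminormedAddCommGroup X] [NormedSpace ℂ X] (T : X →L[ℂ] X) : ℝ :=
  sInf {t : ℝ | ∃ K : X →L[ℂ] X, IsCompactOperator K ∧ t = ‖T - K‖}

/-- `d_φ(ζ) = liminf_{z → ζ} (1 - |φ(z)|) / (1 - |z|)`, the limit being unrestricted in the unit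
ball; it takes values in `[0, ∞]`. -/
def angularLiminf {N : ℕ} (φ : CSpace N → CSpace N) (ζ : CSpace N) : ℝ≥0∞ :=
  liminf (fun z => ENNReal.ofReal ((1 - ‖φ z‖) / (1 - ‖z‖))) (𝓝[ball 0 1] ζ)

/-- The radial limit `φ(ζ) = lim_{r → 1⁻} φ(rζ)` (meaningful when the limit exists). -/
def radialLimit {N : ℕ} (φ : CSpace N → CSpace N) (ζ : CSpace N) : CSpace N :=
  limUnder (𝓝[<] (1 : ℝ)) fun r => φ (r • ζ)

/-- The pair `(φ(ζ), d_φ(ζ))`. -/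
def boundaryData {N : ℕ} (φ : CSpace N → CSpace N) (ζ : CSpace N) : CSpace N × ℝ≥0∞ :=
  (radialLimit φ ζ, angularLiminf φ ζ)

/-- The finite set of the distinct pairs `(φ_j(ζ), d_{φ_j}(ζ))` with `d_{φ_j}(ζ) < ∞`. -/
def finiteBoundaryData {N m : ℕ} (φ : Fin m → CSpace N → CSpace N) (ζ : CSpace N) :
    Finset (CSpace N × ℝ≥0∞) :=
  (Finset.univ.filter fun j => angularLiminf (φ j) ζ < ∞).image fun j => boundaryData (φ j) ζ

end

/-! Write `β = N + s + 1` (so `β = N` in the Hardy case) and `K_a(z) = (1 - ⟨z, a⟩)^(-β)`. Formally,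
the adjoint of `T = ∑ c_j C_{φ_j}` sends the normalized kernel at `w` to `f_w = (1 - |w|²)^(β/2) ∑
conj(c_l) K_{φ_l(w)}`, and normalized kernels tend weakly to zero at the boundary. The essential
norm squared is therefore at least every limit of `‖f_w‖² = (1 - |w|²)^β ∑ conj(c_l) c_j
K_{φ_l(w)}(φ_j(w))` as `w → ζ`.

The limit is taken along `w = (1 - tκ)ζ` with `Re κ = 1`, `t → 0+`. Here `1 - |w|² ~ 2t`. Julia's
lemma, the nontangential Julia–Carathéodory theorem and the fact that the component of `φ_j(w)`
orthogonal to `φ_j(ζ)` is `o(√t)` give `1 - ⟨φ_j(w), φ_l(w)⟩ ~ t (d_j κ + d_l conj κ)` when the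
boundary values agree. The corresponding term tends to `((d_j κ + d_l conj κ)/2)^(-β)`; terms with
different boundary values or with an infinite dilatation tend to zero. When `Im κ → ∞`, terms with
`d_j ≠ d_l` disappear and those with `d_j = d_l = d` remain equal to `d^(-β)`. This is the asserted
sum over distinct pairs (`IsJuliaPoint.tendsto_inner_quotient`, `tendsto_kernelLimit`,
`sum_image_norm_sq_fiber`).

No adjoint and no completeness are needed. The vectors `f_w` are written down explicitly, and two
inequalities suffice: the sharp point evaluation bound `|f(w)| (1 - |w|²)^(β/2) ≤ ‖f‖`, and the
bound of the squared norm of a kernel sum by its quadratic form. If `S` is the quadratic form of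
`f_w`, they give `|S| ≤ ‖T f_w‖ ≤ ‖T - K‖ √S + ‖K f_w‖`. A compact `K` makes `K f_w` small along a
subsequence because the `f_w` are asymptotically orthogonal
(`IsCompactOperator.exists_subseq_tendsto_zero`, `re_sum_limit_le_norm_sub_sq`).

For `s > -1` both inequalities follow from the automorphisms of the ball and the mean value
property. For the Hardy space they are obtained by letting `s → -1`: the weighted measures are
probability measures that concentrate on the sphere. -/

/-! ### Automorphisms of the unit ball -/

section BallAutomorphism

open scoped InnerProductSpace ComplexConjugate

variable {E : Type*} [NormedAddCommGroup E] [InnerProductSpace ℂ E]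

/-- The operator `P_a + √(1 - |a|²) (1 - P_a)`, with `P_a` the projection onto the line of `a`. -/
noncomputable def ballLin (a : E) : E →L[ℂ] E :=
  ((√(1 - ‖a‖ ^ 2) : ℝ) : ℂ) • ContinuousLinearMap.id ℂ E +
    ((1 + √(1 - ‖a‖ ^ 2) : ℝ) : ℂ)⁻¹ • (innerSL ℂ a).smulRight a

/-- The involutive automorphism of the unit ball that interchanges `0` and `a`. -/
noncomputable def ballAut (a z : E) : E := (1 - ⟪a, z⟫_ℂ)⁻¹ • (a - ballLin a z)

lemma ballLin_apply (a z : E) : ballLin a z = ((√(1 - ‖a‖ ^ 2) : ℝ) : ℂ) • z +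
    (((1 + √(1 - ‖a‖ ^ 2) : ℝ) : ℂ)⁻¹ * ⟪a, z⟫_ℂ) • a := by
  simp [ballLin, smul_smul]

lemma exists_sqrt_one_sub {a : E} (ha : ‖a‖ < 1) : ∃ σ : ℝ, √(1 - ‖a‖ ^ 2) = σ ∧ 0 < σ ∧
    ⟪a, a⟫_ℂ = 1 - (σ : ℂ) ^ 2 ∧ 1 + (σ : ℂ) ≠ 0 ∧ (σ : ℂ) ^ 2 = 1 - (‖a‖ : ℂ) ^ 2 ∧
    σ ^ 2 = 1 - ‖a‖ ^ 2 := by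
  have h1 : 0 < 1 - ‖a‖ ^ 2 := by nlinarith [norm_nonneg a]
  have h2 : √(1 - ‖a‖ ^ 2) ^ 2 = 1 - ‖a‖ ^ 2 := Real.sq_sqrt h1.le
  have h3 : ((√(1 - ‖a‖ ^ 2) : ℝ) : ℂ) ^ 2 = 1 - (‖a‖ : ℂ) ^ 2 := by exact_mod_cast h2
  refine ⟨_, rfl, Real.sqrt_pos.2 h1, ?_, ?_, h3, h2⟩
  · rw [h3, inner_self_eq_norm_sq_to_K]; simp
  · have := Real.sqrt_nonneg (1 - ‖a‖ ^ 2)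
    exact_mod_cast (by positivity : (1 + √(1 - ‖a‖ ^ 2)) ≠ 0)

lemma ballLin_self {a : E} (ha : ‖a‖ < 1) : ballLin a a = a := by
  obtain ⟨σ, h, -, haa, h1, -⟩ := exists_sqrt_one_sub ha
  rw [ballLin_apply, h, haa, ← add_smul]
  have : (σ : ℂ) + ((1 + σ : ℝ) : ℂ)⁻¹ * (1 - (σ : ℂ) ^ 2) = 1 := by
    push_cast; field_simp; ring
  rw [this, one_smul]

lemma inner_ballLin {a : E} (ha : ‖a‖ < 1) (z : E) : ⟪a, ballLin a z⟫_ℂ = ⟪a, z⟫_ℂ := by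
  obtain ⟨σ, h, -, haa, h1, -⟩ := exists_sqrt_one_sub ha
  rw [ballLin_apply, h, inner_add_right, inner_smul_right, inner_smul_right, haa]
  push_cast; field_simp; ring

lemma ballLin_ballLin {a : E} (ha : ‖a‖ < 1) (z : E) :
    ballLin a (ballLin a z) = (1 - (‖a‖ : ℂ) ^ 2) • z + ⟪a, z⟫_ℂ • a := by
  have h0 := inner_ballLin ha z
  obtain ⟨σ, h, -, haa, h1, h2, -⟩ := exists_sqrt_one_sub ha
  rw [ballLin_apply a (ballLin a z), h0, ballLin_apply, h, ← h2, smul_add, smul_smul, smul_smul,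
    add_assoc, ← add_smul]
  congr 2
  · ring
  · push_cast; field_simp; ring

lemma inner_ballLin_left (a z w : E) : ⟪ballLin a z, w⟫_ℂ = ⟪z, ballLin a w⟫_ℂ := by
  rw [ballLin_apply, ballLin_apply, inner_add_left, inner_add_right, inner_smul_left,
    inner_smul_left, inner_smul_right, inner_smul_right, map_mul, inner_conj_symm, map_inv₀,
    Complex.conj_ofReal, Complex.conj_ofReal]
  ring

lemma norm_ballLin_sq {a : E} (ha : ‖a‖ < 1) (z : E) :
    ‖ballLin a z‖ ^ 2 = (1 - ‖a‖ ^ 2) * ‖z‖ ^ 2 + ‖⟪a, z⟫_ℂ‖ ^ 2 := by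
  have h : ⟪ballLin a z, ballLin a z⟫_ℂ = (((1 - ‖a‖ ^ 2) * ‖z‖ ^ 2 + ‖⟪a, z⟫_ℂ‖ ^ 2 : ℝ) : ℂ) := by
    rw [inner_ballLin_left, ballLin_ballLin ha, inner_add_right, inner_smul_right,
      inner_smul_right, inner_self_eq_norm_sq_to_K, ← inner_conj_symm z a, Complex.mul_conj,
      Complex.normSq_eq_norm_sq]
    push_cast; simp
  rw [inner_self_eq_norm_sq_to_K] at h
  exact Complex.ofReal_injective (by rw [← h]; simp)

lemma norm_sub_ballLin_sq {a : E} (ha : ‖a‖ < 1) (z : E) :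
    ‖a - ballLin a z‖ ^ 2 = ‖1 - ⟪a, z⟫_ℂ‖ ^ 2 - (1 - ‖a‖ ^ 2) * (1 - ‖z‖ ^ 2) := by
  have h1 : ‖1 - ⟪a, z⟫_ℂ‖ ^ 2 = 1 - 2 * (⟪a, z⟫_ℂ).re + ‖⟪a, z⟫_ℂ‖ ^ 2 := by
    rw [← Complex.normSq_eq_norm_sq, ← Complex.normSq_eq_norm_sq, Complex.normSq_apply,
      Complex.normSq_apply]
    simp; ring
  rw [@norm_sub_sq ℂ, inner_ballLin ha, norm_ballLin_sq ha, h1]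
  simp only [RCLike.re_to_complex]
  ring

lemma norm_inner_lt_one {a z : E} (ha : ‖a‖ < 1) (hz : ‖z‖ ≤ 1) : ‖⟪a, z⟫_ℂ‖ < 1 :=
  (norm_inner_le_norm a z).trans_lt (by nlinarith [norm_nonneg a, norm_nonneg z])

lemma one_sub_inner_ne_zero {a z : E} (ha : ‖a‖ < 1) (hz : ‖z‖ ≤ 1) : 1 - ⟪a, z⟫_ℂ ≠ 0 := by
  intro h
  have := norm_inner_lt_one ha hz
  rw [← sub_eq_zero.1 h] at this
  simp at this

/-- This identity serves twice: it turns the Schwarz lemma into the Schwarz–Pick inequality, and it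
describes how the Bergman weight transforms under the automorphism. -/
lemma one_sub_norm_ballAut_sq {a z : E} (ha : ‖a‖ < 1) (hz : ‖z‖ ≤ 1) :
    1 - ‖ballAut a z‖ ^ 2 = (1 - ‖a‖ ^ 2) * (1 - ‖z‖ ^ 2) / ‖1 - ⟪a, z⟫_ℂ‖ ^ 2 := by
  have h : ‖1 - ⟪a, z⟫_ℂ‖ ≠ 0 := norm_ne_zero_iff.2 (one_sub_inner_ne_zero ha hz)
  rw [ballAut, norm_smul, mul_pow, norm_sub_ballLin_sq ha, norm_inv]
  field_simp
  ring

lemma norm_ballAut_lt_one {a z : E} (ha : ‖a‖ < 1) (hz : ‖z‖ < 1) : ‖ballAut a z‖ < 1 := by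
  have h : 0 < ‖1 - ⟪a, z⟫_ℂ‖ := norm_pos_iff.2 (one_sub_inner_ne_zero ha hz.le)
  have h1 := one_sub_norm_ballAut_sq ha hz.le
  have h2 : 0 < (1 - ‖a‖ ^ 2) * (1 - ‖z‖ ^ 2) / ‖1 - ⟪a, z⟫_ℂ‖ ^ 2 := by
    have : 0 < 1 - ‖a‖ ^ 2 := by nlinarith [norm_nonneg a]
    have : 0 < 1 - ‖z‖ ^ 2 := by nlinarith [norm_nonneg z]
    positivity
  nlinarith [norm_nonneg (ballAut a z)]

lemma mapsTo_ballAut {a : E} (ha : ‖a‖ < 1) : Set.MapsTo (ballAut a) (ball 0 1) (ball 0 1) := by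
  intro z hz
  rw [mem_ball_zero_iff] at hz ⊢
  exact norm_ballAut_lt_one ha hz

lemma one_sub_inner_ballAut {a z : E} (ha : ‖a‖ < 1) (hz : ‖z‖ ≤ 1) :
    1 - ⟪a, ballAut a z⟫_ℂ = (1 - (‖a‖ : ℂ) ^ 2) / (1 - ⟪a, z⟫_ℂ) := by
  have h := one_sub_inner_ne_zero ha hz
  rw [ballAut, inner_smul_right, inner_sub_right, inner_ballLin ha, inner_self_eq_norm_sq_to_K]
  field_simp
  simp

lemma ballAut_ballAut {a z : E} (ha : ‖a‖ < 1) (hz : ‖z‖ ≤ 1) : ballAut a (ballAut a z) = z := by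
  have h := one_sub_inner_ne_zero ha hz
  have h' : (1 - (‖a‖ : ℂ) ^ 2) ≠ 0 := by
    have : 1 - ‖a‖ ^ 2 ≠ 0 := by nlinarith [norm_nonneg a]
    exact_mod_cast this
  have hL : ballLin a (ballAut a z) = a - ((1 - (‖a‖ : ℂ) ^ 2) / (1 - ⟪a, z⟫_ℂ)) • z := by
    rw [ballAut, map_smul, map_sub, ballLin_self ha, ballLin_ballLin ha, div_eq_inv_mul, mul_smul]
    have : a - ((1 - (‖a‖ : ℂ) ^ 2) • z + ⟪a, z⟫_ℂ • a) =
      (1 - ⟪a, z⟫_ℂ) • a - (1 - (‖a‖ : ℂ) ^ 2) • z := by module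
    rw [this, smul_sub, smul_smul, inv_mul_cancel₀ h, one_smul]
  rw [ballAut, one_sub_inner_ballAut ha hz, hL, sub_sub_cancel, smul_smul, inv_mul_cancel₀,
    one_smul]
  exact div_ne_zero h' h

lemma ballAut_zero (a : E) : ballAut a 0 = a := by simp [ballAut]

lemma ballAut_self {a : E} (ha : ‖a‖ < 1) : ballAut a a = 0 := by
  rw [ballAut, ballLin_self ha, sub_self, smul_zero]

lemma hasFDerivAt_ballAut {a z : E} (ha : ‖a‖ < 1) (hz : ‖z‖ ≤ 1) :
    HasFDerivAt (𝕜 := ℂ) (ballAut a)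
      ((1 - ⟪a, z⟫_ℂ)⁻¹ • (-ballLin a) +
        ((1 - ⟪a, z⟫_ℂ)⁻¹ ^ 2 • innerSL ℂ a).smulRight (a - ballLin a z)) z := by
  have h := one_sub_inner_ne_zero ha hz
  have h1 : HasFDerivAt (𝕜 := ℂ) (fun z => 1 - ⟪a, z⟫_ℂ) (-(innerSL ℂ a)) z :=
    (innerSL ℂ a).hasFDerivAt.const_sub 1
  have h2 := (hasDerivAt_inv h).comp_hasFDerivAt z h1
  have h3 : HasFDerivAt (𝕜 := ℂ) (fun z => a - ballLin a z) (-(ballLin a)) z :=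
    (ballLin a).hasFDerivAt.const_sub a
  have h4 := h2.smul h3
  refine h4.congr_fderiv ?_
  ext v
  simp

lemma differentiableOn_ballAut {a : E} (ha : ‖a‖ < 1) :
    DifferentiableOn ℂ (ballAut a) (ball 0 1) := fun _ hz =>
  (hasFDerivAt_ballAut ha (mem_ball_zero_iff.1 hz).le).differentiableAt.differentiableWithinAt

/-- The differential is a scalar multiple of a rank one perturbation of the identity, whose
determinant is one plus the value of the linear form at the vector. The scalar has modulus `√(1 -
|a|²) / |1 - ⟨z, a⟩|` and contributes its power `finrank`; the perturbation contributes one more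
factor of the same modulus. -/
lemma det_fderiv_ballAut [FiniteDimensional ℂ E] {a z : E} (ha : ‖a‖ < 1) (hz : ‖z‖ ≤ 1) :
    ‖LinearMap.det (((1 - ⟪a, z⟫_ℂ)⁻¹ • (-ballLin a) +
        ((1 - ⟪a, z⟫_ℂ)⁻¹ ^ 2 • innerSL ℂ a).smulRight (a - ballLin a z) : E →L[ℂ] E) :
          E →ₗ[ℂ] E)‖ =
      (√(1 - ‖a‖ ^ 2) / ‖1 - ⟪a, z⟫_ℂ‖) ^ (Module.finrank ℂ E + 1) := by
  have h := one_sub_inner_ne_zero ha hz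
  have hL := ballLin_apply a z
  obtain ⟨σ, hs, hpos, haa, h1, h2, -⟩ := exists_sqrt_one_sub ha
  have hσ : (σ : ℂ) ≠ 0 := by exact_mod_cast hpos.ne'
  set x := ⟪a, z⟫_ℂ with hx
  -- The vector left over when the differential is divided by the scalar `-σ / (1 - x)` and the
  -- identity is removed.
  set v : E := ((σ : ℂ) * (1 + σ))⁻¹ • a - ((σ : ℂ) * (1 - x))⁻¹ • (a - ballLin a z) with hv
  have key : (((1 - x)⁻¹ • (-ballLin a) +
        ((1 - x)⁻¹ ^ 2 • innerSL ℂ a).smulRight (a - ballLin a z) : E →L[ℂ] E) :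
          E →ₗ[ℂ] E) = (-((σ : ℂ) / (1 - x))) •
            LinearMap.transvection (innerSL ℂ a : E →ₗ[ℂ] ℂ) v := by
    refine LinearMap.ext fun w => ?_
    change (1 - x)⁻¹ • (-ballLin a w) + ((1 - x)⁻¹ ^ 2 * ⟪a, w⟫_ℂ) • (a - ballLin a z) =
      (-((σ : ℂ) / (1 - x))) • (w + ⟪a, w⟫_ℂ • v)
    rw [ballLin_apply a w, hs, hv]
    push_cast
    match_scalars <;> field_simp
    ring
  have hfv : (innerSL ℂ a : E →ₗ[ℂ] ℂ) v = σ / (1 - x) - 1 := by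
    simp only [ContinuousLinearMap.coe_coe, innerSL_apply_apply, hv, inner_sub_right,
      inner_smul_right, inner_ballLin ha, haa, ← hx]
    field_simp
    ring
  rw [key, LinearMap.det_smul, LinearMap.transvection.det, hfv, add_sub_cancel, norm_mul,
    norm_pow, norm_neg, norm_div, hs, Complex.norm_real, Real.norm_of_nonneg hpos.le, pow_succ]

end BallAutomorphism

lemma one_sub_norm_sq_pos {E : Type*} [NormedAddCommGroup E] {z : E} (hz : ‖z‖ < 1) :
    0 < 1 - ‖z‖ ^ 2 := by
  nlinarith [norm_nonneg z]

/-! ### The Schwarz–Pick inequality -/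

section SchwarzPick

open scoped InnerProductSpace ComplexConjugate

variable {E : Type*} [NormedAddCommGroup E] [InnerProductSpace ℂ E]

/-- The Schwarz–Pick inequality in the unit ball. -/
lemma schwarz_pick_ball {φ : E → E} (hφ : DifferentiableOn ℂ φ (ball 0 1))
    (hmaps : Set.MapsTo φ (ball 0 1) (ball 0 1)) {a z : E} (ha : ‖a‖ < 1) (hz : ‖z‖ < 1) :
    ‖1 - ⟪φ a, φ z⟫_ℂ‖ ^ 2 * ((1 - ‖a‖ ^ 2) * (1 - ‖z‖ ^ 2)) ≤
      ‖1 - ⟪a, z⟫_ℂ‖ ^ 2 * ((1 - ‖φ a‖ ^ 2) * (1 - ‖φ z‖ ^ 2)) := by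
  have hφa : ‖φ a‖ < 1 := mem_ball_zero_iff.1 (hmaps (mem_ball_zero_iff.2 ha))
  have hφz : ‖φ z‖ < 1 := mem_ball_zero_iff.1 (hmaps (mem_ball_zero_iff.2 hz))
  -- Composition with the automorphisms moves `a` and `φ a` to the origin. The Schwarz lemma at the
  -- point `ballAut a z` then compares `ballAut (φ a) (φ z)` with `ballAut a z`.
  have hd : DifferentiableOn ℂ (ballAut (φ a) ∘ φ ∘ ballAut a) (ball 0 1) :=
    (differentiableOn_ballAut hφa).comp (hφ.comp (differentiableOn_ballAut ha)
      (mapsTo_ballAut ha)) (hmaps.comp (mapsTo_ballAut ha))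
  have hm : Set.MapsTo (ballAut (φ a) ∘ φ ∘ ballAut a) (ball 0 1) (closedBall 0 1) :=
    ((mapsTo_ballAut hφa).comp (hmaps.comp (mapsTo_ballAut ha))).mono_right ball_subset_closedBall
  have h0 : (ballAut (φ a) ∘ φ ∘ ballAut a) 0 = 0 := by
    simp [ballAut_zero, ballAut_self hφa]
  have h := Complex.norm_le_norm_of_mapsTo_ball hd hm h0 (norm_ballAut_lt_one ha hz)
  simp only [Function.comp_apply, ballAut_ballAut ha hz.le] at h
  have h1 : 1 - ‖ballAut a z‖ ^ 2 ≤ 1 - ‖ballAut (φ a) (φ z)‖ ^ 2 := by gcongr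
  have p1 : 0 < ‖1 - ⟪a, z⟫_ℂ‖ := norm_pos_iff.2 (one_sub_inner_ne_zero ha hz.le)
  have p2 : 0 < ‖1 - ⟪φ a, φ z⟫_ℂ‖ := norm_pos_iff.2 (one_sub_inner_ne_zero hφa hφz.le)
  rw [one_sub_norm_ballAut_sq ha hz.le, one_sub_norm_ballAut_sq hφa hφz.le,
    div_le_div_iff₀ (by positivity) (by positivity)] at h1
  linarith

end SchwarzPick

/-! ### Julia's lemma -/

section JuliaCaratheodory

open scoped InnerProductSpace ComplexConjugate

variable {N : ℕ} {φ : CSpace N → CSpace N} {ζ η : CSpace N}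

lemma eventually_le_quotient_of_lt_angularLiminf {d : ℝ}
    (hlt : ENNReal.ofReal d < angularLiminf φ ζ) :
    ∀ᶠ z in 𝓝[ball 0 1] ζ, d ≤ (1 - ‖φ z‖) / (1 - ‖z‖) := by
  filter_upwards [eventually_lt_of_lt_liminf hlt] with z hz
  by_contra! h
  exact absurd hz (not_lt.2 (ENNReal.ofReal_le_ofReal h.le))

/-- Julia's lemma in the ball, at a boundary point where the dilatation is finite. -/
lemma exists_julia (hφ : DifferentiableOn ℂ φ (ball 0 1))
    (hmaps : Set.MapsTo φ (ball 0 1) (ball 0 1)) (hζ : ‖ζ‖ = 1)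
    (hL : angularLiminf φ ζ < ∞) :
    ∃ η : CSpace N, ‖η‖ = 1 ∧ ∀ z : CSpace N, ‖z‖ < 1 →
      ‖1 - ⟪η, φ z⟫_ℂ‖ ^ 2 * (1 - ‖z‖ ^ 2) ≤
        (angularLiminf φ ζ).toReal * ‖1 - ⟪ζ, z⟫_ℂ‖ ^ 2 * (1 - ‖φ z‖ ^ 2) := by
  set d := (angularLiminf φ ζ).toReal
  have hd0 : 0 ≤ d := ENNReal.toReal_nonneg
  have hex : ∀ k : ℕ, ∃ z : CSpace N, ‖z‖ < 1 ∧ dist z ζ < 1 / ((k : ℝ) + 1) ∧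
      (1 - ‖φ z‖) / (1 - ‖z‖) ≤ d + 1 / ((k : ℝ) + 1) := by
    intro k
    have hk : (0 : ℝ) < 1 / ((k : ℝ) + 1) := by positivity
    have hlt : angularLiminf φ ζ < ENNReal.ofReal (d + 1 / ((k : ℝ) + 1)) := by
      rw [ENNReal.lt_ofReal_iff_toReal_lt hL.ne]; linarith
    have hf := frequently_lt_of_liminf_lt (by isBoundedDefault) hlt
    have he : ∀ᶠ z in 𝓝[ball 0 1] ζ, z ∈ ball (0 : CSpace N) 1 ∧ dist z ζ < 1 / ((k : ℝ) + 1) :=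
      (eventually_mem_nhdsWithin).and (nhdsWithin_le_nhds (ball_mem_nhds ζ hk))
    obtain ⟨z, hz1, hz2, hz3⟩ := (hf.and_eventually he).exists
    refine ⟨z, mem_ball_zero_iff.1 hz2, hz3, ?_⟩
    exact ((ENNReal.ofReal_lt_ofReal_iff (by positivity)).1 hz1).le
  choose z hz1 hz2 hz3 using hex
  have hlim0 : Tendsto (fun k : ℕ => 1 / ((k : ℝ) + 1)) atTop (𝓝 0) :=
    tendsto_one_div_add_atTop_nhds_zero_nat
  have hzlim : Tendsto z atTop (𝓝 ζ) :=
    tendsto_iff_dist_tendsto_zero.2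
      (squeeze_zero (fun _ => dist_nonneg) (fun k => (hz2 k).le) hlim0)
  have hφ1 : ∀ k, ‖φ (z k)‖ < 1 := fun k =>
    mem_ball_zero_iff.1 (hmaps (mem_ball_zero_iff.2 (hz1 k)))
  -- The target point is a cluster point of `φ` along a sequence realizing the liminf. Bounded
  -- quotients and `|z_k| → 1` force `|φ(z_k)| → 1`, so it lies on the sphere.
  obtain ⟨η, -, u, hu, hη⟩ := (isCompact_closedBall (0 : CSpace N) 1).tendsto_subseq
    (x := fun k => φ (z k)) (fun k => mem_closedBall_zero_iff.2 (hφ1 k).le)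
  have hzu := hzlim.comp hu.tendsto_atTop
  have hnz : Tendsto (fun k => ‖z (u k)‖) atTop (𝓝 1) := by
    rw [← hζ]; exact hzu.norm
  have hq : Tendsto (fun k => d + 1 / ((u k : ℝ) + 1)) atTop (𝓝 (d + 0)) :=
    tendsto_const_nhds.add (hlim0.comp hu.tendsto_atTop)
  have hle : ∀ k, 1 - ‖φ (z k)‖ ≤ (d + 1 / ((k : ℝ) + 1)) * (1 - ‖z k‖) := fun k =>
    (div_le_iff₀ (by linarith [hz1 k])).1 (hz3 k)
  have hη1 : ‖η‖ = 1 := by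
    refine tendsto_nhds_unique (f := fun k => ‖φ (z (u k))‖) hη.norm ?_
    have h1 : Tendsto (fun k => 1 - (d + 1 / ((u k : ℝ) + 1)) * (1 - ‖z (u k)‖)) atTop
        (𝓝 (1 - (d + 0) * (1 - 1))) := tendsto_const_nhds.sub (hq.mul (tendsto_const_nhds.sub hnz))
    have h2 : (1 : ℝ) - (d + 0) * (1 - 1) = 1 := by ring
    rw [h2] at h1
    refine tendsto_of_tendsto_of_tendsto_of_le_of_le h1 tendsto_const_nhds (fun k => ?_)
      (fun k => (hφ1 _).le)
    have := hle (u k)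
    simp only
    linarith
  refine ⟨η, hη1, fun w hw => ?_⟩
  have hφw : ‖φ w‖ < 1 := mem_ball_zero_iff.1 (hmaps (mem_ball_zero_iff.2 hw))
  -- Schwarz–Pick between `z_k` and `w`, divided by `1 - |z_k|`, has `1 + |z_k|` on the left and the
  -- dilatation quotient times `1 + |φ(z_k)|` on the right. Both sums tend to 2 and cancel in the
  -- limit.
  have hl : Tendsto (fun k => ‖1 - ⟪φ (z (u k)), φ w⟫_ℂ‖ ^ 2 * ((1 + ‖z (u k)‖) * (1 - ‖w‖ ^ 2)))
      atTop (𝓝 (‖1 - ⟪η, φ w⟫_ℂ‖ ^ 2 * ((1 + 1) * (1 - ‖w‖ ^ 2)))) :=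
    ((tendsto_const_nhds.sub (hη.inner tendsto_const_nhds)).norm.pow 2).mul
      ((tendsto_const_nhds.add hnz).mul tendsto_const_nhds)
  have hr : Tendsto (fun k => ‖1 - ⟪z (u k), w⟫_ℂ‖ ^ 2 *
      ((d + 1 / ((u k : ℝ) + 1)) * (1 + ‖φ (z (u k))‖) * (1 - ‖φ w‖ ^ 2)))
      atTop (𝓝 (‖1 - ⟪ζ, w⟫_ℂ‖ ^ 2 * ((d + 0) * (1 + ‖η‖) * (1 - ‖φ w‖ ^ 2)))) :=
    ((tendsto_const_nhds.sub (hzu.inner tendsto_const_nhds)).norm.pow 2).mul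
      ((hq.mul (tendsto_const_nhds.add hη.norm)).mul tendsto_const_nhds)
  have h := le_of_tendsto_of_tendsto' hl hr fun k => ?_
  · rw [hη1] at h
    nlinarith [h]
  · have h1 := schwarz_pick_ball hφ hmaps (hz1 (u k)) hw
    have h2 := hle (u k)
    have hpos : 0 < 1 - ‖z (u k)‖ := by linarith [hz1 (u k)]
    have h3 : ‖1 - ⟪z (u k), w⟫_ℂ‖ ^ 2 * ((1 - ‖φ (z (u k))‖ ^ 2) * (1 - ‖φ w‖ ^ 2)) ≤
        ‖1 - ⟪z (u k), w⟫_ℂ‖ ^ 2 * (((d + 1 / ((u k : ℝ) + 1)) * (1 - ‖z (u k)‖) *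
          (1 + ‖φ (z (u k))‖)) * (1 - ‖φ w‖ ^ 2)) := by
      have := one_sub_norm_sq_pos hφw
      have h4 : 1 - ‖φ (z (u k))‖ ^ 2 = (1 - ‖φ (z (u k))‖) * (1 + ‖φ (z (u k))‖) := by ring
      rw [h4]
      gcongr
    have h5 := h1.trans h3
    refine le_of_mul_le_mul_right ?_ hpos
    calc _ = ‖1 - ⟪φ (z (u k)), φ w⟫_ℂ‖ ^ 2 * ((1 - ‖z (u k)‖ ^ 2) * (1 - ‖w‖ ^ 2)) := by ring
      _ ≤ _ := h5
      _ = _ := by ring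

end JuliaCaratheodory

/-- A holomorphic function with nonnegative real part on a disc is controlled by its value at the
center. -/
lemma norm_le_of_re_nonneg {h : ℂ → ℂ} {c z : ℂ} {R : ℝ}
    (hd : DifferentiableOn ℂ h (ball c R)) (hre : ∀ w ∈ ball c R, 0 ≤ (h w).re)
    (hz : z ∈ ball c R) :
    ‖h z‖ ≤ ‖h c‖ * (R + ‖z - c‖) / (R - ‖z - c‖) := by
  have hzR : ‖z - c‖ < R := by simpa [dist_eq_norm] using hz
  have hR : 0 < R := (norm_nonneg _).trans_lt hzR
  have hmaps : Set.MapsTo (fun w => c + w) (ball 0 R) (ball c R) := fun w hw => by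
    simpa [dist_eq_norm] using hw
  have hd' : DifferentiableOn ℂ (fun w => -h (c + w)) (ball 0 R) :=
    (hd.comp (by fun_prop) hmaps).neg
  -- The real part of `-h` is bounded above by every `M > 0`, as Borel–Carathéodory requires; the
  -- term in `M` disappears when `M → 0`.
  have key : ∀ M : ℝ, 0 < M → ‖h z‖ ≤
      2 * M * ‖z - c‖ / (R - ‖z - c‖) + ‖h c‖ * (R + ‖z - c‖) / (R - ‖z - c‖) := by
    intro M hM
    have := Complex.borelCaratheodory (z := z - c) hM hd' (fun w hw => ?_) hR (by simpa using hzR)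
    · simpa using this
    · have := hre _ (hmaps hw)
      simp only [Set.mem_ofPred_eq, Complex.neg_re]
      linarith
  have hlim : Tendsto (fun M : ℝ => 2 * M * ‖z - c‖ / (R - ‖z - c‖) +
      ‖h c‖ * (R + ‖z - c‖) / (R - ‖z - c‖)) (𝓝[>] 0)
      (𝓝 (2 * 0 * ‖z - c‖ / (R - ‖z - c‖) + ‖h c‖ * (R + ‖z - c‖) / (R - ‖z - c‖))) := by
    refine Tendsto.mono_left ?_ nhdsWithin_le_nhds
    exact ((tendsto_id.const_mul 2).mul_const _ |>.div_const _).add_const _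
  have := ge_of_tendsto hlim (by filter_upwards [self_mem_nhdsWithin] with M hM using key M hM)
  simpa using this

/-! ### The nontangential Julia–Carathéodory theorem -/

section JuliaCaratheodory

open scoped InnerProductSpace ComplexConjugate

variable {N : ℕ} {φ : CSpace N → CSpace N} {ζ η : CSpace N} {d : ℝ}

/-- The conclusion of Julia's lemma: `φ` maps horoballs at `ζ` to horoballs at `η`, with
dilatation `d`, and `d` is a lower bound of the dilatation near `ζ`. -/
structure IsJuliaPoint (φ : CSpace N → CSpace N) (ζ η : CSpace N) (d : ℝ) : Prop where
  diff : DifferentiableOn ℂ φ (ball 0 1)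
  maps : Set.MapsTo φ (ball 0 1) (ball 0 1)
  norm_source : ‖ζ‖ = 1
  norm_target : ‖η‖ = 1
  nonneg : 0 ≤ d
  julia : ∀ z : CSpace N, ‖z‖ < 1 →
      ‖1 - ⟪η, φ z⟫_ℂ‖ ^ 2 * (1 - ‖z‖ ^ 2) ≤ d * ‖1 - ⟪ζ, z⟫_ℂ‖ ^ 2 * (1 - ‖φ z‖ ^ 2)
  lower : ∀ d' < d, ∀ᶠ z in 𝓝[ball 0 1] ζ, d' ≤ (1 - ‖φ z‖) / (1 - ‖z‖)

lemma exists_isJuliaPoint (hφ : DifferentiableOn ℂ φ (ball 0 1))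
    (hmaps : Set.MapsTo φ (ball 0 1) (ball 0 1)) (hζ : ‖ζ‖ = 1)
    (hL : angularLiminf φ ζ < ∞) :
    ∃ η : CSpace N, IsJuliaPoint φ ζ η (angularLiminf φ ζ).toReal := by
  obtain ⟨η, hη, hJ⟩ := exists_julia hφ hmaps hζ hL
  refine ⟨η, hφ, hmaps, hζ, hη, ENNReal.toReal_nonneg, hJ, fun d' hd' => ?_⟩
  by_cases h0 : 0 ≤ d'
  · exact eventually_le_quotient_of_lt_angularLiminf
      ((ENNReal.ofReal_lt_iff_lt_toReal h0 hL.ne).2 hd')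
  · filter_upwards [self_mem_nhdsWithin] with z hz
    have h1 : ‖z‖ < 1 := mem_ball_zero_iff.1 hz
    have h2 : ‖φ z‖ < 1 := mem_ball_zero_iff.1 (hmaps hz)
    have : 0 ≤ (1 - ‖φ z‖) / (1 - ‖z‖) := div_nonneg (by linarith) (by linarith)
    linarith

namespace IsJuliaPoint

variable (h : IsJuliaPoint φ ζ η d)

include h

lemma norm_apply_lt {z : CSpace N} (hz : ‖z‖ < 1) : ‖φ z‖ < 1 :=
  mem_ball_zero_iff.1 (h.maps (mem_ball_zero_iff.2 hz))

lemma norm_inner_le (z : CSpace N) : ‖⟪η, φ z⟫_ℂ‖ ≤ ‖φ z‖ := by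
  simpa [h.norm_target] using norm_inner_le_norm η (φ z)

lemma norm_smul_source (l : ℂ) : ‖l • ζ‖ = ‖l‖ := by rw [norm_smul, h.norm_source, mul_one]

lemma one_sub_inner_ne {z : CSpace N} (hz : ‖z‖ < 1) : 1 - ⟪η, φ z⟫_ℂ ≠ 0 := by
  intro h0
  have := (h.norm_inner_le z).trans_lt (h.norm_apply_lt hz)
  rw [← sub_eq_zero.1 h0] at this
  simp at this

lemma pos : 0 < d := by
  have h0 : ‖(0 : CSpace N)‖ < 1 := by simp
  have h1 := h.julia 0 h0
  have h2 : 0 < ‖1 - ⟪η, φ 0⟫_ℂ‖ := norm_pos_iff.2 (h.one_sub_inner_ne h0)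
  refine lt_of_le_of_ne h.nonneg fun hd => ?_
  rw [← hd] at h1
  simp at h1
  exact h.one_sub_inner_ne h0 h1

lemma julia_slice {l : ℂ} (hl : ‖l‖ < 1) :
    ‖1 - ⟪η, φ (l • ζ)⟫_ℂ‖ ^ 2 * (1 - ‖l‖ ^ 2) ≤
      d * ‖1 - l‖ ^ 2 * (1 - ‖φ (l • ζ)‖ ^ 2) := by
  have := h.julia (l • ζ) (by rwa [h.norm_smul_source])
  rwa [h.norm_smul_source, inner_smul_right, inner_self_eq_norm_sq_to_K, h.norm_source,
    RCLike.ofReal_one, one_pow, mul_one] at this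

/-- On the radius, with `x = |1 - ⟨φ, η⟩|`, Julia's lemma reads `x² t (2 - t) ≤ d t² (1 - |φ|²)`.
Since `1 - |φ|² ≤ 2 (1 - |φ|) ≤ 2x`, one factor `x t` can be divided out. -/
lemma norm_one_sub_inner_le {t : ℝ} (ht : t ∈ Set.Ioo (0 : ℝ) 1) :
    ‖1 - ⟪η, φ ((1 - (t : ℂ)) • ζ)⟫_ℂ‖ * (2 - t) ≤ 2 * d * t := by
  obtain ⟨ht0, ht1⟩ := ht
  have hn : ‖1 - (t : ℂ)‖ = 1 - t := by
    rw [← Complex.ofReal_one, ← Complex.ofReal_sub, Complex.norm_real,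
      Real.norm_of_nonneg (by linarith)]
  have hlt : ‖1 - (t : ℂ)‖ < 1 := by rw [hn]; linarith
  have hJ := h.julia_slice hlt
  have hz : ‖(1 - (t : ℂ)) • ζ‖ < 1 := by rwa [h.norm_smul_source]
  have h1 := h.norm_apply_lt hz
  have h2 : 1 - ‖φ ((1 - (t : ℂ)) • ζ)‖ ≤ ‖1 - ⟪η, φ ((1 - (t : ℂ)) • ζ)⟫_ℂ‖ := by
    have h3 := norm_sub_norm_le 1 ⟪η, φ ((1 - (t : ℂ)) • ζ)⟫_ℂ
    have h4 := h.norm_inner_le ((1 - (t : ℂ)) • ζ)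
    rw [norm_one] at h3
    linarith
  have h5 : 0 < ‖1 - ⟪η, φ ((1 - (t : ℂ)) • ζ)⟫_ℂ‖ := norm_pos_iff.2 (h.one_sub_inner_ne hz)
  rw [hn, sub_sub_cancel, Complex.norm_real, Real.norm_of_nonneg ht0.le] at hJ
  set x := ‖1 - ⟪η, φ ((1 - (t : ℂ)) • ζ)⟫_ℂ‖
  set y := ‖φ ((1 - (t : ℂ)) • ζ)‖
  have h6 : d * t ^ 2 * (1 - y ^ 2) ≤ d * t ^ 2 * (2 * x) := by
    have := h.pos
    have : 0 ≤ y := norm_nonneg _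
    gcongr
    nlinarith
  have h7 : (x * t) * (x * (2 - t)) ≤ (x * t) * (2 * d * t) := by nlinarith
  exact le_of_mul_le_mul_left h7 (by positivity)

lemma tendsto_slice (l : ℝ → ℂ) (hl : Tendsto l (𝓝[>] 0) (𝓝 1))
    (hlt : ∀ᶠ t in 𝓝[>] (0 : ℝ), ‖l t‖ < 1) :
    Tendsto (fun t => l t • ζ) (𝓝[>] 0) (𝓝[ball 0 1] ζ) := by
  refine tendsto_nhdsWithin_iff.2 ⟨?_, ?_⟩
  · simpa using hl.smul_const ζ
  · filter_upwards [hlt] with t ht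
    rwa [mem_ball_zero_iff, h.norm_smul_source]

/-- The radial case of the Julia–Carathéodory theorem. -/
lemma tendsto_radial_quotient :
    Tendsto (fun t : ℝ => (1 - ⟪η, φ ((1 - (t : ℂ)) • ζ)⟫_ℂ) / t) (𝓝[>] 0) (𝓝 d) := by
  have hdpos := h.pos
  have hIoo : ∀ᶠ t in 𝓝[>] (0 : ℝ), t ∈ Set.Ioo (0 : ℝ) 1 := Ioo_mem_nhdsGT one_pos
  have hnorm : ∀ t ∈ Set.Ioo (0 : ℝ) 1, ‖1 - (t : ℂ)‖ = 1 - t := by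
    intro t ht
    rw [← Complex.ofReal_one, ← Complex.ofReal_sub, Complex.norm_real,
      Real.norm_of_nonneg (by linarith [ht.2])]
  have hofReal : Tendsto (fun t : ℝ => (t : ℂ)) (𝓝[>] 0) (𝓝 0) :=
    (Complex.continuous_ofReal.tendsto' 0 0 (by simp)).mono_left nhdsWithin_le_nhds
  have hslice := h.tendsto_slice (fun t => 1 - (t : ℂ)) (by simpa using hofReal.const_sub 1) (by
    filter_upwards [hIoo] with t ht
    rw [hnorm t ht]; linarith [ht.1])
  -- Julia's lemma bounds `|q|` above by a quantity tending to `d`, and the definition of `d` as a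
  -- liminf bounds `Re q` below. Modulus and real part thus have the same limit `d`, and the
  -- expansion of `|q - d|²` gives `q → d`.
  set q : ℝ → ℂ := fun t => (1 - ⟪η, φ ((1 - (t : ℂ)) • ζ)⟫_ℂ) / t with hq
  have hupper : ∀ᶠ t in 𝓝[>] (0 : ℝ), ‖q t‖ ≤ 2 * d / (2 - t) := by
    filter_upwards [hIoo] with t ht
    rw [hq, norm_div, Complex.norm_real, Real.norm_of_nonneg ht.1.le,
      div_le_div_iff₀ ht.1 (by linarith [ht.2])]
    exact h.norm_one_sub_inner_le ht
  have hlower : ∀ d' < d, ∀ᶠ t in 𝓝[>] (0 : ℝ), d' ≤ (q t).re := by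
    intro d' hd'
    filter_upwards [hslice.eventually (h.lower d' hd'), hIoo] with t ht htI
    refine ht.trans ?_
    rw [h.norm_smul_source, hnorm t htI, sub_sub_cancel, hq, Complex.div_ofReal_re]
    have h4 := h.norm_inner_le ((1 - (t : ℂ)) • ζ)
    have h5 := Complex.re_le_norm ⟪η, φ ((1 - (t : ℂ)) • ζ)⟫_ℂ
    have := htI.1
    gcongr
    rw [Complex.sub_re, Complex.one_re]
    linarith
  have hlim : Tendsto (fun t : ℝ => 2 * d / (2 - t)) (𝓝[>] 0) (𝓝 d) := by
    have : Tendsto (fun t : ℝ => 2 * d / (2 - t)) (𝓝 0) (𝓝 (2 * d / (2 - 0))) :=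
      tendsto_const_nhds.div (tendsto_const_nhds.sub tendsto_id) (by norm_num)
    rw [sub_zero, mul_div_cancel_left₀ d two_ne_zero] at this
    exact this.mono_left nhdsWithin_le_nhds
  have hre : Tendsto (fun t => (q t).re) (𝓝[>] 0) (𝓝 d) := by
    refine tendsto_order.2 ⟨fun a ha => ?_, fun a ha => ?_⟩
    · obtain ⟨b, hab, hbd⟩ := exists_between ha
      filter_upwards [hlower b hbd] with t ht using hab.trans_le ht
    · filter_upwards [hupper, (tendsto_order.1 hlim).2 a ha] with t ht1 ht2
      exact ((Complex.re_le_norm _).trans ht1).trans_lt ht2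
  have hn : Tendsto (fun t => ‖q t‖) (𝓝[>] 0) (𝓝 d) :=
    tendsto_of_tendsto_of_tendsto_of_le_of_le' hre hlim
      (Eventually.of_forall fun t => Complex.re_le_norm _) hupper
  have hsq : Tendsto (fun t => ‖q t - d‖ ^ 2) (𝓝[>] 0) (𝓝 0) := by
    have h1 : ∀ t, ‖q t - d‖ ^ 2 = ‖q t‖ ^ 2 - 2 * d * (q t).re + d ^ 2 := by
      intro t
      rw [← Complex.normSq_eq_norm_sq, ← Complex.normSq_eq_norm_sq, Complex.normSq_apply,
        Complex.normSq_apply]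
      simp
      ring
    simp_rw [h1]
    have := ((hn.pow 2).sub (hre.const_mul (2 * d))).add_const (d ^ 2)
    convert this using 2
    ring
  rw [tendsto_iff_norm_sub_tendsto_zero]
  have := hsq.sqrt
  simpa [Real.sqrt_sq] using this

/-- The nontangential case of the Julia–Carathéodory theorem, along a straight path in the
complex line through the boundary point. -/
lemma tendsto_quotient {κ : ℂ} (hκ : κ.re = 1) :
    Tendsto (fun t : ℝ => (1 - ⟪η, φ ((1 - t * κ) • ζ)⟫_ℂ) / t) (𝓝[>] 0) (𝓝 (d * κ)) := by
  have hdpos := h.pos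
  have hdC : (d : ℂ) ≠ 0 := by exact_mod_cast hdpos.ne'
  have hκ0 : κ ≠ 0 := by rintro rfl; simp at hκ
  set ψ : ℂ → ℂ := fun l => ⟪η, φ (l • ζ)⟫_ℂ with hψ
  have hmaps : Set.MapsTo (fun l : ℂ => l • ζ) (ball 0 1) (ball 0 1) := fun l hl => by
    rw [mem_ball_zero_iff] at hl ⊢
    rwa [h.norm_smul_source]
  have hψd : DifferentiableOn ℂ ψ (ball 0 1) :=
    (innerSL ℂ η).differentiable.comp_differentiableOn (h.diff.comp (by fun_prop) hmaps)
  have hψne : ∀ l ∈ ball (0 : ℂ) 1, 1 - ψ l ≠ 0 := fun l hl =>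
    h.one_sub_inner_ne (by rw [h.norm_smul_source]; exact mem_ball_zero_iff.1 hl)
  have hlne : ∀ l ∈ ball (0 : ℂ) 1, 1 - l ≠ 0 := fun l hl h0 => by
    rw [← sub_eq_zero.1 h0] at hl
    simp at hl
  -- With `2 / (1 - w) - 1 = (1 + w) / (1 - w)`, this is a difference of Cayley transforms. As the
  -- real part of the latter is `(1 - |w|²) / |1 - w|²`, Julia's lemma says precisely that `Re H ≥
  -- 0`. The radial limit says that `H` has no pole part at 1, and Harnack's inequality carries this
  -- over to nontangential paths.
  set H : ℂ → ℂ := fun l => (2 / (1 - ψ l) - 1) - (d : ℂ)⁻¹ * (2 / (1 - l) - 1) with hH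
  have hHd : DifferentiableOn ℂ H (ball 0 1) := by
    have h1 : DifferentiableOn ℂ (fun l => 2 / (1 - ψ l)) (ball 0 1) :=
      (differentiableOn_const _).div (hψd.const_sub 1) hψne
    have h2 : DifferentiableOn ℂ (fun l : ℂ => 2 / (1 - l)) (ball 0 1) :=
      (differentiableOn_const _).div (differentiableOn_id.const_sub 1) hlne
    exact (h1.sub_const 1).sub ((h2.sub_const 1).const_mul _)
  have hre_formula : ∀ w : ℂ, 1 - w ≠ 0 → (2 / (1 - w) - 1).re = (1 - ‖w‖ ^ 2) / ‖1 - w‖ ^ 2 := by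
    intro w hw
    have hw' : Complex.normSq (1 - w) ≠ 0 := by simpa using hw
    rw [← Complex.normSq_eq_norm_sq, ← Complex.normSq_eq_norm_sq, Complex.sub_re, Complex.div_re,
      eq_div_iff hw', sub_mul, add_mul, div_mul_cancel₀ _ hw', div_mul_cancel₀ _ hw']
    simp only [Complex.normSq_apply, Complex.sub_re, Complex.sub_im, Complex.one_re,
      Complex.one_im, Complex.re_ofNat, Complex.im_ofNat]
    ring
  have hHre : ∀ l ∈ ball (0 : ℂ) 1, 0 ≤ (H l).re := by
    intro l hl
    have hl1 : ‖l‖ < 1 := mem_ball_zero_iff.1 hl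
    have hJ := h.julia_slice hl1
    rw [hH, Complex.sub_re, ← Complex.ofReal_inv, Complex.re_ofReal_mul, hre_formula _ (hψne l hl),
      hre_formula _ (hlne l hl), sub_nonneg, ← div_eq_inv_mul, div_div,
      div_le_div_iff₀ (mul_pos (by have := norm_pos_iff.2 (hlne l hl); positivity) hdpos)
        (by have := norm_pos_iff.2 (hψne l hl); positivity)]
    have h1 : ‖ψ l‖ ≤ ‖φ (l • ζ)‖ := h.norm_inner_le _
    have h2 : d * ‖1 - l‖ ^ 2 * (1 - ‖φ (l • ζ)‖ ^ 2) ≤ d * ‖1 - l‖ ^ 2 * (1 - ‖ψ l‖ ^ 2) := by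
      gcongr
    have h3 := hJ.trans h2
    linarith
  have hofReal : Tendsto (fun t : ℝ => (t : ℂ)) (𝓝[>] 0) (𝓝 0) :=
    (Complex.continuous_ofReal.tendsto' 0 0 (by simp)).mono_left nhdsWithin_le_nhds
  -- behaviour on the radius
  have hrad : Tendsto (fun t : ℝ => (t : ℂ) * H (1 - t)) (𝓝[>] 0) (𝓝 0) := by
    have h1 : Tendsto (fun t : ℝ => 2 * ((1 - ψ (1 - t)) / t)⁻¹ - t - (d : ℂ)⁻¹ * (2 - t))
        (𝓝[>] 0) (𝓝 (2 * (d : ℂ)⁻¹ - 0 - (d : ℂ)⁻¹ * (2 - 0))) :=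
      (((h.tendsto_radial_quotient.inv₀ hdC).const_mul 2).sub hofReal).sub
        ((hofReal.const_sub 2).const_mul _)
    have h2 : 2 * (d : ℂ)⁻¹ - 0 - (d : ℂ)⁻¹ * (2 - 0) = 0 := by ring
    rw [h2] at h1
    refine h1.congr' ?_
    filter_upwards [self_mem_nhdsWithin] with t ht
    have ht0 : (t : ℂ) ≠ 0 := by exact_mod_cast (ne_of_gt ht)
    simp only [hH, sub_sub_cancel, inv_div]
    field_simp
  -- The disc with center `1 - Lt` and radius `Lt` is internally tangent to the unit circle at 1.
  -- For `Re κ = 1`, the point `1 - tκ` lies in it exactly when `|L - κ| < L`, that is `1 + (Im κ)²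
  -- < 2L`, and its relative position is then independent of `t`.
  obtain ⟨L, hL1, hL2⟩ : ∃ L : ℝ, 0 < L ∧ 1 + κ.im ^ 2 < 2 * L :=
    ⟨1 + κ.im ^ 2, by positivity, by nlinarith [sq_nonneg κ.im]⟩
  have hκL : ‖(L : ℂ) - κ‖ < L := by
    refine lt_of_pow_lt_pow_left₀ 2 hL1.le ?_
    rw [← Complex.normSq_eq_norm_sq, Complex.normSq_apply]
    simp [hκ]
    nlinarith
  set ρ := ‖(L : ℂ) - κ‖ with hρ
  have hsmall : ∀ᶠ t in 𝓝[>] (0 : ℝ), 0 < t ∧ L * t ≤ 1 := by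
    filter_upwards [Ioo_mem_nhdsGT (inv_pos.2 hL1)] with t ht
    refine ⟨ht.1, ?_⟩
    calc L * t ≤ L * L⁻¹ := by gcongr; exact ht.2.le
      _ = 1 := mul_inv_cancel₀ hL1.ne'
  have hsub : ∀ t : ℝ, 0 < t → L * t ≤ 1 → ball (1 - ((L * t : ℝ) : ℂ)) (L * t) ⊆ ball 0 1 := by
    intro t ht htL
    refine ball_subset_ball' ?_
    rw [dist_zero_right, ← Complex.ofReal_one, ← Complex.ofReal_sub, Complex.norm_real,
      Real.norm_of_nonneg (by linarith)]
    linarith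
  have hmem : ∀ t : ℝ, 0 < t → (1 - t * κ : ℂ) - (1 - ((L * t : ℝ) : ℂ)) = t * (L - κ) := by
    intro t ht
    push_cast; ring
  -- Harnack on that disc has the ratio `(Lt + tρ) / (Lt - tρ)`, in which `t` cancels; the extra `L`
  -- in the denominator comes from trading the factor `t` for `Lt`.
  have hbound : ∀ᶠ t : ℝ in 𝓝[>] (0 : ℝ), ‖(t : ℂ) * H (1 - t * κ)‖ ≤
      ‖((L * t : ℝ) : ℂ) * H (1 - ((L * t : ℝ) : ℂ))‖ * ((L + ρ) / (L * (L - ρ))) := by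
    filter_upwards [hsmall] with t ht
    have hn : ‖(1 - t * κ : ℂ) - (1 - ((L * t : ℝ) : ℂ))‖ = t * ρ := by
      rw [hmem t ht.1, norm_mul, Complex.norm_real, Real.norm_of_nonneg ht.1.le]
    have hz : (1 - t * κ : ℂ) ∈ ball (1 - ((L * t : ℝ) : ℂ)) (L * t) := by
      rw [mem_ball, dist_eq_norm, hn]
      nlinarith [ht.1]
    have := norm_le_of_re_nonneg (hHd.mono (hsub t ht.1 ht.2))
      (fun w hw => hHre w (hsub t ht.1 ht.2 hw)) hz
    rw [hn] at this
    rw [norm_mul, norm_mul, Complex.norm_real, Complex.norm_real, Real.norm_of_nonneg ht.1.le,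
      Real.norm_of_nonneg (mul_pos hL1 ht.1).le]
    refine (mul_le_mul_of_nonneg_left this ht.1.le).trans_eq ?_
    have h1 : L - ρ ≠ 0 := by linarith
    have h2 : L * t - t * ρ ≠ 0 := by
      have : L * t - t * ρ = t * (L - ρ) := by ring
      rw [this]; exact mul_ne_zero ht.1.ne' h1
    have h3 := ht.1.ne'
    field_simp
  have hLt : Tendsto (fun t : ℝ => L * t) (𝓝[>] 0) (𝓝[>] 0) := by
    refine tendsto_nhdsWithin_iff.2 ⟨?_, ?_⟩
    · have : Tendsto (fun t : ℝ => L * t) (𝓝 0) (𝓝 (L * 0)) := tendsto_id.const_mul L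
      rw [mul_zero] at this
      exact this.mono_left nhdsWithin_le_nhds
    · filter_upwards [self_mem_nhdsWithin] with t ht using mul_pos hL1 ht
  have hH0 : Tendsto (fun t : ℝ => (t : ℂ) * H (1 - t * κ)) (𝓝[>] 0) (𝓝 0) := by
    refine squeeze_zero_norm' hbound ?_
    have := (hrad.comp hLt).norm.mul_const ((L + ρ) / (L * (L - ρ)))
    simpa using this
  -- Solving the definition of `H` for `t / (1 - ψ)` expresses the inverse quotient through `t H`,
  -- which tends to zero.
  have hfin : Tendsto (fun t : ℝ => ((t : ℂ) * H (1 - t * κ) + t +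
      (d : ℂ)⁻¹ * (2 * κ⁻¹ - t)) / 2) (𝓝[>] 0)
      (𝓝 ((0 + 0 + (d : ℂ)⁻¹ * (2 * κ⁻¹ - 0)) / 2)) :=
    ((hH0.add hofReal).add ((hofReal.const_sub _).const_mul _)).div_const 2
  have hne : (0 + 0 + (d : ℂ)⁻¹ * (2 * κ⁻¹ - 0)) / 2 ≠ 0 := by
    simp [hκ0, hdC]
  have hlimval : ((0 + 0 + (d : ℂ)⁻¹ * (2 * κ⁻¹ - 0)) / 2)⁻¹ = d * κ := by
    field_simp; simp
  have := hfin.inv₀ hne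
  rw [hlimval] at this
  refine this.congr' ?_
  filter_upwards [hsmall] with t ht
  have ht0 : (t : ℂ) ≠ 0 := by exact_mod_cast ht.1.ne'
  have hz : (1 - t * κ : ℂ) ∈ ball (0 : ℂ) 1 := by
    refine hsub t ht.1 ht.2 ?_
    rw [mem_ball, dist_eq_norm, hmem t ht.1, norm_mul, Complex.norm_real,
      Real.norm_of_nonneg ht.1.le]
    nlinarith [ht.1]
  have hne1 := hψne _ hz
  have : ((t : ℂ) * H (1 - t * κ) + t + (d : ℂ)⁻¹ * (2 * κ⁻¹ - t)) / 2 =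
      t / (1 - ψ (1 - t * κ)) := by
    simp only [hH, sub_sub_cancel]
    field_simp
    ring
  rw [this, inv_div]

end IsJuliaPoint

end JuliaCaratheodory

/-! ### Asymptotics of kernels along nontangential paths -/

section KernelAsymptotics

open scoped InnerProductSpace ComplexConjugate

lemma Complex.ofReal_mul_cpow_ofReal {r : ℝ} (hr : 0 < r) {z : ℂ} (hz : z ≠ 0) (x : ℝ) :
    ((r : ℂ) * z) ^ (x : ℂ) = ((r ^ x : ℝ) : ℂ) * z ^ (x : ℂ) := by
  have hr' : (r : ℂ) ≠ 0 := by exact_mod_cast hr.ne'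
  rw [Complex.cpow_def_of_ne_zero (mul_ne_zero hr' hz), Complex.cpow_def_of_ne_zero hz,
    Complex.log_ofReal_mul hr hz, add_mul, Complex.exp_add, Complex.ofReal_cpow hr.le,
    Complex.cpow_def_of_ne_zero hr', Complex.ofReal_log hr.le]

/-- The reproducing kernel `(1 - ⟨z, a⟩)^(-β)` of the unit ball. -/
noncomputable def ballKernel {E : Type*} [NormedAddCommGroup E] [InnerProductSpace ℂ E]
    (β : ℝ) (a z : E) : ℂ := (1 - ⟪a, z⟫_ℂ) ^ ((-β : ℝ) : ℂ)

section

variable {E : Type*} [NormedAddCommGroup E] [InnerProductSpace ℂ E]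

/-- Keeps the base of the kernel in the right half plane, so that the principal power is holomorphic
and commutes with conjugation and inversion. -/
lemma one_sub_inner_re_pos {a z : E} (ha : ‖a‖ < 1) (hz : ‖z‖ ≤ 1) : 0 < (1 - ⟪a, z⟫_ℂ).re := by
  have := (Complex.re_le_norm ⟪a, z⟫_ℂ).trans_lt (norm_inner_lt_one ha hz)
  simp only [Complex.sub_re, Complex.one_re]
  linarith

lemma norm_ballKernel (β : ℝ) (a z : E) :
    ‖ballKernel β a z‖ = ‖1 - ⟪a, z⟫_ℂ‖ ^ (-β) := by
  rw [ballKernel, Complex.norm_cpow_real]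

lemma conj_ballKernel (β : ℝ) {a z : E} (ha : ‖a‖ < 1) (hz : ‖z‖ ≤ 1) :
    conj (ballKernel β a z) = ballKernel β z a := by
  have h := one_sub_inner_re_pos ha hz
  have harg : (1 - ⟪a, z⟫_ℂ).arg ≠ Real.pi := by
    intro h1
    rw [Complex.arg_eq_pi_iff] at h1
    linarith [h1.1]
  have := Complex.conj_cpow (1 - ⟪a, z⟫_ℂ) ((-β : ℝ) : ℂ) harg
  rw [Complex.conj_ofReal] at this
  rw [ballKernel, ballKernel, ← this, map_sub, map_one, inner_conj_symm]

/-- The kernel, normalized by the boundary distance of a base point `w`. -/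
lemma normalized_ballKernel (β : ℝ) {w a z : E} (hw : ‖w‖ < 1) (ha : ‖a‖ < 1) (hz : ‖z‖ ≤ 1) :
    (((1 - ‖w‖ ^ 2) ^ β : ℝ) : ℂ) * ballKernel β a z =
      ((1 - ⟪a, z⟫_ℂ) / (1 - ‖w‖ ^ 2 : ℝ)) ^ ((-β : ℝ) : ℂ) := by
  have hw' := one_sub_norm_sq_pos hw
  rw [div_eq_inv_mul, ← Complex.ofReal_inv, Complex.ofReal_mul_cpow_ofReal (inv_pos.2 hw')
    (one_sub_inner_ne_zero ha hz), Real.inv_rpow hw'.le, Real.rpow_neg hw'.le, inv_inv, ballKernel]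

lemma norm_normalized_ballKernel (β : ℝ) {w a z : E} (hw : ‖w‖ < 1) (ha : ‖a‖ < 1)
    (hz : ‖z‖ ≤ 1) :
    ‖(((1 - ‖w‖ ^ 2) ^ β : ℝ) : ℂ) * ballKernel β a z‖ =
      ((1 - ‖w‖ ^ 2) / ‖1 - ⟪a, z⟫_ℂ‖) ^ β := by
  have hw' := one_sub_norm_sq_pos hw
  rw [normalized_ballKernel β hw ha hz, Complex.norm_cpow_real, norm_div, Complex.norm_real,
    Real.norm_of_nonneg hw'.le, Real.rpow_neg (by positivity), ← Real.inv_rpow (by positivity),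
    inv_div]

end

variable {N : ℕ} {φ ψ : CSpace N → CSpace N} {ζ η η' : CSpace N} {d d' : ℝ} {κ : ℂ}

/-- The nontangential path `(1 - tκ)ζ` towards `ζ`. -/
noncomputable def stolzPath (ζ : CSpace N) (κ : ℂ) (t : ℝ) : CSpace N := (1 - t * κ) • ζ

lemma one_sub_norm_stolzPath_sq (hζ : ‖ζ‖ = 1) (hκ : κ.re = 1) (t : ℝ) :
    1 - ‖stolzPath ζ κ t‖ ^ 2 = t * (2 - t * (1 + κ.im ^ 2)) := by
  rw [stolzPath, norm_smul, hζ, mul_one, ← Complex.normSq_eq_norm_sq, Complex.normSq_apply]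
  simp [hκ]
  ring

lemma eventually_norm_stolzPath_lt (hζ : ‖ζ‖ = 1) (hκ : κ.re = 1) :
    ∀ᶠ t in 𝓝[>] (0 : ℝ), ‖stolzPath ζ κ t‖ < 1 := by
  have h : (0 : ℝ) < 2 / (1 + κ.im ^ 2) := by positivity
  filter_upwards [Ioo_mem_nhdsGT h] with t ht
  have h1 := one_sub_norm_stolzPath_sq hζ hκ t
  have h2 : t * (1 + κ.im ^ 2) < 2 := (lt_div_iff₀ (by positivity)).1 ht.2
  have h3 : 0 < t * (2 - t * (1 + κ.im ^ 2)) := mul_pos ht.1 (by linarith)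
  nlinarith [norm_nonneg (stolzPath ζ κ t)]

lemma tendsto_one_sub_norm_stolzPath_sq_div (hζ : ‖ζ‖ = 1) (hκ : κ.re = 1) :
    Tendsto (fun t => (1 - ‖stolzPath ζ κ t‖ ^ 2) / t) (𝓝[>] 0) (𝓝 2) := by
  have h : Tendsto (fun t : ℝ => 2 - t * (1 + κ.im ^ 2)) (𝓝[>] 0) (𝓝 2) := by
    have : Continuous (fun t : ℝ => 2 - t * (1 + κ.im ^ 2)) := by fun_prop
    exact (this.tendsto' 0 2 (by simp)).mono_left nhdsWithin_le_nhds
  refine h.congr' ?_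
  filter_upwards [self_mem_nhdsWithin] with t ht
  rw [one_sub_norm_stolzPath_sq hζ hκ, mul_div_cancel_left₀ _ (ne_of_gt ht)]

lemma tendsto_one_sub_norm_stolzPath_sq (hζ : ‖ζ‖ = 1) (hκ : κ.re = 1) :
    Tendsto (fun t => 1 - ‖stolzPath ζ κ t‖ ^ 2) (𝓝[>] 0) (𝓝 0) := by
  have : Continuous (fun t : ℝ => t * (2 - t * (1 + κ.im ^ 2))) := by fun_prop
  simp_rw [one_sub_norm_stolzPath_sq hζ hκ]
  exact (this.tendsto' 0 0 (by simp)).mono_left nhdsWithin_le_nhds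

lemma tendsto_stolzPath (hζ : ‖ζ‖ = 1) (hκ : κ.re = 1) :
    Tendsto (stolzPath ζ κ) (𝓝[>] 0) (𝓝[ball 0 1] ζ) := by
  refine tendsto_nhdsWithin_iff.2 ⟨?_, ?_⟩
  · have : Continuous (stolzPath ζ κ) := by unfold stolzPath; fun_prop
    exact (this.tendsto' 0 ζ (by simp [stolzPath])).mono_left nhdsWithin_le_nhds
  · filter_upwards [eventually_norm_stolzPath_lt hζ hκ] with t ht
    exact mem_ball_zero_iff.2 ht

namespace IsJuliaPoint

lemma tendsto_one_sub_inner_stolzPath (h : IsJuliaPoint φ ζ η d) (hκ : κ.re = 1) :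
    Tendsto (fun t => 1 - ⟪η, φ (stolzPath ζ κ t)⟫_ℂ) (𝓝[>] 0) (𝓝 0) := by
  have hofReal : Tendsto (fun t : ℝ => (t : ℂ)) (𝓝[>] 0) (𝓝 0) :=
    (Complex.continuous_ofReal.tendsto' 0 0 (by simp)).mono_left nhdsWithin_le_nhds
  have := (h.tendsto_quotient hκ).mul hofReal
  rw [mul_zero] at this
  refine this.congr' ?_
  filter_upwards [self_mem_nhdsWithin] with t ht
  have : (t : ℂ) ≠ 0 := by exact_mod_cast (ne_of_gt ht)
  rw [div_mul_cancel₀ _ this, stolzPath]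

/-- Since `η` is a unit vector and `|φ| < 1`, one has `|φ - η|² ≤ 2 Re (1 - ⟨φ, η⟩)`, so convergence
of the component along `η` is enough. -/
lemma tendsto_apply_stolzPath (h : IsJuliaPoint φ ζ η d) (hκ : κ.re = 1) :
    Tendsto (fun t => φ (stolzPath ζ κ t)) (𝓝[>] 0) (𝓝 η) := by
  rw [tendsto_iff_norm_sub_tendsto_zero]
  have h1 : Tendsto (fun t => √(2 * ‖1 - ⟪η, φ (stolzPath ζ κ t)⟫_ℂ‖)) (𝓝[>] 0) (𝓝 0) := by
    have := ((h.tendsto_one_sub_inner_stolzPath hκ).norm.const_mul 2).sqrt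
    simpa using this
  refine squeeze_zero' (Eventually.of_forall fun _ => norm_nonneg _) ?_ h1
  filter_upwards [eventually_norm_stolzPath_lt h.norm_source hκ] with t ht
  refine Real.le_sqrt_of_sq_le ?_
  have h2 := h.norm_apply_lt ht
  have h3 := Complex.re_le_norm (1 - ⟪η, φ (stolzPath ζ κ t)⟫_ℂ)
  rw [← norm_neg, neg_sub, @norm_sub_sq ℂ, h.norm_target]
  simp only [Complex.sub_re, Complex.one_re, RCLike.re_to_complex] at h3 ⊢
  nlinarith [norm_nonneg (φ (stolzPath ζ κ t))]

lemma norm_tangential_sq (h : IsJuliaPoint φ ζ η d) (z : CSpace N) :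
    ‖φ z - ⟪η, φ z⟫_ℂ • η‖ ^ 2 = ‖φ z‖ ^ 2 - ‖⟪η, φ z⟫_ℂ‖ ^ 2 := by
  rw [@norm_sub_sq ℂ, inner_smul_right, ← inner_conj_symm (φ z) η, Complex.mul_conj, norm_smul,
    h.norm_target, Complex.normSq_eq_norm_sq, RCLike.re_to_complex, Complex.ofReal_re]
  ring

/-- Julia's lemma is asymptotically an equality on the path: with `x = ⟨φ, η⟩`, both `1 - |x|²` and
Julia's lower bound for `1 - |φ|²` are `2dt + o(t)`. Their difference bounds the squared orthogonal
component. -/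
lemma tendsto_norm_tangential_sq_div (h : IsJuliaPoint φ ζ η d) (hκ : κ.re = 1) :
    Tendsto (fun t => ‖φ (stolzPath ζ κ t) -
      ⟪η, φ (stolzPath ζ κ t)⟫_ℂ • η‖ ^ 2 / t) (𝓝[>] 0) (𝓝 0) := by
  have hd := h.pos
  have hκ0 : κ ≠ 0 := by rintro rfl; simp at hκ
  have hκn : ‖κ‖ ≠ 0 := norm_ne_zero_iff.2 hκ0
  have hq := h.tendsto_quotient hκ
  have h0 := h.tendsto_one_sub_inner_stolzPath hκ
  -- upper bound of `(1 - |ψ|²) / t`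
  have h1 : Tendsto (fun t : ℝ => 2 * ((1 - ⟪η, φ ((1 - t * κ) • ζ)⟫_ℂ) / t).re -
      ‖(1 - ⟪η, φ ((1 - t * κ) • ζ)⟫_ℂ) / t‖ * ‖1 - ⟪η, φ (stolzPath ζ κ t)⟫_ℂ‖) (𝓝[>] 0)
      (𝓝 (2 * (d * κ).re - ‖d * κ‖ * ‖(0 : ℂ)‖)) :=
    (((Complex.continuous_re.tendsto _).comp hq).const_mul 2).sub (hq.norm.mul h0.norm)
  have h2 : Tendsto (fun t : ℝ => ‖(1 - ⟪η, φ ((1 - t * κ) • ζ)⟫_ℂ) / t‖ ^ 2 *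
      ((1 - ‖stolzPath ζ κ t‖ ^ 2) / t) * (d * ‖κ‖ ^ 2)⁻¹) (𝓝[>] 0)
      (𝓝 (‖d * κ‖ ^ 2 * 2 * (d * ‖κ‖ ^ 2)⁻¹)) :=
    ((hq.norm.pow 2).mul
      (tendsto_one_sub_norm_stolzPath_sq_div h.norm_source hκ)).mul_const _
  have h3 := h1.sub h2
  have h4 : (2 * (d * κ).re - ‖d * κ‖ * ‖(0 : ℂ)‖) - ‖d * κ‖ ^ 2 * 2 * (d * ‖κ‖ ^ 2)⁻¹ = 0 := by
    rw [norm_mul, Complex.norm_real, Real.norm_of_nonneg hd.le, Complex.re_ofReal_mul, hκ]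
    simp
    field_simp
    ring
  rw [h4] at h3
  refine squeeze_zero' ?_ ?_ h3
  · filter_upwards [self_mem_nhdsWithin] with t ht
    have : 0 < t := ht
    positivity
  · filter_upwards [self_mem_nhdsWithin, eventually_norm_stolzPath_lt h.norm_source hκ]
      with t ht hlt
    have ht0 : 0 < t := ht
    rw [h.norm_tangential_sq]
    have hl : ‖(1 - t * κ : ℂ)‖ < 1 := by
      rwa [stolzPath, h.norm_smul_source] at hlt
    have hJ := h.julia_slice hl
    have hn : ‖stolzPath ζ κ t‖ = ‖(1 - t * κ : ℂ)‖ := by rw [stolzPath, h.norm_smul_source]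
    rw [← hn, sub_sub_cancel, norm_mul, Complex.norm_real, Real.norm_of_nonneg ht0.le] at hJ
    change _ ≤ 2 * ((1 - ⟪η, φ (stolzPath ζ κ t)⟫_ℂ) / t).re -
      ‖(1 - ⟪η, φ (stolzPath ζ κ t)⟫_ℂ) / t‖ * ‖1 - ⟪η, φ (stolzPath ζ κ t)⟫_ℂ‖ -
      ‖(1 - ⟪η, φ (stolzPath ζ κ t)⟫_ℂ) / t‖ ^ 2 * _ * _
    change ‖1 - ⟪η, φ (stolzPath ζ κ t)⟫_ℂ‖ ^ 2 * _ ≤ d * _ * (1 - ‖φ (stolzPath ζ κ t)‖ ^ 2) at hJ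
    set x := ⟪η, φ (stolzPath ζ κ t)⟫_ℂ
    have hx : ‖x‖ ^ 2 = 1 - 2 * (1 - x).re + ‖1 - x‖ ^ 2 := by
      rw [← Complex.normSq_eq_norm_sq, ← Complex.normSq_eq_norm_sq, Complex.normSq_apply,
        Complex.normSq_apply]
      simp
      ring
    rw [Complex.div_ofReal_re, norm_div, Complex.norm_real, Real.norm_of_nonneg ht0.le]
    have h5 : ‖1 - x‖ ^ 2 * (1 - ‖stolzPath ζ κ t‖ ^ 2) / (d * (t * ‖κ‖) ^ 2) ≤
        1 - ‖φ (stolzPath ζ κ t)‖ ^ 2 := by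
      rw [div_le_iff₀ (by positivity)]
      linarith
    have h6 : 2 * ((1 - x).re / t) - ‖1 - x‖ / t * ‖1 - x‖ -
        (‖1 - x‖ / t) ^ 2 * ((1 - ‖stolzPath ζ κ t‖ ^ 2) / t) * (d * ‖κ‖ ^ 2)⁻¹ =
        (2 * (1 - x).re - ‖1 - x‖ ^ 2 -
          ‖1 - x‖ ^ 2 * (1 - ‖stolzPath ζ κ t‖ ^ 2) / (d * (t * ‖κ‖) ^ 2)) / t := by
      field_simp
    rw [h6]
    exact div_le_div_of_nonneg_right (by linarith) ht0.le

/-- Split both vectors along `η`. With components `u`, `v` along `η`, `1 - conj u · v = (1 - v) +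
conj (1 - u) - (1 - v) conj (1 - u)`; the product is `o(t)`, and so is the inner product of the
orthogonal parts, by Cauchy–Schwarz. -/
lemma tendsto_inner_quotient (hφ : IsJuliaPoint φ ζ η d) (hψ : IsJuliaPoint ψ ζ η d')
    (hκ : κ.re = 1) :
    Tendsto (fun t : ℝ => (1 - ⟪φ (stolzPath ζ κ t), ψ (stolzPath ζ κ t)⟫_ℂ) / t) (𝓝[>] 0)
      (𝓝 (d' * κ + d * conj κ)) := by
  have h1 := hψ.tendsto_quotient hκ
  have h2 := (Complex.continuous_conj.tendsto _).comp (hφ.tendsto_quotient hκ)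
  have h3 := h1.mul ((Complex.continuous_conj.tendsto _).comp
    (hφ.tendsto_one_sub_inner_stolzPath hκ))
  have h4 : Tendsto (fun t : ℝ => ⟪φ (stolzPath ζ κ t) - ⟪η, φ (stolzPath ζ κ t)⟫_ℂ • η,
      ψ (stolzPath ζ κ t) - ⟪η, ψ (stolzPath ζ κ t)⟫_ℂ • η⟫_ℂ / t) (𝓝[>] 0) (𝓝 0) := by
    have h5 := ((hφ.tendsto_norm_tangential_sq_div hκ).sqrt).mul
      ((hψ.tendsto_norm_tangential_sq_div hκ).sqrt)
    rw [Real.sqrt_zero, mul_zero] at h5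
    refine squeeze_zero_norm' ?_ h5
    filter_upwards [self_mem_nhdsWithin] with t ht
    have ht0 : 0 < t := ht
    rw [norm_div, Complex.norm_real, Real.norm_of_nonneg ht0.le, Real.sqrt_div (by positivity),
      Real.sqrt_div (by positivity), Real.sqrt_sq (norm_nonneg _), Real.sqrt_sq (norm_nonneg _),
      div_mul_div_comm, Real.mul_self_sqrt ht0.le]
    gcongr
    exact norm_inner_le_norm _ _
  have h6 := ((h1.add h2).sub h3).sub h4
  have h7 : (d' * κ + conj ((d : ℂ) * κ) - d' * κ * conj (0 : ℂ) - 0) = d' * κ + d * conj κ := by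
    simp
  rw [h7] at h6
  refine h6.congr' ?_
  filter_upwards [self_mem_nhdsWithin] with t ht
  have ht0 : (t : ℂ) ≠ 0 := by exact_mod_cast (ne_of_gt ht)
  simp only [Function.comp_apply]
  change (1 - ⟪η, ψ (stolzPath ζ κ t)⟫_ℂ) / t + conj ((1 - ⟪η, φ (stolzPath ζ κ t)⟫_ℂ) / t) -
    (1 - ⟪η, ψ (stolzPath ζ κ t)⟫_ℂ) / t * _ - _ = _
  rw [inner_sub_left, inner_sub_right, inner_sub_right, inner_smul_left, inner_smul_left,
    inner_smul_right, inner_smul_right, inner_self_eq_norm_sq_to_K, hφ.norm_target, map_div₀,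
    Complex.conj_ofReal, map_sub, map_one, ← inner_conj_symm (φ (stolzPath ζ κ t)) η]
  field_simp
  simp
  ring

end IsJuliaPoint

/-- The limit of the normalized kernel along a nontangential path: equal boundary values. -/
lemma tendsto_normalized_ballKernel_same (β : ℝ) (hφ : IsJuliaPoint φ ζ η d)
    (hψ : IsJuliaPoint ψ ζ η d') (hκ : κ.re = 1) :
    Tendsto (fun t : ℝ => (((1 - ‖stolzPath ζ κ t‖ ^ 2) ^ β : ℝ) : ℂ) *
      ballKernel β (φ (stolzPath ζ κ t)) (ψ (stolzPath ζ κ t))) (𝓝[>] 0)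
      (𝓝 (((d' * κ + d * conj κ) / 2) ^ ((-β : ℝ) : ℂ))) := by
  have h1 := hφ.tendsto_inner_quotient hψ hκ
  have h2 : Tendsto (fun t => (((1 - ‖stolzPath ζ κ t‖ ^ 2) / t : ℝ) : ℂ)) (𝓝[>] 0) (𝓝 2) :=
    (Complex.continuous_ofReal.tendsto' _ _ (by simp)).comp
      (tendsto_one_sub_norm_stolzPath_sq_div hφ.norm_source hκ)
  have h3 := h1.div h2 two_ne_zero
  -- The real part is `(d' + d) / 2 > 0`, which keeps the limit off the branch cut.
  have hslit : (d' * κ + d * conj κ) / 2 ∈ Complex.slitPlane := by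
    left
    have := hφ.pos
    have := hψ.pos
    rw [Complex.div_ofNat_re, Complex.add_re, Complex.re_ofReal_mul, Complex.re_ofReal_mul,
      Complex.conj_re, hκ]
    positivity
  refine (h3.cpow tendsto_const_nhds hslit).congr' ?_
  filter_upwards [self_mem_nhdsWithin, eventually_norm_stolzPath_lt hφ.norm_source hκ]
    with t ht hlt
  have ht0 : (t : ℂ) ≠ 0 := by exact_mod_cast (ne_of_gt ht)
  rw [normalized_ballKernel β hlt (hφ.norm_apply_lt hlt) (hψ.norm_apply_lt hlt).le]
  congr 1
  simp only [Pi.div_apply]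
  push_cast
  rw [div_div_div_cancel_right₀ ht0]

lemma tendsto_normalized_ballKernel_zero {β : ℝ} (hβ : 0 < β)
    (hφ : Set.MapsTo φ (ball 0 1) (ball 0 1)) (hψ : Set.MapsTo ψ (ball 0 1) (ball 0 1))
    (hζ : ‖ζ‖ = 1) (hκ : κ.re = 1)
    (h : Tendsto (fun t => (1 - ‖stolzPath ζ κ t‖ ^ 2) /
      ‖1 - ⟪φ (stolzPath ζ κ t), ψ (stolzPath ζ κ t)⟫_ℂ‖) (𝓝[>] 0) (𝓝 0)) :
    Tendsto (fun t : ℝ => (((1 - ‖stolzPath ζ κ t‖ ^ 2) ^ β : ℝ) : ℂ) *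
      ballKernel β (φ (stolzPath ζ κ t)) (ψ (stolzPath ζ κ t))) (𝓝[>] 0) (𝓝 0) := by
  rw [tendsto_zero_iff_norm_tendsto_zero]
  have h1 := h.rpow_const (p := β) (Or.inr hβ.le)
  rw [Real.zero_rpow hβ.ne'] at h1
  refine h1.congr' ?_
  filter_upwards [eventually_norm_stolzPath_lt hζ hκ] with t hlt
  have := mem_ball_zero_iff.2 hlt
  rw [norm_normalized_ballKernel β hlt (mem_ball_zero_iff.1 (hφ this))
    (mem_ball_zero_iff.1 (hψ this)).le]

/-- The limit of the normalized kernel along a nontangential path: distinct boundary values. -/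
lemma tendsto_normalized_ballKernel_ne {β : ℝ} (hβ : 0 < β) (hφ : IsJuliaPoint φ ζ η d)
    (hψ : IsJuliaPoint ψ ζ η' d') (hne : η ≠ η') (hκ : κ.re = 1) :
    Tendsto (fun t : ℝ => (((1 - ‖stolzPath ζ κ t‖ ^ 2) ^ β : ℝ) : ℂ) *
      ballKernel β (φ (stolzPath ζ κ t)) (ψ (stolzPath ζ κ t))) (𝓝[>] 0) (𝓝 0) := by
  refine tendsto_normalized_ballKernel_zero hβ hφ.maps hψ.maps hφ.norm_source hκ ?_
  have h1 : ‖1 - ⟪η, η'⟫_ℂ‖ ≠ 0 := by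
    rw [norm_ne_zero_iff, sub_ne_zero]
    exact fun h0 => hne ((inner_eq_one_iff_of_norm_eq_one hφ.norm_target hψ.norm_target).1 h0.symm)
  have h2 := (tendsto_one_sub_norm_stolzPath_sq hφ.norm_source hκ).div
    ((tendsto_const_nhds (x := (1 : ℂ))).sub ((hφ.tendsto_apply_stolzPath hκ).inner (𝕜 := ℂ)
      (hψ.tendsto_apply_stolzPath hκ))).norm h1
  rw [zero_div] at h2
  exact h2

/-- The limit of the normalized kernel along a nontangential path: infinite dilatation. -/
lemma tendsto_normalized_ballKernel_top {β : ℝ} (hβ : 0 < β)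
    (hφ : Set.MapsTo φ (ball 0 1) (ball 0 1)) (hψ : Set.MapsTo ψ (ball 0 1) (ball 0 1))
    (hζ : ‖ζ‖ = 1) (htop : angularLiminf φ ζ = ∞ ∨ angularLiminf ψ ζ = ∞) (hκ : κ.re = 1) :
    Tendsto (fun t : ℝ => (((1 - ‖stolzPath ζ κ t‖ ^ 2) ^ β : ℝ) : ℂ) *
      ballKernel β (φ (stolzPath ζ κ t)) (ψ (stolzPath ζ κ t))) (𝓝[>] 0) (𝓝 0) := by
  refine tendsto_normalized_ballKernel_zero hβ hφ hψ hζ hκ ?_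
  -- An infinite dilatation of one of the two maps suffices, because `|1 - ⟨ψ, φ⟩|` is at least `1 -
  -- |φ|` and at least `1 - |ψ|`.
  have key : ∀ χ : CSpace N → CSpace N, Set.MapsTo χ (ball 0 1) (ball 0 1) →
      angularLiminf χ ζ = ∞ → Tendsto (fun t => (1 - ‖stolzPath ζ κ t‖ ^ 2) /
        (1 - ‖χ (stolzPath ζ κ t)‖)) (𝓝[>] 0) (𝓝 0) := by
    intro χ hχ hχtop
    have h1 : Tendsto (fun z => (1 - ‖χ z‖) / (1 - ‖z‖)) (𝓝[ball 0 1] ζ) atTop :=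
      tendsto_atTop.2 fun b => (eventually_le_quotient_of_lt_angularLiminf (d := b)
        (by rw [hχtop]; exact ENNReal.ofReal_lt_top))
    have h2 := (h1.comp (tendsto_stolzPath hζ hκ)).inv_tendsto_atTop.const_mul 2
    rw [mul_zero] at h2
    refine squeeze_zero' ?_ ?_ h2
    · filter_upwards [eventually_norm_stolzPath_lt hζ hκ] with t hlt
      have h3 := mem_ball_zero_iff.1 (hχ (mem_ball_zero_iff.2 hlt))
      have h4 := one_sub_norm_sq_pos hlt
      exact div_nonneg h4.le (by linarith)
    · filter_upwards [eventually_norm_stolzPath_lt hζ hκ] with t hlt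
      have h3 := mem_ball_zero_iff.1 (hχ (mem_ball_zero_iff.2 hlt))
      simp only [Pi.inv_apply, Function.comp_apply, inv_div]
      rw [← mul_div_assoc]
      have : 0 ≤ 1 - ‖χ (stolzPath ζ κ t)‖ := by linarith
      gcongr
      nlinarith [norm_nonneg (stolzPath ζ κ t)]
  have hlow : ∀ t, ‖stolzPath ζ κ t‖ < 1 →
      1 - ‖φ (stolzPath ζ κ t)‖ ≤ ‖1 - ⟪φ (stolzPath ζ κ t), ψ (stolzPath ζ κ t)⟫_ℂ‖ ∧
      1 - ‖ψ (stolzPath ζ κ t)‖ ≤ ‖1 - ⟪φ (stolzPath ζ κ t), ψ (stolzPath ζ κ t)⟫_ℂ‖ ∧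
      0 < 1 - ‖φ (stolzPath ζ κ t)‖ ∧ 0 < 1 - ‖ψ (stolzPath ζ κ t)‖ := by
    intro t hlt
    have h3 := mem_ball_zero_iff.1 (hφ (mem_ball_zero_iff.2 hlt))
    have h4 := mem_ball_zero_iff.1 (hψ (mem_ball_zero_iff.2 hlt))
    have h5 := norm_sub_norm_le 1 ⟪φ (stolzPath ζ κ t), ψ (stolzPath ζ κ t)⟫_ℂ
    have h6 := norm_inner_le_norm (𝕜 := ℂ) (φ (stolzPath ζ κ t)) (ψ (stolzPath ζ κ t))
    rw [norm_one] at h5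
    have := norm_nonneg (φ (stolzPath ζ κ t))
    have := norm_nonneg (ψ (stolzPath ζ κ t))
    exact ⟨by nlinarith, by nlinarith, by linarith, by linarith⟩
  rcases htop with htop | htop
  · refine squeeze_zero' ?_ ?_ (key φ hφ htop)
    · filter_upwards [eventually_norm_stolzPath_lt hζ hκ] with t hlt
      have h4 := one_sub_norm_sq_pos hlt
      positivity
    · filter_upwards [eventually_norm_stolzPath_lt hζ hκ] with t hlt
      have h4 := one_sub_norm_sq_pos hlt
      obtain ⟨h5, -, h6, -⟩ := hlow t hlt
      gcongr
  · refine squeeze_zero' ?_ ?_ (key ψ hψ htop)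
    · filter_upwards [eventually_norm_stolzPath_lt hζ hκ] with t hlt
      have h4 := one_sub_norm_sq_pos hlt
      positivity
    · filter_upwards [eventually_norm_stolzPath_lt hζ hκ] with t hlt
      have h4 := one_sub_norm_sq_pos hlt
      obtain ⟨-, h5, -, h6⟩ := hlow t hlt
      gcongr

end KernelAsymptotics

/-! ### The weighted measures and their invariance properties -/

section BergmanMeasure

open scoped InnerProductSpace ComplexConjugate

variable {N : ℕ} {s : ℝ}

lemma measurable_ballAut (a : CSpace N) : Measurable (ballAut a) := by
  unfold ballAut; fun_prop

lemma measurable_ballKernel (β : ℝ) (a : CSpace N) : Measurable (ballKernel β a) := by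
  unfold ballKernel; fun_prop

lemma measurable_bergmanWeight (N : ℕ) (s : ℝ) : Measurable (bergmanWeight N s) := by
  unfold bergmanWeight; fun_prop

lemma lintegral_ballMeasure (g : CSpace N → ℝ≥0∞) :
    ∫⁻ z, g z ∂ballMeasure N =
      (volume (ball (0 : CSpace N) 1))⁻¹ * ∫⁻ z in ball (0 : CSpace N) 1, g z := by
  rw [ballMeasure, lintegral_smul_measure, smul_eq_mul]

lemma lintegral_bergmanMeasure {g : CSpace N → ℝ≥0∞} (hg : Measurable g) :
    ∫⁻ z, g z ∂bergmanMeasure N s = (volume (ball (0 : CSpace N) 1))⁻¹ *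
      ∫⁻ z in ball (0 : CSpace N) 1, ENNReal.ofReal (bergmanWeight N s z) * g z := by
  rw [bergmanMeasure, lintegral_withDensity_eq_lintegral_mul _
    (measurable_bergmanWeight N s).ennreal_ofReal hg, lintegral_ballMeasure]
  rfl

lemma ae_mem_ball_bergmanMeasure (N : ℕ) (s : ℝ) :
    ∀ᵐ z ∂bergmanMeasure N s, z ∈ ball (0 : CSpace N) 1 := by
  refine (withDensity_absolutelyContinuous _ _).ae_le ?_
  unfold ballMeasure
  exact Measure.ae_smul_measure (ae_restrict_mem measurableSet_ball) _

/-- The real determinant of a complex linear map is the squared modulus of its complex determinant.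
-/
lemma hasFDerivAt_real_det_ballAut {a z : CSpace N} (ha : ‖a‖ < 1) (hz : ‖z‖ ≤ 1) :
    ∃ f' : CSpace N →L[ℝ] CSpace N, HasFDerivAt (ballAut a) f' z ∧
      |f'.det| = ((1 - ‖a‖ ^ 2) / ‖1 - ⟪a, z⟫_ℂ‖ ^ 2) ^ (N + 1) := by
  refine ⟨_, (hasFDerivAt_ballAut ha hz).restrictScalars ℝ, ?_⟩
  have h := det_fderiv_ballAut ha hz
  set L := ((1 - ⟪a, z⟫_ℂ)⁻¹ • (-ballLin a) +
        ((1 - ⟪a, z⟫_ℂ)⁻¹ ^ 2 • innerSL ℂ a).smulRight (a - ballLin a z) :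
          CSpace N →L[ℂ] CSpace N)
  have h1 : (L.restrictScalars ℝ).det = ‖LinearMap.det (L : CSpace N →ₗ[ℂ] CSpace N)‖ ^ 2 := by
    rw [← Complex.normSq_eq_norm_sq]
    change LinearMap.det ((L : CSpace N →ₗ[ℂ] CSpace N).restrictScalars ℝ) = _
    rw [LinearMap.det_restrictScalars, Algebra.norm_complex_eq]
    rfl
  have h2 : 0 ≤ 1 - ‖a‖ ^ 2 := (one_sub_norm_sq_pos ha).le
  rw [h1, h, abs_of_nonneg (by positivity), ← pow_mul, mul_comm _ 2, pow_mul, div_pow,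
    Real.sq_sqrt h2, finrank_euclideanSpace, Fintype.card_fin]

lemma image_ballAut_ball {a : CSpace N} (ha : ‖a‖ < 1) :
    ballAut a '' ball 0 1 = ball 0 1 := by
  refine Set.Subset.antisymm (mapsTo_ballAut ha).image_subset fun z hz => ?_
  exact ⟨ballAut a z, mapsTo_ballAut ha hz, ballAut_ballAut ha (mem_ball_zero_iff.1 hz).le⟩

lemma injOn_ballAut {a : CSpace N} (ha : ‖a‖ < 1) : Set.InjOn (ballAut a) (ball 0 1) :=
  fun z hz w hw h => by
    rw [← ballAut_ballAut ha (mem_ball_zero_iff.1 hz).le, h,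
      ballAut_ballAut ha (mem_ball_zero_iff.1 hw).le]

/-- The Jacobian of `ballAut a` with respect to the weighted measure. -/
noncomputable def bergmanJacobian (N : ℕ) (s : ℝ) (a z : CSpace N) : ℝ :=
  ((1 - ‖a‖ ^ 2) / ‖1 - ⟪a, z⟫_ℂ‖ ^ 2) ^ ((N : ℝ) + s + 1)

lemma measurable_bergmanJacobian (s : ℝ) (a : CSpace N) : Measurable (bergmanJacobian N s a) := by
  unfold bergmanJacobian; fun_prop

lemma bergmanJacobian_nonneg (s : ℝ) {a : CSpace N} (ha : ‖a‖ < 1) (z : CSpace N) :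
    0 ≤ bergmanJacobian N s a z := by
  have := (one_sub_norm_sq_pos ha).le
  unfold bergmanJacobian; positivity

/-- The Jacobian supplies the power `N + 1` and the weight the power `s` of one and the same ratio;
together they give the exponent `β`. -/
lemma bergmanWeight_ballAut {a z : CSpace N} (ha : ‖a‖ < 1) (hz : ‖z‖ < 1) :
    ((1 - ‖a‖ ^ 2) / ‖1 - ⟪a, z⟫_ℂ‖ ^ 2) ^ (N + 1) * bergmanWeight N s (ballAut a z) =
      bergmanWeight N s z * bergmanJacobian N s a z := by
  have h1 := one_sub_norm_sq_pos ha
  have h2 := one_sub_norm_sq_pos hz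
  have h3 : 0 < ‖1 - ⟪a, z⟫_ℂ‖ := norm_pos_iff.2 (one_sub_inner_ne_zero ha hz.le)
  have h4 : 0 < (1 - ‖a‖ ^ 2) / ‖1 - ⟪a, z⟫_ℂ‖ ^ 2 := by positivity
  have h5 : (1 - ‖a‖ ^ 2) * (1 - ‖z‖ ^ 2) / ‖1 - ⟪a, z⟫_ℂ‖ ^ 2 =
      (1 - ‖a‖ ^ 2) / ‖1 - ⟪a, z⟫_ℂ‖ ^ 2 * (1 - ‖z‖ ^ 2) := by ring
  have h6 : (N : ℝ) + s + 1 = (N + 1 : ℕ) + s := by push_cast; ring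
  rw [bergmanWeight, bergmanWeight, bergmanJacobian, one_sub_norm_ballAut_sq ha hz.le, h5,
    Real.mul_rpow h4.le h2.le, h6, Real.rpow_add h4, Real.rpow_natCast]
  ring

lemma lintegral_comp_ballAut {a : CSpace N} (ha : ‖a‖ < 1) {g : CSpace N → ℝ≥0∞}
    (hg : Measurable g) :
    ∫⁻ z, g z ∂bergmanMeasure N s =
      ∫⁻ z, ENNReal.ofReal (bergmanJacobian N s a z) * g (ballAut a z) ∂bergmanMeasure N s := by
  rw [lintegral_bergmanMeasure hg, lintegral_bergmanMeasure (g := fun z =>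
    ENNReal.ofReal (bergmanJacobian N s a z) * g (ballAut a z))
    ((measurable_bergmanJacobian s a).ennreal_ofReal.mul (hg.comp (measurable_ballAut a)))]
  congr 1
  -- The change of variables formula takes a derivative defined everywhere; its values off the
  -- closed ball are irrelevant and set to 0.
  have hex : ∀ z : CSpace N, ∃ f' : CSpace N →L[ℝ] CSpace N, ‖z‖ ≤ 1 →
      HasFDerivAt (ballAut a) f' z ∧
      |f'.det| = ((1 - ‖a‖ ^ 2) / ‖1 - ⟪a, z⟫_ℂ‖ ^ 2) ^ (N + 1) := by
    intro z
    by_cases hz : ‖z‖ ≤ 1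
    · obtain ⟨f', hf'⟩ := hasFDerivAt_real_det_ballAut ha hz
      exact ⟨f', fun _ => hf'⟩
    · exact ⟨0, fun h => absurd h hz⟩
  choose f' hf' using hex
  have key := lintegral_image_eq_lintegral_abs_det_fderiv_mul volume
    (measurableSet_ball (x := (0 : CSpace N)) (ε := 1)) (f := ballAut a) (f' := f')
    (fun z hz => (hf' z (mem_ball_zero_iff.1 hz).le).1.hasFDerivWithinAt) (injOn_ballAut ha)
    (fun z => ENNReal.ofReal (bergmanWeight N s z) * g z)
  rw [image_ballAut_ball ha] at key
  rw [key]
  refine setLIntegral_congr_fun measurableSet_ball fun z hz => ?_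
  have hz' := mem_ball_zero_iff.1 hz
  rw [(hf' z hz'.le).2, ← mul_assoc, ← mul_assoc, mul_comm (ENNReal.ofReal (bergmanWeight N s z)),
    ← ENNReal.ofReal_mul (by have := one_sub_norm_sq_pos ha; positivity),
    bergmanWeight_ballAut ha hz', mul_comm (bergmanWeight N s z),
    ENNReal.ofReal_mul (bergmanJacobian_nonneg s ha z)]

/-- The change of variables formula for `ballAut a`. -/
lemma map_ballAut_bergmanMeasure {a : CSpace N} (ha : ‖a‖ < 1) :
    ((bergmanMeasure N s).withDensity fun z => ENNReal.ofReal (bergmanJacobian N s a z)).map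
      (ballAut a) = bergmanMeasure N s := by
  ext A hA
  have hm := (measurable_bergmanJacobian s a).ennreal_ofReal
  rw [← lintegral_indicator_one hA, ← lintegral_indicator_one (μ := bergmanMeasure N s) hA,
    lintegral_map (measurable_one.indicator hA) (measurable_ballAut a),
    lintegral_withDensity_eq_lintegral_mul _ hm (g := fun z => A.indicator 1 (ballAut a z))
      ((measurable_one.indicator hA).comp (measurable_ballAut a)),
    lintegral_comp_ballAut ha (measurable_one.indicator hA)]
  rfl

/-- Multiplication by a unimodular number. -/
noncomputable def unimodularSMul (N : ℕ) (c : ℂ) (hc : ‖c‖ = 1) : CSpace N ≃ₗᵢ[ℝ] CSpace N where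
  toLinearEquiv := (LinearEquiv.smulOfNeZero ℂ (CSpace N) c
    (norm_ne_zero_iff.1 (by rw [hc]; exact one_ne_zero))).restrictScalars ℝ
  norm_map' z := by
    change ‖c • z‖ = ‖z‖
    rw [norm_smul, hc, one_mul]

lemma measurePreserving_smul_volume {c : ℂ} (hc : ‖c‖ = 1) :
    MeasurePreserving (fun z : CSpace N => c • z) volume volume :=
  (unimodularSMul N c hc).measurePreserving

lemma measurableEmbedding_smul {c : ℂ} (hc : ‖c‖ = 1) :
    MeasurableEmbedding (fun z : CSpace N => c • z) :=
  (unimodularSMul N c hc).toHomeomorph.measurableEmbedding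

lemma measurePreserving_smul_bergmanMeasure {c : ℂ} (hc : ‖c‖ = 1) :
    MeasurePreserving (fun z : CSpace N => c • z) (bergmanMeasure N s) (bergmanMeasure N s) := by
  have hmeas : Measurable fun z : CSpace N => c • z := by fun_prop
  refine ⟨hmeas, ?_⟩
  ext A hA
  have hball : (fun z : CSpace N => c • z) ⁻¹' ball 0 1 = ball 0 1 := by
    ext z; simp [norm_smul, hc]
  rw [← lintegral_indicator_one hA, ← lintegral_indicator_one (μ := bergmanMeasure N s) hA,
    lintegral_map (measurable_one.indicator hA) hmeas,
    lintegral_bergmanMeasure (g := fun z => A.indicator 1 (c • z))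
      ((measurable_one.indicator hA).comp hmeas),
    lintegral_bergmanMeasure (measurable_one.indicator hA)]
  congr 1
  have h := (measurePreserving_smul_volume (N := N) hc).setLIntegral_comp_preimage_emb
    (measurableEmbedding_smul hc)
    (fun z => ENNReal.ofReal (bergmanWeight N s z) * A.indicator 1 z) (ball 0 1)
  rw [hball] at h
  rw [← h]
  refine lintegral_congr fun z => ?_
  simp [bergmanWeight, norm_smul, hc]

/-- Polar coordinates in real dimension `2N` and the substitution `y ↦ y²` turn the weight into the
beta density with parameters `N` and `s + 1`, up to the factor `1 / (2N)`; the gamma factors are its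
normalization. -/
lemma integral_radial_bergmanWeight (hN : 0 < N) (hs : -1 < s) :
    ∫ z in ball (0 : CSpace N) 1, bergmanWeight N s z = volume.real (ball (0 : CSpace N) 1) := by
  have hNpos : (0 : ℝ) < N := by exact_mod_cast hN
  have : Nonempty (Fin N) := ⟨⟨0, hN⟩⟩
  set f : ℝ → ℝ := fun y => if y < 1 then
    Real.Gamma (N + s + 1) / (Real.Gamma (N + 1) * Real.Gamma (s + 1)) * (1 - y ^ 2) ^ s else 0
    with hf
  have h1 : ∫ z in ball (0 : CSpace N) 1, bergmanWeight N s z =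
      ∫ z : CSpace N, f ‖z‖ := by
    rw [← integral_indicator measurableSet_ball]
    refine integral_congr_ae (Eventually.of_forall fun z => ?_)
    simp only [Set.indicator_apply, mem_ball_zero_iff, hf, bergmanWeight]
  have hdim : Module.finrank ℝ (CSpace N) = 2 * N := by
    rw [finrank_real_of_complex, finrank_euclideanSpace, Fintype.card_fin]
  rw [h1, integral_fun_norm_addHaar volume f, hdim]
  have hG1 := Real.Gamma_pos_of_pos (by linarith : 0 < s + 1)
  have hG2 := Real.Gamma_pos_of_pos hNpos
  have hG3 := Real.Gamma_pos_of_pos (by linarith : 0 < (N : ℝ) + s + 1)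
  have h2 : ∫ y in Set.Ioi (0 : ℝ), y ^ (2 * N - 1) • f y =
      (2 * (N : ℝ))⁻¹ * ∫ y in Set.Ioi (0 : ℝ), ProbabilityTheory.betaPDFReal N (s + 1) y := by
    rw [← integral_comp_rpow_Ioi (ProbabilityTheory.betaPDFReal N (s + 1)) two_ne_zero,
      ← integral_const_mul]
    refine setIntegral_congr_fun measurableSet_Ioi fun y hy => ?_
    have hy0 : (0 : ℝ) < y := hy
    have hpow : y ^ (2 * N - 1) = y * (y ^ 2) ^ ((N : ℝ) - 1) := by
      rw [← Real.rpow_natCast y 2, ← Real.rpow_mul hy0.le, ← Real.rpow_one_add' hy0.le,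
        ← Real.rpow_natCast]
      · congr 1
        rw [Nat.cast_sub (by omega)]
        push_cast; ring
      · have : (1 : ℝ) ≤ N := by exact_mod_cast hN
        push_cast; nlinarith
    simp only [hf, ProbabilityTheory.betaPDFReal, smul_eq_mul, Real.rpow_two]
    by_cases hy1 : y < 1
    · have h3 : 0 < y ^ 2 ∧ y ^ 2 < 1 := ⟨by positivity, by nlinarith⟩
      rw [if_pos hy1, if_pos h3, hpow, ProbabilityTheory.beta, Real.Gamma_add_one hNpos.ne',
        abs_of_pos two_pos, add_sub_cancel_right, ← add_assoc]
      norm_num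
      field_simp
    · have h3 : ¬ (0 < y ^ 2 ∧ y ^ 2 < 1) := fun h => hy1 (by nlinarith [h.2])
      rw [if_neg hy1, if_neg h3]
      simp
  have h3 : ∫ y in Set.Ioi (0 : ℝ), ProbabilityTheory.betaPDFReal N (s + 1) y = 1 := by
    rw [setIntegral_eq_integral_of_forall_compl_eq_zero]
    · have h4 := ProbabilityTheory.lintegral_betaPDF_eq_one hNpos (by linarith : 0 < s + 1)
      rw [integral_eq_lintegral_of_nonneg_ae _
        (ProbabilityTheory.measurable_betaPDFReal _ _).aestronglyMeasurable]
      · unfold ProbabilityTheory.betaPDF at h4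
        rw [h4]; rfl
      · refine Eventually.of_forall fun y => ?_
        simp only [Pi.zero_apply]
        by_cases hy : 0 < y ∧ y < 1
        · exact (ProbabilityTheory.betaPDFReal_pos hy.1 hy.2 hNpos (by linarith)).le
        · rw [ProbabilityTheory.betaPDFReal, if_neg hy]
    · intro y hy
      rw [ProbabilityTheory.betaPDFReal, if_neg fun h => hy h.1]
  rw [h2, h3]
  simp only [nsmul_eq_mul, smul_eq_mul]
  push_cast
  field_simp

lemma bergmanWeight_nonneg (hs : -1 < s) {z : CSpace N} (hz : ‖z‖ < 1) :
    0 ≤ bergmanWeight N s z := by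
  have := (one_sub_norm_sq_pos hz).le
  have hNpos : (0 : ℝ) ≤ N := Nat.cast_nonneg N
  have hG1 := Real.Gamma_pos_of_pos (by linarith : 0 < s + 1)
  have hG2 := Real.Gamma_pos_of_pos (by linarith : 0 < (N : ℝ) + 1)
  have hG3 := Real.Gamma_pos_of_pos (by linarith : 0 < (N : ℝ) + s + 1)
  unfold bergmanWeight
  positivity

lemma isProbabilityMeasure_bergmanMeasure (hN : 0 < N) (hs : -1 < s) :
    IsProbabilityMeasure (bergmanMeasure N s) := by
  have h := integral_radial_bergmanWeight hN hs
  have hfin : volume (ball (0 : CSpace N) 1) ≠ ∞ := measure_ball_lt_top.ne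
  have hpos : volume (ball (0 : CSpace N) 1) ≠ 0 := (measure_ball_pos _ _ one_pos).ne'
  have hint : Integrable (bergmanWeight N s) (volume.restrict (ball (0 : CSpace N) 1)) := by
    -- A nonintegrable function has integral 0 by convention, whereas this integral is the positive
    -- volume of the ball; the formula itself therefore yields integrability.
    by_contra hcon
    rw [integral_undef hcon] at h
    exact (ENNReal.toReal_pos hpos hfin).ne h
  constructor
  rw [← lintegral_one, lintegral_bergmanMeasure measurable_const]
  simp only [mul_one]
  rw [← ofReal_integral_eq_lintegral_ofReal hint, h, ofReal_measureReal hfin,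
    ENNReal.inv_mul_cancel hpos hfin]
  filter_upwards [ae_restrict_mem measurableSet_ball] with z hz
  exact bergmanWeight_nonneg hs (mem_ball_zero_iff.1 hz)

end BergmanMeasure

/-! ### Point evaluations and kernels in the Bergman spaces -/

section BergmanKernel

open scoped InnerProductSpace ComplexConjugate

variable {N : ℕ} {s : ℝ}

lemma measurable_indicator_of_differentiableOn {F : CSpace N → ℂ}
    (hF : DifferentiableOn ℂ F (ball 0 1)) : Measurable ((ball 0 1).indicator F) := by
  rw [← Set.piecewise_eq_indicator]
  exact hF.continuousOn.measurable_piecewise continuousOn_const measurableSet_ball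

lemma circleAverage_smul_eq {F : CSpace N → ℂ} (hF : DifferentiableOn ℂ F (ball 0 1))
    {z : CSpace N} (hz : ‖z‖ < 1) :
    ∫ θ in (0 : ℝ)..2 * Real.pi, F (circleMap 0 1 θ • z) = (2 * Real.pi : ℝ) • F 0 := by
  have hd : DiffContOnCl ℂ (fun l : ℂ => F (l • z)) (ball 0 |1|) := by
    refine DifferentiableOn.diffContOnCl ?_
    refine hF.comp (by fun_prop) fun l hl => ?_
    have hl1 : ‖l‖ ≤ 1 := by
      have := closure_ball_subset_closedBall hl
      simpa using this
    rw [mem_ball_zero_iff, norm_smul]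
    nlinarith [norm_nonneg z, norm_nonneg l]
  have h := hd.circleAverage
  rw [Real.circleAverage_def, zero_smul] at h
  rw [← h, smul_smul, mul_inv_cancel₀ (by positivity), one_smul]

/-- The mean value property for the weighted measures on the ball. -/
lemma integral_bergmanMeasure_of_differentiableOn (hN : 0 < N) (hs : -1 < s) {F : CSpace N → ℂ}
    (hF : DifferentiableOn ℂ F (ball 0 1)) (hint : Integrable F (bergmanMeasure N s)) :
    ∫ z, F z ∂bergmanMeasure N s = F 0 := by
  have := isProbabilityMeasure_bergmanMeasure hN hs
  set μ := bergmanMeasure N s with hμ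
  set F' := (ball (0 : CSpace N) 1).indicator F with hF'
  have hmeas : Measurable F' := measurable_indicator_of_differentiableOn hF
  have hae : F' =ᵐ[μ] F := by
    filter_upwards [ae_mem_ball_bergmanMeasure N s] with z hz
    rw [hF', Set.indicator_of_mem hz]
  have hint' : Integrable F' μ := hint.congr hae.symm
  have hn : ∀ θ : ℝ, ‖circleMap 0 1 θ‖ = 1 := fun θ => by simp
  have hmp : ∀ θ : ℝ, MeasurePreserving (fun z : CSpace N => circleMap 0 1 θ • z) μ μ :=
    fun θ => measurePreserving_smul_bergmanMeasure (hn θ)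
  set ν := (volume : Measure ℝ).restrict (Set.Ioc 0 (2 * Real.pi)) with hν
  have hGm : Measurable (Function.uncurry fun (θ : ℝ) (z : CSpace N) =>
      F' (circleMap 0 1 θ • z)) := by
    refine hmeas.comp ?_
    change Measurable fun p : ℝ × CSpace N => circleMap 0 1 p.1 • p.2
    have : Measurable fun p : ℝ × CSpace N => circleMap 0 1 p.1 :=
      (by fun_prop : Continuous fun θ : ℝ => circleMap 0 1 θ).measurable.comp measurable_fst
    exact this.smul measurable_snd
  have hGint : Integrable (Function.uncurry fun (θ : ℝ) (z : CSpace N) =>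
      F' (circleMap 0 1 θ • z)) (ν.prod μ) := by
    rw [integrable_prod_iff hGm.aestronglyMeasurable]
    refine ⟨Eventually.of_forall fun θ => ?_, ?_⟩
    · exact (hmp θ).integrable_comp_of_integrable hint'
    · have : ∀ θ : ℝ, ∫ z, ‖Function.uncurry (fun (θ : ℝ) (z : CSpace N) =>
          F' (circleMap 0 1 θ • z)) (θ, z)‖ ∂μ = ∫ z, ‖F' z‖ ∂μ := fun θ =>
        (hmp θ).integral_comp (measurableEmbedding_smul (hn θ)) fun z => ‖F' z‖
      simp_rw [this]
      exact integrable_const _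
  -- The double integral over rotations and the ball is `2π ∫ F` by rotation invariance in one
  -- order, and `2π F(0)` by the mean value property on complex lines in the other.
  have hswap := integral_integral_swap hGint
  have h1 : ∫ θ, ∫ z, F' (circleMap 0 1 θ • z) ∂μ ∂ν = (2 * Real.pi : ℝ) • ∫ z, F z ∂μ := by
    have : ∀ θ : ℝ, ∫ z, F' (circleMap 0 1 θ • z) ∂μ = ∫ z, F z ∂μ := fun θ => by
      rw [(hmp θ).integral_comp (measurableEmbedding_smul (hn θ)) F']
      exact integral_congr_ae hae
    simp_rw [this]
    rw [integral_const, hν, measureReal_restrict_apply_univ, Real.volume_real_Ioc_of_le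
      (by positivity), sub_zero]
  have h2 : ∫ z, ∫ θ, F' (circleMap 0 1 θ • z) ∂ν ∂μ = (2 * Real.pi : ℝ) • F 0 := by
    have : ∀ᵐ z ∂μ, ∫ θ, F' (circleMap 0 1 θ • z) ∂ν = (2 * Real.pi : ℝ) • F 0 := by
      filter_upwards [ae_mem_ball_bergmanMeasure N s] with z hz
      have hz' := mem_ball_zero_iff.1 hz
      rw [← circleAverage_smul_eq hF hz', intervalIntegral.integral_of_le (by positivity)]
      refine integral_congr_ae (Eventually.of_forall fun θ => ?_)
      simp only [hF']
      rw [Set.indicator_of_mem]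
      rwa [mem_ball_zero_iff, norm_smul, hn, one_mul]
    rw [integral_congr_ae this, integral_const]
    simp
  rw [h1, h2] at hswap
  exact smul_right_injective _ (by positivity : (2 * Real.pi : ℝ) ≠ 0) hswap

lemma integral_comp_ballAut {a : CSpace N} (ha : ‖a‖ < 1) {g : CSpace N → ℂ}
    (hg : AEStronglyMeasurable g (bergmanMeasure N s)) :
    ∫ z, g z ∂bergmanMeasure N s =
      ∫ z, bergmanJacobian N s a z • g (ballAut a z) ∂bergmanMeasure N s := by
  have hm := (measurable_bergmanJacobian s a).ennreal_ofReal
  have hmap := map_ballAut_bergmanMeasure (s := s) ha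
  have h1 : ∫ z, g z ∂bergmanMeasure N s = ∫ z, g (ballAut a z) ∂((bergmanMeasure N s).withDensity
      fun z => ENNReal.ofReal (bergmanJacobian N s a z)) := by
    rw [← integral_map (measurable_ballAut a).aemeasurable (by rwa [hmap]), hmap]
  rw [h1, integral_withDensity_eq_integral_toReal_smul hm
    (Eventually.of_forall fun _ => ENNReal.ofReal_lt_top)]
  refine integral_congr_ae (Eventually.of_forall fun z => ?_)
  simp only
  rw [ENNReal.toReal_ofReal (bergmanJacobian_nonneg s ha z)]

lemma differentiableOn_ballKernel (β : ℝ) {a : CSpace N} (ha : ‖a‖ < 1) :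
    DifferentiableOn ℂ (ballKernel β a) (ball 0 1) := by
  unfold ballKernel
  refine DifferentiableOn.cpow_const ?_ fun z hz =>
    Or.inl (one_sub_inner_re_pos ha (mem_ball_zero_iff.1 hz).le)
  exact ((innerSL ℂ a).differentiable.differentiableOn).const_sub 1

lemma ballKernel_zero (β : ℝ) (a : CSpace N) : ballKernel β a 0 = 1 := by
  simp [ballKernel]

lemma norm_ballKernel_le {β : ℝ} (hβ : 0 ≤ β) {a z : CSpace N} (ha : ‖a‖ < 1) (hz : ‖z‖ ≤ 1) :
    ‖ballKernel β a z‖ ≤ (1 - ‖a‖) ^ (-β) := by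
  rw [norm_ballKernel]
  refine Real.rpow_le_rpow_of_nonpos (by linarith) ?_ (by linarith)
  have h1 := norm_sub_norm_le 1 ⟪a, z⟫_ℂ
  have h2 := norm_inner_le_norm (𝕜 := ℂ) a z
  rw [norm_one] at h1
  nlinarith [norm_nonneg a]

/-- The Jacobian is the squared modulus of the normalized kernel, so composition with the
automorphism followed by multiplication by that kernel preserves the Bergman norm. -/
lemma norm_sq_normalized_ballKernel {a z : CSpace N} (ha : ‖a‖ < 1) (hz : ‖z‖ < 1) :
    (1 - ‖a‖ ^ 2) ^ ((N : ℝ) + s + 1) * ‖ballKernel (N + s + 1) a z‖ ^ 2 =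
      bergmanJacobian N s a z := by
  have h1 := one_sub_norm_sq_pos ha
  have h3 : 0 < ‖1 - ⟪a, z⟫_ℂ‖ := norm_pos_iff.2 (one_sub_inner_ne_zero ha hz.le)
  rw [norm_ballKernel, bergmanJacobian, Real.div_rpow h1.le (by positivity), div_eq_mul_inv]
  congr 1
  rw [Real.rpow_neg h3.le, inv_pow, ← Real.rpow_natCast (_ ^ _), ← Real.rpow_natCast ‖_‖,
    ← Real.rpow_mul h3.le, ← Real.rpow_mul h3.le, mul_comm]

/-- The sharp pointwise bound in the weighted Bergman space. -/
lemma enorm_apply_le_bergmanENorm (hN : 0 < N) (hs : -1 < s) {f : CSpace N → ℂ}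
    (hf : DifferentiableOn ℂ f (ball 0 1)) (hfm : Measurable f) {w : CSpace N} (hw : ‖w‖ < 1) :
    ‖f w‖ₑ * ENNReal.ofReal ((1 - ‖w‖ ^ 2) ^ (((N : ℝ) + s + 1) / 2)) ≤ bergmanENorm N s f := by
  have := isProbabilityMeasure_bergmanMeasure hN hs
  by_cases htop : bergmanENorm N s f = ∞
  · rw [htop]; exact le_top
  have hw1 := one_sub_norm_sq_pos hw
  set μ := bergmanMeasure N s with hμ
  set c : ℝ := (1 - ‖w‖ ^ 2) ^ (((N : ℝ) + s + 1) / 2) with hc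
  have hc0 : 0 < c := Real.rpow_pos_of_pos hw1 _
  have hc2 : c ^ 2 = (1 - ‖w‖ ^ 2) ^ ((N : ℝ) + s + 1) := by
    rw [hc, ← Real.rpow_natCast, ← Real.rpow_mul hw1.le]
    congr 1; push_cast; ring
  -- `G` has the norm of `f` and takes at the origin the value `f(w) (1 - |w|²)^(β/2)`. The mean
  -- value property on a probability space then gives the sharp constant.
  set G : CSpace N → ℂ := fun z => f (ballAut w z) * ((c : ℂ) * ballKernel (N + s + 1) w z) with hG
  have hGd : DifferentiableOn ℂ G (ball 0 1) :=
    (hf.comp (differentiableOn_ballAut hw) (mapsTo_ballAut hw)).mul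
      ((differentiableOn_ballKernel _ hw).const_mul _)
  have hGm : Measurable G := (hfm.comp (measurable_ballAut w)).mul
    ((measurable_ballKernel _ w).const_mul _)
  have hnorm : eLpNorm G 2 μ = bergmanENorm N s f := by
    rw [bergmanENorm, eLpNorm_eq_lintegral_rpow_enorm_toReal two_ne_zero ENNReal.ofNat_ne_top,
      eLpNorm_eq_lintegral_rpow_enorm_toReal two_ne_zero ENNReal.ofNat_ne_top]
    congr 1
    rw [lintegral_comp_ballAut (s := s) hw (g := fun z => ‖f z‖ₑ ^ (2 : ℝ≥0∞).toReal) (by fun_prop)]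
    refine lintegral_congr_ae ?_
    filter_upwards [ae_mem_ball_bergmanMeasure N s] with z hz
    have hz' := mem_ball_zero_iff.1 hz
    rw [← norm_sq_normalized_ballKernel hw hz', ← hc2, ← mul_pow, ENNReal.toReal_ofNat,
      ENNReal.rpow_ofNat, ENNReal.rpow_ofNat, hG, enorm_mul, mul_pow, mul_comm]
    congr 1
    rw [ENNReal.ofReal_pow (by positivity), ← ofReal_norm, norm_mul, Complex.norm_real,
      Real.norm_of_nonneg hc0.le]
  have hmem : MemLp G 2 μ := ⟨hGm.aestronglyMeasurable, by
    rw [hnorm]; exact lt_top_iff_ne_top.2 htop⟩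
  have hint : Integrable G μ := hmem.integrable (by norm_num)
  have hval := integral_bergmanMeasure_of_differentiableOn hN hs hGd hint
  have hG0 : G 0 = f w * c := by simp [hG, ballAut_zero, ballKernel_zero]
  calc ‖f w‖ₑ * ENNReal.ofReal c = ‖G 0‖ₑ := by
        rw [hG0, enorm_mul]
        congr 1
        rw [← ofReal_norm, Complex.norm_real, Real.norm_of_nonneg hc0.le]
    _ ≤ ∫⁻ z, ‖G z‖ₑ ∂μ := by rw [← hval]; exact enorm_integral_le_lintegral_enorm _
    _ = eLpNorm G 1 μ := eLpNorm_one_eq_lintegral_enorm.symm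
    _ ≤ eLpNorm G 2 μ := eLpNorm_le_eLpNorm_of_exponent_le (by norm_num) hGm.aestronglyMeasurable
    _ = _ := hnorm

lemma ae_norm_ballKernel_le (s' : ℝ) {β : ℝ} (hβ : 0 ≤ β) {a : CSpace N} (ha : ‖a‖ < 1) :
    ∀ᵐ z ∂bergmanMeasure N s', ‖ballKernel β a z‖ ≤ (1 - ‖a‖) ^ (-β) := by
  filter_upwards [ae_mem_ball_bergmanMeasure N s'] with z hz
  exact norm_ballKernel_le hβ ha (mem_ball_zero_iff.1 hz).le

lemma integrable_ballKernel_mul_conj (hN : 0 < N) (hs : -1 < s) {β : ℝ} (hβ : 0 ≤ β)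
    {a b : CSpace N} (ha : ‖a‖ < 1) (hb : ‖b‖ < 1) :
    Integrable (fun z => ballKernel β a z * conj (ballKernel β b z)) (bergmanMeasure N s) := by
  have := isProbabilityMeasure_bergmanMeasure hN hs
  have hm : Measurable fun z => ballKernel β a z * conj (ballKernel β b z) :=
    (measurable_ballKernel β a).mul
      (Complex.continuous_conj.measurable.comp (measurable_ballKernel β b))
  refine Integrable.of_bound hm.aestronglyMeasurable ((1 - ‖a‖) ^ (-β) * (1 - ‖b‖) ^ (-β)) ?_
  filter_upwards [ae_norm_ballKernel_le s hβ ha, ae_norm_ballKernel_le s hβ hb] with z h1 h2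
  rw [norm_mul, RCLike.norm_conj]
  gcongr

/-- The reproducing property for pairs of kernels. -/
lemma integral_ballKernel_mul_conj (hN : 0 < N) (hs : -1 < s) {a b : CSpace N} (ha : ‖a‖ < 1)
    (hb : ‖b‖ < 1) :
    ∫ z, ballKernel (N + s + 1) a z * conj (ballKernel (N + s + 1) b z) ∂bergmanMeasure N s =
      ballKernel (N + s + 1) a b := by
  have := isProbabilityMeasure_bergmanMeasure hN hs
  have hNpos : (0 : ℝ) < N := by exact_mod_cast hN
  have hβ : 0 ≤ (N : ℝ) + s + 1 := by linarith
  have hb1 := one_sub_norm_sq_pos hb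
  rw [integral_comp_ballAut hb (integrable_ballKernel_mul_conj hN hs hβ ha hb).1]
  -- After the change of variables, the transformed conjugate kernel cancels the antiholomorphic
  -- half of the Jacobian, because `K_b(ballAut b z) K_b(z)` is constant. A holomorphic integrand
  -- remains, whose integral is its value at 0.
  have hpt : ∀ z : CSpace N, ‖z‖ < 1 → bergmanJacobian N s b z •
      (ballKernel (N + s + 1) a (ballAut b z) * conj (ballKernel (N + s + 1) b (ballAut b z))) =
      ballKernel (N + s + 1) a (ballAut b z) * ballKernel (N + s + 1) b z := by
    intro z hz
    have hK : ballKernel (N + s + 1) b (ballAut b z) * ballKernel (N + s + 1) b z =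
        (((1 - ‖b‖ ^ 2) ^ (-((N : ℝ) + s + 1)) : ℝ) : ℂ) := by
      have hD := one_sub_inner_ne_zero hb hz.le
      have hre := one_sub_inner_re_pos hb hz.le
      have harg : (1 - ⟪b, z⟫_ℂ).arg ≠ Real.pi := by
        intro h1
        rw [Complex.arg_eq_pi_iff] at h1
        linarith [h1.1]
      have h1 : 1 - ⟪b, ballAut b z⟫_ℂ = ((1 - ‖b‖ ^ 2 : ℝ) : ℂ) * (1 - ⟪b, z⟫_ℂ)⁻¹ := by
        rw [one_sub_inner_ballAut hb hz.le]; push_cast; ring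
      rw [ballKernel, ballKernel, h1, Complex.ofReal_mul_cpow_ofReal hb1 (inv_ne_zero hD),
        Complex.inv_cpow _ _ harg, mul_assoc, inv_mul_cancel₀, mul_one]
      rw [Ne, Complex.cpow_eq_zero_iff]
      exact fun h => hD h.1
    have hc : (((1 - ‖b‖ ^ 2) ^ ((N : ℝ) + s + 1) : ℝ) : ℂ) *
        (((1 - ‖b‖ ^ 2) ^ (-((N : ℝ) + s + 1)) : ℝ) : ℂ) = 1 := by
      rw [← Complex.ofReal_mul, ← Real.rpow_add hb1, add_neg_cancel, Real.rpow_zero,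
        Complex.ofReal_one]
    have hK' := congrArg conj hK
    rw [map_mul, Complex.conj_ofReal] at hK'
    rw [← norm_sq_normalized_ballKernel hb hz, Complex.real_smul, Complex.ofReal_mul,
      Complex.ofReal_pow, ← Complex.mul_conj']
    linear_combination ballKernel (N + s + 1) a (ballAut b z) * ballKernel (N + s + 1) b z *
      (((1 - ‖b‖ ^ 2) ^ ((N : ℝ) + s + 1) : ℝ) : ℂ) * hK' +
      ballKernel (N + s + 1) a (ballAut b z) * ballKernel (N + s + 1) b z * hc
  have hae : (fun z => bergmanJacobian N s b z •
      (ballKernel (N + s + 1) a (ballAut b z) * conj (ballKernel (N + s + 1) b (ballAut b z))))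
      =ᵐ[bergmanMeasure N s]
      fun z => ballKernel (N + s + 1) a (ballAut b z) * ballKernel (N + s + 1) b z := by
    filter_upwards [ae_mem_ball_bergmanMeasure N s] with z hz
    exact hpt z (mem_ball_zero_iff.1 hz)
  rw [integral_congr_ae hae, integral_bergmanMeasure_of_differentiableOn hN hs]
  · rw [ballAut_zero, ballKernel_zero, mul_one]
  · exact ((differentiableOn_ballKernel _ ha).comp (differentiableOn_ballAut hb)
      (mapsTo_ballAut hb)).mul (differentiableOn_ballKernel _ hb)
  · have hm : Measurable fun z => ballKernel (N + s + 1) a (ballAut b z) *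
        ballKernel (N + s + 1) b z :=
      ((measurable_ballKernel _ a).comp (measurable_ballAut b)).mul (measurable_ballKernel _ b)
    refine Integrable.of_bound hm.aestronglyMeasurable
      ((1 - ‖a‖) ^ (-((N : ℝ) + s + 1)) * (1 - ‖b‖) ^ (-((N : ℝ) + s + 1))) ?_
    filter_upwards [ae_mem_ball_bergmanMeasure N s, ae_norm_ballKernel_le s hβ hb] with z hz h2
    rw [norm_mul]
    have := norm_ballKernel_le hβ ha (norm_ballAut_lt_one hb (mem_ball_zero_iff.1 hz)).le
    gcongr

/-- The linear combination `∑ x_i K_{p_i}` of kernels. -/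
noncomputable def kernelSum {ι : Type*} [Fintype ι] (β : ℝ) (x : ι → ℂ) (p : ι → CSpace N)
    (z : CSpace N) : ℂ := ∑ i, x i * ballKernel β (p i) z

/-- The quadratic form `∑ x_i conj x_j K_{p_i}(p_j)`, the squared norm of `∑ x_i K_{p_i}`. -/
noncomputable def kernelQuad {ι : Type*} [Fintype ι] (β : ℝ) (x : ι → ℂ) (p : ι → CSpace N) : ℝ :=
  (∑ i, ∑ j, x i * conj (x j) * ballKernel β (p i) (p j)).re

lemma bergmanENorm_kernelSum {ι : Type*} [Fintype ι] (hN : 0 < N) (hs : -1 < s) (x : ι → ℂ)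
    {p : ι → CSpace N} (hp : ∀ i, ‖p i‖ < 1) :
    bergmanENorm N s (kernelSum (N + s + 1) x p) ^ 2 =
      ENNReal.ofReal (kernelQuad (N + s + 1) x p) := by
  have hNpos : (0 : ℝ) < N := by exact_mod_cast hN
  have hβ : 0 ≤ (N : ℝ) + s + 1 := by linarith
  set μ := bergmanMeasure N s
  have hexp : ∀ z, ((‖kernelSum (N + s + 1) x p z‖ ^ 2 : ℝ) : ℂ) = ∑ i, ∑ j, x i * conj (x j) *
      (ballKernel (N + s + 1) (p i) z * conj (ballKernel (N + s + 1) (p j) z)) := by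
    intro z
    rw [Complex.ofReal_pow, ← Complex.mul_conj', kernelSum, map_sum, Finset.sum_mul_sum]
    refine Finset.sum_congr rfl fun i _ => Finset.sum_congr rfl fun j _ => ?_
    rw [map_mul]; ring
  have hint : ∀ i j, Integrable (fun z => x i * conj (x j) *
      (ballKernel (N + s + 1) (p i) z * conj (ballKernel (N + s + 1) (p j) z))) μ := fun i j =>
    (integrable_ballKernel_mul_conj hN hs hβ (hp i) (hp j)).const_mul _
  have hintC : Integrable (fun z => ((‖kernelSum (N + s + 1) x p z‖ ^ 2 : ℝ) : ℂ)) μ := by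
    simp_rw [hexp]
    exact integrable_finsetSum _ fun i _ => integrable_finsetSum _ fun j _ => hint i j
  have hintR : Integrable (fun z => ‖kernelSum (N + s + 1) x p z‖ ^ 2) μ := by
    simpa only [RCLike.re_to_complex, Complex.ofReal_re] using hintC.re
  have hval : ((∫ z, ‖kernelSum (N + s + 1) x p z‖ ^ 2 ∂μ : ℝ) : ℂ) =
      ∑ i, ∑ j, x i * conj (x j) * ballKernel (N + s + 1) (p i) (p j) := by
    rw [← integral_complex_ofReal]
    simp_rw [hexp]
    rw [integral_finsetSum _ fun i _ => integrable_finsetSum _ fun j _ => hint i j]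
    refine Finset.sum_congr rfl fun i _ => ?_
    rw [integral_finsetSum _ fun j _ => hint i j]
    refine Finset.sum_congr rfl fun j _ => ?_
    rw [integral_const_mul, integral_ballKernel_mul_conj hN hs (hp i) (hp j)]
  have hval' : ∫ z, ‖kernelSum (N + s + 1) x p z‖ ^ 2 ∂μ = kernelQuad (N + s + 1) x p := by
    rw [kernelQuad, ← hval, Complex.ofReal_re]
  rw [← hval', ofReal_integral_eq_lintegral_ofReal hintR
    (Eventually.of_forall fun z => by positivity), bergmanENorm]
  have h2 := eLpNorm_nnreal_pow_eq_lintegral (μ := μ) (f := kernelSum (N + s + 1) x p)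
    (p := 2) two_ne_zero
  simp only [NNReal.coe_ofNat, ENNReal.coe_ofNat, ENNReal.rpow_ofNat] at h2
  rw [h2]
  refine lintegral_congr fun z => ?_
  rw [ENNReal.ofReal_pow (norm_nonneg _), ofReal_norm]

end BergmanKernel

/-! ### The quadratic form of a kernel sum -/

section KernelForm

open scoped InnerProductSpace ComplexConjugate

variable {N : ℕ} {s : ℝ} {ι : Type*} [Fintype ι]

lemma measurable_kernelSum (β : ℝ) (x : ι → ℂ) (p : ι → CSpace N) :
    Measurable (kernelSum β x p) := by
  unfold kernelSum
  exact Finset.measurable_sum _ fun i _ => (measurable_ballKernel β (p i)).const_mul _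

lemma differentiableOn_kernelSum (β : ℝ) (x : ι → ℂ) {p : ι → CSpace N} (hp : ∀ i, ‖p i‖ < 1) :
    DifferentiableOn ℂ (kernelSum β x p) (ball 0 1) := by
  unfold kernelSum
  exact DifferentiableOn.fun_sum fun i _ => (differentiableOn_ballKernel β (hp i)).const_mul _

lemma integral_kernelSum_mul_conj (hN : 0 < N) (hs : -1 < s) (x y : ι → ℂ) {p q : ι → CSpace N}
    (hp : ∀ i, ‖p i‖ < 1) (hq : ∀ i, ‖q i‖ < 1) :
    ∫ z, kernelSum (N + s + 1) x p z * conj (kernelSum (N + s + 1) y q z) ∂bergmanMeasure N s =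
      ∑ i, ∑ j, x i * conj (y j) * ballKernel (N + s + 1) (p i) (q j) := by
  have hNpos : (0 : ℝ) < N := by exact_mod_cast hN
  have hβ : 0 ≤ (N : ℝ) + s + 1 := by linarith
  have hexp : ∀ z, kernelSum (N + s + 1) x p z * conj (kernelSum (N + s + 1) y q z) =
      ∑ i, ∑ j, x i * conj (y j) *
      (ballKernel (N + s + 1) (p i) z * conj (ballKernel (N + s + 1) (q j) z)) := by
    intro z
    rw [kernelSum, kernelSum, map_sum, Finset.sum_mul_sum]
    refine Finset.sum_congr rfl fun i _ => Finset.sum_congr rfl fun j _ => ?_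
    rw [map_mul]; ring
  have hint : ∀ i j, Integrable (fun z => x i * conj (y j) *
      (ballKernel (N + s + 1) (p i) z * conj (ballKernel (N + s + 1) (q j) z)))
      (bergmanMeasure N s) := fun i j =>
    (integrable_ballKernel_mul_conj hN hs hβ (hp i) (hq j)).const_mul _
  simp_rw [hexp]
  rw [integral_finsetSum _ fun i _ => integrable_finsetSum _ fun j _ => hint i j]
  refine Finset.sum_congr rfl fun i _ => ?_
  rw [integral_finsetSum _ fun j _ => hint i j]
  refine Finset.sum_congr rfl fun j _ => ?_
  rw [integral_const_mul, integral_ballKernel_mul_conj hN hs (hp i) (hq j)]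

lemma kernelQuad_nonneg (hN : 0 < N) (hs : -1 < s) (x : ι → ℂ) {p : ι → CSpace N}
    (hp : ∀ i, ‖p i‖ < 1) : 0 ≤ kernelQuad (N + s + 1) x p := by
  rw [kernelQuad, ← integral_kernelSum_mul_conj hN hs x x hp hp]
  simp_rw [Complex.mul_conj']
  have : ∀ z, ((‖kernelSum (N + s + 1) x p z‖ : ℂ) ^ 2) =
      ((‖kernelSum (N + s + 1) x p z‖ ^ 2 : ℝ) : ℂ) := fun z => by push_cast; rfl
  simp_rw [this]
  rw [integral_complex_ofReal, Complex.ofReal_re]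
  exact integral_nonneg fun z => by positivity

/-- The Cauchy–Schwarz inequality for kernel sums. -/
lemma norm_kernelForm_sq_le (hN : 0 < N) (hs : -1 < s) (x y : ι → ℂ) {p q : ι → CSpace N}
    (hp : ∀ i, ‖p i‖ < 1) (hq : ∀ i, ‖q i‖ < 1) :
    ‖∑ i, ∑ j, x i * conj (y j) * ballKernel (N + s + 1) (p i) (q j)‖ ^ 2 ≤
      kernelQuad (N + s + 1) x p * kernelQuad (N + s + 1) y q := by
  rw [← integral_kernelSum_mul_conj hN hs x y hp hq]
  set f := kernelSum (N + s + 1) x p with hf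
  set g := kernelSum (N + s + 1) y q with hg
  have hQf := kernelQuad_nonneg hN hs x hp
  have hQg := kernelQuad_nonneg hN hs y hq
  have h1 : ‖∫ z, f z * conj (g z) ∂bergmanMeasure N s‖ₑ ≤
      bergmanENorm N s f * bergmanENorm N s g := by
    have h2 := ENNReal.lintegral_mul_le_Lp_mul_Lq (bergmanMeasure N s)
      Real.HolderConjugate.two_two
      ((measurable_kernelSum (N + s + 1) x p).enorm.aemeasurable)
      ((measurable_kernelSum (N + s + 1) y q).enorm.aemeasurable)
    refine (enorm_integral_le_lintegral_enorm _).trans ?_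
    rw [bergmanENorm, bergmanENorm,
      eLpNorm_eq_lintegral_rpow_enorm_toReal two_ne_zero ENNReal.ofNat_ne_top,
      eLpNorm_eq_lintegral_rpow_enorm_toReal two_ne_zero ENNReal.ofNat_ne_top,
      ENNReal.toReal_ofNat]
    refine le_trans (le_of_eq ?_) h2
    refine lintegral_congr fun z => ?_
    rw [enorm_mul, RCLike.enorm_conj]
    rfl
  have h3 := pow_le_pow_left' h1 2
  rw [mul_pow, hf, hg, bergmanENorm_kernelSum hN hs x hp, bergmanENorm_kernelSum hN hs y hq,
    ← ofReal_norm, ← ENNReal.ofReal_pow (norm_nonneg _), ← ENNReal.ofReal_mul hQf] at h3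
  exact (ENNReal.ofReal_le_ofReal_iff (mul_nonneg hQf hQg)).1 h3

/-- Let `Q` be the quadratic form and `H(c) = ∑ x_i conj(x_j) K_{p_i}(c r p_j)`. For `|c| = 1`,
Cauchy–Schwarz and rotation invariance bound `|H(c)|` by `√(Q(p) Q(rp))`. The maximum principle
extends this to `c = r`, where `H(r) = Q(rp)`; squaring and dividing by `Q(rp)` ends the proof. In
the Hardy case the inequality permits a dilation of the points before `s → -1`. -/
lemma kernelQuad_smul_le (hN : 0 < N) (hs : -1 < s) (x : ι → ℂ) {p : ι → CSpace N}
    (hp : ∀ i, ‖p i‖ < 1) {r : ℝ} (hr0 : 0 ≤ r) (hr1 : r < 1) :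
    kernelQuad (N + s + 1) x (fun i => (r : ℂ) • p i) ≤ kernelQuad (N + s + 1) x p := by
  have hsm : ∀ (c : ℂ), ‖c‖ ≤ 1 → ∀ i, ‖c • p i‖ < 1 := fun c hc i => by
    rw [norm_smul]; nlinarith [hp i, norm_nonneg (p i), norm_nonneg c]
  have hrn : ‖(r : ℂ)‖ = r := by rw [Complex.norm_real, Real.norm_of_nonneg hr0]
  have hrp := hsm r (by rw [hrn]; exact hr1.le)
  set H : ℂ → ℂ := fun c => ∑ i, ∑ j, x i * conj (x j) *
    ballKernel (N + s + 1) (p i) (c • (r : ℂ) • p j) with hH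
  have hker : ∀ (c : ℂ) (a b : CSpace N), ballKernel (N + s + 1) a (c • b) =
      ballKernel (N + s + 1) (conj c • a) b := fun c a b => by
    rw [ballKernel, ballKernel, inner_smul_right, inner_smul_left, Complex.conj_conj]
  have hQr := kernelQuad_nonneg hN hs x hrp
  have hQ1 := kernelQuad_nonneg hN hs x hp
  have hbound : ∀ c : ℂ, ‖c‖ = 1 → ‖H c‖ ≤
      √(kernelQuad (N + s + 1) x p * kernelQuad (N + s + 1) x (fun i => (r : ℂ) • p i)) := by
    intro c hc
    refine Real.le_sqrt_of_sq_le ?_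
    have hcp := hsm (conj c) (by rw [RCLike.norm_conj, hc])
    have h1 := norm_kernelForm_sq_le hN hs x x hcp hrp
    have h2 : kernelQuad (N + s + 1) x (fun i => conj c • p i) = kernelQuad (N + s + 1) x p := by
      unfold kernelQuad
      congr 1
      refine Finset.sum_congr rfl fun i _ => Finset.sum_congr rfl fun j _ => ?_
      rw [hker, smul_smul, Complex.conj_conj, Complex.mul_conj', hc]
      simp
    rw [h2] at h1
    refine le_trans (le_of_eq ?_) h1
    simp only [hH, hker c]
  have hd : DiffContOnCl ℂ H (ball 0 1) := by
    refine DifferentiableOn.diffContOnCl ?_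
    rw [closure_ball _ one_ne_zero]
    refine DifferentiableOn.fun_sum fun i _ => DifferentiableOn.fun_sum fun j _ => ?_
    refine DifferentiableOn.const_mul ?_ _
    refine (differentiableOn_ballKernel _ (hp i)).comp (by fun_prop) fun c hc => ?_
    rw [mem_ball_zero_iff, norm_smul]
    have := hrp j
    have hc1 : ‖c‖ ≤ 1 := mem_closedBall_zero_iff.1 hc
    nlinarith [norm_nonneg c, norm_nonneg ((r : ℂ) • p j)]
  have hmax := Complex.norm_le_of_forall_mem_frontier_norm_le isBounded_ball hd
    (C := √(kernelQuad (N + s + 1) x p * kernelQuad (N + s + 1) x (fun i => (r : ℂ) • p i)))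
    (fun c hc => hbound c (by
      rw [frontier_ball _ one_ne_zero] at hc; simpa using hc)) (z := (r : ℂ))
    (subset_closure (by rw [mem_ball_zero_iff, hrn]; exact hr1))
  have hHr : kernelQuad (N + s + 1) x (fun i => (r : ℂ) • p i) ≤ ‖H r‖ := by
    refine le_trans (le_of_eq ?_) (Complex.re_le_norm _)
    unfold kernelQuad
    congr 1
    refine Finset.sum_congr rfl fun i _ => Finset.sum_congr rfl fun j _ => ?_
    rw [hker (r : ℂ) (p i), Complex.conj_ofReal]
  have h1 := pow_le_pow_left₀ hQr (hHr.trans hmax) 2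
  rw [Real.sq_sqrt (mul_nonneg hQ1 hQr), sq] at h1
  rcases hQr.eq_or_lt with h0 | h0
  · rw [← h0]; exact hQ1
  · exact le_of_mul_le_mul_right h1 h0

end KernelForm

/-! ### Comparison of the Hardy and Bergman norms -/

section Hardy

open scoped InnerProductSpace ComplexConjugate

variable {N : ℕ} {s : ℝ}

lemma isProbabilityMeasure_sphereMeasure (hN : 0 < N) : IsProbabilityMeasure (sphereMeasure N) := by
  have : Nonempty (Fin N) := ⟨⟨0, hN⟩⟩
  constructor
  rw [sphereMeasure, Measure.smul_apply, smul_eq_mul]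
  refine ENNReal.inv_mul_cancel ?_ (measure_ne_top _ _)
  rw [Ne, Measure.measure_univ_eq_zero]
  exact Measure.toSphere_ne_zero _

/-- Integration in polar coordinates for the weighted measures on the ball. -/
lemma exists_polar_bergmanMeasure (hN : 0 < N) (s : ℝ) :
    ∃ m : Measure (Set.Ioi (0 : ℝ)), (∀ᵐ ρ : Set.Ioi (0 : ℝ) ∂m, (ρ : ℝ) < 1) ∧
      ∀ g : CSpace N → ℝ≥0∞, Measurable g → ∫⁻ z, g z ∂bergmanMeasure N s =
        ∫⁻ ρ, ∫⁻ ξ : sphere (0 : CSpace N) 1, g ((ρ : ℝ) • (ξ : CSpace N)) ∂sphereMeasure N ∂m := by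
  have : Nonempty (Fin N) := ⟨⟨0, hN⟩⟩
  have := isProbabilityMeasure_sphereMeasure hN
  set V := volume (ball (0 : CSpace N) 1) with hV
  set τ := (volume : Measure (CSpace N)).toSphere with hτ
  have hT0 : τ Set.univ ≠ 0 := by
    rw [Ne, Measure.measure_univ_eq_zero]
    exact Measure.toSphere_ne_zero _
  have hTt : τ Set.univ ≠ ∞ := measure_ne_top _ _
  set W : ℝ → ℝ≥0∞ := (Set.Iio 1).indicator fun y => ENNReal.ofReal
    (Real.Gamma (N + s + 1) / (Real.Gamma (N + 1) * Real.Gamma (s + 1)) * (1 - y ^ 2) ^ s) with hW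
  have hWm : Measurable W := by
    refine Measurable.indicator ?_ measurableSet_Iio
    fun_prop
  set ν := Measure.volumeIoiPow (Module.finrank ℝ (CSpace N) - 1) with hν
  have hdens : Measurable fun ρ : Set.Ioi (0 : ℝ) => V⁻¹ * τ Set.univ * W ρ :=
    (hWm.comp measurable_subtype_coe).const_mul _
  -- The factor `τ univ` undoes the normalization of the sphere measure and `V⁻¹` supplies that of
  -- the ball measure; `W` vanishes from radius 1 on.
  refine ⟨ν.withDensity fun ρ => V⁻¹ * τ Set.univ * W ρ, ?_, fun g hg => ?_⟩
  · rw [ae_withDensity_iff hdens]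
    refine Eventually.of_forall fun ρ hρ => ?_
    by_contra hcon
    refine hρ ?_
    rw [hW, Set.indicator_of_notMem (by simpa using hcon), mul_zero]
  · have hgm : Measurable fun p : Set.Ioi (0 : ℝ) × sphere (0 : CSpace N) 1 =>
        g ((p.1 : ℝ) • (p.2 : CSpace N)) := hg.comp (by fun_prop)
    rw [lintegral_bergmanMeasure hg, lintegral_withDensity_eq_lintegral_mul _ hdens
      (Measurable.lintegral_prod_right' hgm), ← lintegral_indicator measurableSet_ball]
    have h1 : ∀ z : CSpace N, (ball (0 : CSpace N) 1).indicator
        (fun z => ENNReal.ofReal (bergmanWeight N s z) * g z) z = W ‖z‖ * g z := by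
      intro z
      simp only [hW, Set.indicator_apply, mem_ball_zero_iff, Set.mem_Iio, bergmanWeight]
      split_ifs <;> simp
    simp_rw [h1]
    have h2 := ((volume : Measure (CSpace N)).measurePreserving_homeomorphUnitSphereProd).symm
      (homeomorphUnitSphereProd (CSpace N)).toMeasurableEquiv
    have hGm : Measurable fun z : CSpace N => W ‖z‖ * g z := (hWm.comp measurable_norm).mul hg
    have h3 : ∫⁻ z : CSpace N, W ‖z‖ * g z =
        ∫⁻ z : ({0}ᶜ : Set (CSpace N)), W ‖(z : CSpace N)‖ * g z ∂(volume.comap Subtype.val) := by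
      rw [lintegral_subtype_comap (measurableSet_singleton _).compl (fun z => W ‖z‖ * g z),
        restrict_compl_singleton]
    rw [h3, ← h2.lintegral_comp (f := fun z : ({0}ᶜ : Set (CSpace N)) =>
      W ‖(z : CSpace N)‖ * g z) (hGm.comp measurable_subtype_coe)]
    have h4 : ∀ q : sphere (0 : CSpace N) 1 × Set.Ioi (0 : ℝ),
        (((homeomorphUnitSphereProd (CSpace N)).toMeasurableEquiv.symm q :
          ({0}ᶜ : Set (CSpace N))) : CSpace N) = (q.2 : ℝ) • (q.1 : CSpace N) := fun q => rfl
    simp_rw [h4]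
    have h5 : ∀ q : sphere (0 : CSpace N) 1 × Set.Ioi (0 : ℝ),
        ‖(q.2 : ℝ) • (q.1 : CSpace N)‖ = q.2 := fun q => by
      have : ‖(q.1 : CSpace N)‖ = 1 := by simp
      rw [norm_smul, this, mul_one, Real.norm_of_nonneg q.2.2.le]
    simp_rw [h5]
    have hFm : Measurable fun q : sphere (0 : CSpace N) 1 × Set.Ioi (0 : ℝ) =>
        W (q.2 : ℝ) * g ((q.2 : ℝ) • (q.1 : CSpace N)) :=
      (hWm.comp (measurable_subtype_coe.comp measurable_snd)).mul (hg.comp (by fun_prop))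
    rw [lintegral_prod_symm' _ hFm, ← lintegral_const_mul' _ _ (by
      rw [Ne, ENNReal.inv_eq_top]; exact (measure_ball_pos _ _ one_pos).ne')]
    refine lintegral_congr fun ρ => ?_
    simp only [Pi.mul_apply]
    have hgρ : Measurable fun ξ : sphere (0 : CSpace N) 1 => g ((ρ : ℝ) • (ξ : CSpace N)) :=
      hg.comp (by fun_prop)
    rw [lintegral_const_mul _ hgρ, sphereMeasure, lintegral_smul_measure,
      smul_eq_mul, ← hτ]
    calc V⁻¹ * (W ρ * ∫⁻ ξ : sphere (0 : CSpace N) 1, g ((ρ : ℝ) • (ξ : CSpace N)) ∂τ)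
        = (τ Set.univ * (τ Set.univ)⁻¹) * (V⁻¹ *
          (W ρ * ∫⁻ ξ : sphere (0 : CSpace N) 1, g ((ρ : ℝ) • (ξ : CSpace N)) ∂τ)) := by
          rw [ENNReal.mul_inv_cancel hT0 hTt, one_mul]
      _ = _ := by ring

/-- The weighted Bergman norms are dominated by the Hardy norm. -/
lemma bergmanENorm_le_hardyENorm (hN : 0 < N) (hs : -1 < s) {f : CSpace N → ℂ}
    (hf : Measurable f) : bergmanENorm N s f ≤ hardyENorm N f := by
  have := isProbabilityMeasure_bergmanMeasure hN hs
  have := isProbabilityMeasure_sphereMeasure hN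
  obtain ⟨m, hm1, hm⟩ := exists_polar_bergmanMeasure hN s
  have hmass : m Set.univ = 1 := by
    have := hm 1 measurable_one
    simpa using this.symm
  rw [bergmanENorm, eLpNorm_eq_lintegral_rpow_enorm_toReal two_ne_zero ENNReal.ofNat_ne_top,
    ENNReal.toReal_ofNat, one_div, ENNReal.rpow_inv_le_iff two_pos]
  rw [hm _ (by fun_prop)]
  calc _ ≤ ∫⁻ _ : Set.Ioi (0 : ℝ), hardyENorm N f ^ (2 : ℝ) ∂m := by
        refine lintegral_mono_ae ?_
        filter_upwards [hm1] with ρ hρ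
        have h1 : eLpNorm (fun ξ : sphere (0 : CSpace N) 1 => f ((ρ : ℝ) • (ξ : CSpace N))) 2
            (sphereMeasure N) ≤ hardyENorm N f :=
          le_iSup₂ (f := fun (r : ℝ) (_ : r ∈ Set.Ioo (0 : ℝ) 1) =>
            eLpNorm (fun ζ : sphere (0 : CSpace N) 1 => f (r • (ζ : CSpace N))) 2
              (sphereMeasure N)) (ρ : ℝ) ⟨ρ.2, hρ⟩
        rwa [eLpNorm_eq_lintegral_rpow_enorm_toReal two_ne_zero ENNReal.ofNat_ne_top,
          ENNReal.toReal_ofNat, one_div, ENNReal.rpow_inv_le_iff two_pos] at h1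
    _ = hardyENorm N f ^ (2 : ℝ) := by rw [lintegral_const, hmass, mul_one]

/-- The sharp pointwise bound in the Hardy space. -/
lemma enorm_apply_le_hardyENorm (hN : 0 < N) {f : CSpace N → ℂ}
    (hf : DifferentiableOn ℂ f (ball 0 1)) (hfm : Measurable f) {w : CSpace N} (hw : ‖w‖ < 1) :
    ‖f w‖ₑ * ENNReal.ofReal ((1 - ‖w‖ ^ 2) ^ ((N : ℝ) / 2)) ≤ hardyENorm N f := by
  have hw1 := one_sub_norm_sq_pos hw
  -- The Hardy norm dominates every Bergman norm with constant 1, so the Bergman bound holds with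
  -- the Hardy norm on the right for each `s > -1`, and only the exponent changes as `s → -1`.
  have hlim : Tendsto (fun s : ℝ => ‖f w‖ₑ *
      ENNReal.ofReal ((1 - ‖w‖ ^ 2) ^ (((N : ℝ) + s + 1) / 2))) (𝓝[>] (-1))
      (𝓝 (‖f w‖ₑ * ENNReal.ofReal ((1 - ‖w‖ ^ 2) ^ ((N : ℝ) / 2)))) := by
    refine ENNReal.Tendsto.const_mul ?_ (Or.inr enorm_ne_top)
    refine ENNReal.tendsto_ofReal ?_
    have hc : Continuous fun s : ℝ => (1 - ‖w‖ ^ 2) ^ (((N : ℝ) + s + 1) / 2) :=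
      continuous_const.rpow (by fun_prop) fun _ => Or.inl hw1.ne'
    refine (hc.tendsto' (-1) _ ?_).mono_left nhdsWithin_le_nhds
    congr 2; ring
  refine le_of_tendsto hlim ?_
  filter_upwards [self_mem_nhdsWithin] with s hs
  exact (enorm_apply_le_bergmanENorm hN hs hf hfm hw).trans
    (bergmanENorm_le_hardyENorm hN hs hfm)

end Hardy

/-! ### Kernel sums in the Hardy space -/

section HardyKernel

open scoped InnerProductSpace ComplexConjugate

variable {N : ℕ} {s : ℝ} {ι : Type*} [Fintype ι]

/-- The weighted measures concentrate on the sphere as the parameter tends to `-1`. -/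
lemma tendsto_bergmanMeasure_closedBall (hN : 0 < N) {ρ : ℝ} (hρ0 : 0 ≤ ρ) (hρ1 : ρ < 1) :
    Tendsto (fun s => bergmanMeasure N s (closedBall 0 ρ)) (𝓝[>] (-1)) (𝓝 0) := by
  have hNpos : (0 : ℝ) < N := by exact_mod_cast hN
  have hρ : 0 < 1 - ρ ^ 2 := by nlinarith
  set C : ℝ → ℝ := fun s => Real.Gamma (N + s + 1) / (Real.Gamma (N + 1) * Real.Gamma (s + 1)) *
    (1 - ρ ^ 2) ^ s with hC
  have hIoo : ∀ᶠ s in 𝓝[>] (-1 : ℝ), s ∈ Set.Ioo (-1 : ℝ) 0 := Ioo_mem_nhdsGT (by norm_num)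
  have hle : ∀ s ∈ Set.Ioo (-1 : ℝ) 0,
      bergmanMeasure N s (closedBall 0 ρ) ≤ ENNReal.ofReal (C s) := by
    intro s hs
    have hG1 := Real.Gamma_pos_of_pos (by linarith [hs.1] : 0 < s + 1)
    have hG2 := Real.Gamma_pos_of_pos (by linarith : 0 < (N : ℝ) + 1)
    have hG3 := Real.Gamma_pos_of_pos (by linarith [hs.1] : 0 < (N : ℝ) + s + 1)
    rw [← lintegral_indicator_one measurableSet_closedBall, lintegral_bergmanMeasure
      (measurable_one.indicator measurableSet_closedBall)]
    calc _ ≤ (volume (ball (0 : CSpace N) 1))⁻¹ *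
          ∫⁻ z in ball (0 : CSpace N) 1, ENNReal.ofReal (C s) := by
          gcongr with z
          by_cases hz : z ∈ closedBall (0 : CSpace N) ρ
          · rw [Set.indicator_of_mem hz, Pi.one_apply, mul_one]
            refine ENNReal.ofReal_le_ofReal ?_
            have hz' : ‖z‖ ≤ ρ := mem_closedBall_zero_iff.1 hz
            refine mul_le_mul_of_nonneg_left ?_ (by positivity)
            exact Real.rpow_le_rpow_of_nonpos hρ (by gcongr) hs.2.le
          · rw [Set.indicator_of_notMem hz, mul_zero]
            exact zero_le
      _ = ENNReal.ofReal (C s) := by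
          rw [lintegral_const, Measure.restrict_apply_univ, mul_comm, mul_assoc,
            ENNReal.mul_inv_cancel (measure_ball_pos _ _ one_pos).ne' measure_ball_lt_top.ne,
            mul_one]
  -- The constant vanishes in the limit because `1 / Γ(s + 1) = (s + 1) / Γ(s + 2)`.
  have hClim : Tendsto C (𝓝[>] (-1)) (𝓝 0) := by
    have hGc : ∀ y : ℝ, 0 < y → ContinuousAt Real.Gamma y := fun y hy =>
      (Real.differentiableAt_Gamma fun m hm => by
      have : (0 : ℝ) ≤ m := Nat.cast_nonneg m
      linarith).continuousAt
    have h1 : Tendsto (fun s : ℝ => Real.Gamma (N + s + 1) * ((s + 1) / Real.Gamma (s + 1 + 1)) /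
        Real.Gamma (N + 1) * (1 - ρ ^ 2) ^ s) (𝓝 (-1))
        (𝓝 (Real.Gamma (N + (-1) + 1) * ((-1 + 1) / Real.Gamma (-1 + 1 + 1)) /
        Real.Gamma (N + 1) * (1 - ρ ^ 2) ^ (-1 : ℝ))) := by
      refine ((Tendsto.mul ?_ (Tendsto.div ?_ ?_ ?_)).div_const _).mul ?_
      · exact (hGc _ (by linarith)).tendsto.comp
          ((continuous_const.add continuous_id).add continuous_const).continuousAt
      · exact (continuous_id.add continuous_const).continuousAt
      · exact (hGc _ (by norm_num)).tendsto.comp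
          ((continuous_id.add continuous_const).add continuous_const).continuousAt
      · norm_num
      · exact (Real.continuous_const_rpow hρ.ne').continuousAt
    have h2 : Real.Gamma (N + (-1) + 1) * (((-1 : ℝ) + 1) / Real.Gamma (-1 + 1 + 1)) /
        Real.Gamma (N + 1) * (1 - ρ ^ 2) ^ (-1 : ℝ) = 0 := by norm_num
    rw [h2] at h1
    refine (h1.mono_left nhdsWithin_le_nhds).congr' ?_
    filter_upwards [hIoo] with s hs
    have hs1 : s + 1 ≠ 0 := by linarith [hs.1]
    have hG1 := (Real.Gamma_pos_of_pos (by linarith [hs.1] : 0 < s + 1)).ne'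
    rw [hC, Real.Gamma_add_one hs1]
    field_simp
  have h3 := ENNReal.tendsto_ofReal hClim
  rw [ENNReal.ofReal_zero] at h3
  refine tendsto_of_tendsto_of_tendsto_of_le_of_le' tendsto_const_nhds h3
    (Eventually.of_forall fun _ => zero_le) ?_
  filter_upwards [hIoo] with s hs using hle s hs

lemma tendsto_ballKernel {α : Type*} {l : Filter α} {b : α → ℝ} {u : α → CSpace N} {β : ℝ}
    {a z : CSpace N} (ha : ‖a‖ < 1) (hz : ‖z‖ ≤ 1) (hb : Tendsto b l (𝓝 β))
    (hu : Tendsto u l (𝓝 z)) :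
    Tendsto (fun t => ballKernel (b t) a (u t)) l (𝓝 (ballKernel β a z)) := by
  unfold ballKernel
  refine Tendsto.cpow (tendsto_const_nhds.sub (tendsto_const_nhds.inner hu))
    ((Complex.continuous_ofReal.tendsto _).comp hb.neg) (Or.inl (one_sub_inner_re_pos ha hz))

lemma tendsto_kernelQuad {β : ℝ} (x : ι → ℂ) {p : ι → CSpace N} (hp : ∀ i, ‖p i‖ < 1)
    {α : Type*} {l : Filter α} {b : α → ℝ} (hb : Tendsto b l (𝓝 β)) :
    Tendsto (fun t => kernelQuad (b t) x p) l (𝓝 (kernelQuad β x p)) := by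
  unfold kernelQuad
  refine (Complex.continuous_re.tendsto _).comp ?_
  exact tendsto_finsetSum _ fun i _ => tendsto_finsetSum _ fun j _ =>
    (tendsto_ballKernel (hp i) (hp j).le hb tendsto_const_nhds).const_mul _

lemma ballKernel_smul_right (β : ℝ) (r : ℝ) (a z : CSpace N) :
    ballKernel β a (r • z) = ballKernel β ((r : ℂ) • a) z := by
  rw [ballKernel, ballKernel, ← Complex.coe_smul, inner_smul_right, inner_smul_left,
    Complex.conj_ofReal]

lemma kernelSum_smul (β : ℝ) (x : ι → ℂ) (p : ι → CSpace N) (r : ℝ) (z : CSpace N) :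
    kernelSum β x p (r • z) = kernelSum β x (fun i => (r : ℂ) • p i) z := by
  simp only [kernelSum, ballKernel_smul_right]

/-- The limit is joint in exponent and radius because, in polar coordinates, a Bergman norm near `s
= -1` averages over all radii near 1 while the kernel depends on `s` as well. -/
lemma tendsto_lintegral_sphere_kernelSum (hN : 0 < N) (x : ι → ℂ) {p : ι → CSpace N}
    (hp : ∀ i, ‖p i‖ < 1) :
    Tendsto (fun q : ℝ × ℝ => ∫⁻ ξ : sphere (0 : CSpace N) 1,
      ‖kernelSum (N + q.1 + 1) x p (q.2 • (ξ : CSpace N))‖ₑ ^ 2 ∂sphereMeasure N)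
      (𝓝[>] (-1) ×ˢ 𝓝[<] 1)
      (𝓝 (∫⁻ ξ : sphere (0 : CSpace N) 1, ‖kernelSum N x p (ξ : CSpace N)‖ₑ ^ 2
        ∂sphereMeasure N)) := by
  have := isProbabilityMeasure_sphereMeasure hN
  have hNpos : (0 : ℝ) < N := by exact_mod_cast hN
  set B : ℝ := ∑ i, ‖x i‖ * (1 - ‖p i‖) ^ (-((N : ℝ) + 1)) with hB
  have hB0 : 0 ≤ B := Finset.sum_nonneg fun i _ => by
    have := hp i
    have : 0 ≤ 1 - ‖p i‖ := by linarith
    positivity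
  have hev : ∀ᶠ q : ℝ × ℝ in 𝓝[>] (-1) ×ˢ 𝓝[<] 1,
      q.1 ∈ Set.Ioo (-1 : ℝ) 0 ∧ q.2 ∈ Set.Ioo (0 : ℝ) 1 :=
    prod_mem_prod (Ioo_mem_nhdsGT (by norm_num : (-1 : ℝ) < 0))
      (Ioo_mem_nhdsLT (by norm_num : (0 : ℝ) < 1))
  refine tendsto_lintegral_filter_of_dominated_convergence
    (fun _ => ENNReal.ofReal (B ^ 2)) ?_ ?_ ?_ ?_
  · refine Eventually.of_forall fun q => ?_
    exact (((measurable_kernelSum _ x p).comp (by fun_prop)).enorm).pow_const 2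
  · filter_upwards [hev] with q hq
    refine Eventually.of_forall fun ξ => ?_
    rw [← ofReal_norm, ← ENNReal.ofReal_pow (norm_nonneg _)]
    refine ENNReal.ofReal_le_ofReal ?_
    gcongr
    rw [kernelSum, hB]
    refine (norm_sum_le _ _).trans (Finset.sum_le_sum fun i _ => ?_)
    rw [norm_mul]
    gcongr
    have hξ : ‖(ξ : CSpace N)‖ = 1 := by simp
    refine (norm_ballKernel_le (by linarith [hq.1.1]) (hp i) ?_).trans ?_
    · rw [norm_smul, hξ, mul_one, Real.norm_of_nonneg hq.2.1.le]
      exact hq.2.2.le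
    · refine Real.rpow_le_rpow_of_exponent_ge (by linarith [hp i]) (by linarith [norm_nonneg (p i)])
        (by linarith [hq.1.2])
  · rw [lintegral_const]
    exact ENNReal.mul_ne_top ENNReal.ofReal_ne_top (measure_ne_top _ _)
  · refine Eventually.of_forall fun ξ => ?_
    have hξ : ‖(ξ : CSpace N)‖ = 1 := by simp
    have h1 : Tendsto (fun q : ℝ × ℝ => (N : ℝ) + q.1 + 1) (𝓝[>] (-1) ×ˢ 𝓝[<] 1) (𝓝 (N : ℝ)) := by
      have : Tendsto (fun t : ℝ => (N : ℝ) + t + 1) (𝓝 (-1)) (𝓝 (N : ℝ)) :=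
        (by fun_prop : Continuous fun t : ℝ => (N : ℝ) + t + 1).tendsto' _ _ (by ring)
      exact this.comp (tendsto_fst.mono_right nhdsWithin_le_nhds)
    have h2 : Tendsto (fun q : ℝ × ℝ => q.2 • (ξ : CSpace N)) (𝓝[>] (-1) ×ˢ 𝓝[<] 1)
        (𝓝 (ξ : CSpace N)) := by
      have : Tendsto (fun q : ℝ × ℝ => q.2) (𝓝[>] (-1) ×ˢ 𝓝[<] 1) (𝓝 1) :=
        tendsto_snd.mono_right nhdsWithin_le_nhds
      simpa using this.smul_const (ξ : CSpace N)
    have h3 : Tendsto (fun q : ℝ × ℝ => kernelSum (N + q.1 + 1) x p (q.2 • (ξ : CSpace N)))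
        (𝓝[>] (-1) ×ˢ 𝓝[<] 1) (𝓝 (kernelSum N x p (ξ : CSpace N))) := by
      unfold kernelSum
      exact tendsto_finsetSum _ fun i _ =>
        (tendsto_ballKernel (hp i) hξ.le h1 h2).const_mul _
    exact ((ENNReal.continuous_pow 2).tendsto _).comp h3.enorm

/-- Absorb `r` into the points. Any `a'` below the resulting sphere integral is also below the
integrals at radii beyond some `ρ₁ < 1`, for `s` near `-1`. Hence `a'` times the mass outside the
ball of radius `ρ₁` is at most the squared Bergman norm, which is bounded by the quadratic form of
the undilated points. As `s → -1` that mass tends to 1. -/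
lemma lintegral_sphere_kernelSum_le (hN : 0 < N) (x : ι → ℂ) {p : ι → CSpace N}
    (hp : ∀ i, ‖p i‖ < 1) {r : ℝ} (hr : r ∈ Set.Ioo (0 : ℝ) 1) :
    ∫⁻ ξ : sphere (0 : CSpace N) 1, ‖kernelSum N x p (r • (ξ : CSpace N))‖ₑ ^ 2
        ∂sphereMeasure N ≤ ENNReal.ofReal (kernelQuad N x p) := by
  have hσ := isProbabilityMeasure_sphereMeasure hN
  set p' : ι → CSpace N := fun i => (r : ℂ) • p i with hp'
  have hp'1 : ∀ i, ‖p' i‖ < 1 := fun i => by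
    rw [hp', norm_smul, Complex.norm_real, Real.norm_of_nonneg hr.1.le]
    nlinarith [hp i, norm_nonneg (p i), hr.1, hr.2]
  simp_rw [kernelSum_smul]
  refine le_of_forall_lt fun a ha => ?_
  obtain ⟨a', haa', ha'⟩ := exists_between ha
  refine haa'.trans_le ?_
  have hev := (tendsto_lintegral_sphere_kernelSum hN x hp'1).eventually_const_lt ha'
  obtain ⟨P1, hP1, P2, hP2, hP⟩ := eventually_prod_iff.1 hev
  obtain ⟨ρ₀, hρ₀1, hρ₀⟩ := mem_nhdsLT_iff_exists_Ioo_subset.1 hP2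
  set ρ₁ := max ρ₀ 0 with hρ₁
  have hρ₁1 : ρ₁ < 1 := max_lt hρ₀1 one_pos
  have hkey : ∀ᶠ s in 𝓝[>] (-1 : ℝ), a' * (1 - bergmanMeasure N s (closedBall 0 ρ₁)) ≤
      ENNReal.ofReal (kernelQuad (N + s + 1) x p) := by
    filter_upwards [hP1, self_mem_nhdsWithin] with s hPs hs
    have hμ := isProbabilityMeasure_bergmanMeasure hN hs
    obtain ⟨m, hm1, hm⟩ := exists_polar_bergmanMeasure hN s
    have h1 : bergmanENorm N s (kernelSum (N + s + 1) x p') ^ 2 ≤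
        ENNReal.ofReal (kernelQuad (N + s + 1) x p) := by
      rw [bergmanENorm_kernelSum hN hs x hp'1]
      exact ENNReal.ofReal_le_ofReal (kernelQuad_smul_le hN hs x hp hr.1.le hr.2)
    refine le_trans ?_ h1
    have h2 := eLpNorm_nnreal_pow_eq_lintegral (μ := bergmanMeasure N s)
      (f := kernelSum (N + s + 1) x p') (p := 2) two_ne_zero
    simp only [NNReal.coe_ofNat, ENNReal.coe_ofNat, ENNReal.rpow_ofNat] at h2
    rw [bergmanENorm, h2, hm _ ((measurable_kernelSum _ x p').enorm.pow_const 2),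
      ← prob_compl_eq_one_sub measurableSet_closedBall,
      ← lintegral_indicator_one measurableSet_closedBall.compl,
      hm _ (measurable_one.indicator measurableSet_closedBall.compl)]
    have hmm : Measurable fun ρ : Set.Ioi (0 : ℝ) => ∫⁻ ξ : sphere (0 : CSpace N) 1,
        (closedBall (0 : CSpace N) ρ₁)ᶜ.indicator (1 : CSpace N → ℝ≥0∞)
          ((ρ : ℝ) • (ξ : CSpace N)) ∂sphereMeasure N := by
      have : Measurable fun q : Set.Ioi (0 : ℝ) × sphere (0 : CSpace N) 1 =>
        (closedBall (0 : CSpace N) ρ₁)ᶜ.indicator (1 : CSpace N → ℝ≥0∞)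
          ((q.1 : ℝ) • (q.2 : CSpace N)) :=
        (measurable_one.indicator measurableSet_closedBall.compl).comp (by fun_prop)
      exact this.lintegral_prod_right'
    rw [← lintegral_const_mul _ hmm]
    refine lintegral_mono_ae ?_
    filter_upwards [hm1] with ρ hρ
    by_cases hρρ : ρ₁ < ρ
    · have h3 : ∀ ξ : sphere (0 : CSpace N) 1,
          (closedBall (0 : CSpace N) ρ₁)ᶜ.indicator (1 : CSpace N → ℝ≥0∞)
            ((ρ : ℝ) • (ξ : CSpace N)) ≤ 1 := fun ξ => Set.indicator_le_self' (by simp) _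
      calc _ ≤ a' * ∫⁻ _ : sphere (0 : CSpace N) 1, 1 ∂sphereMeasure N := by
            gcongr with ξ
            exact h3 ξ
        _ = a' := by simp
        _ ≤ _ := (hP hPs (hρ₀ ⟨(le_max_left _ _).trans_lt hρρ, hρ⟩)).le
    · have h3 : ∀ ξ : sphere (0 : CSpace N) 1,
          (closedBall (0 : CSpace N) ρ₁)ᶜ.indicator (1 : CSpace N → ℝ≥0∞)
            ((ρ : ℝ) • (ξ : CSpace N)) = 0 := fun ξ => by
        have hξ : ‖(ξ : CSpace N)‖ = 1 := by simp
        refine Set.indicator_of_notMem ?_ _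
        rw [Set.notMem_compl_iff, mem_closedBall_zero_iff, norm_smul, hξ, mul_one,
          Real.norm_of_nonneg ρ.2.le]
        exact not_lt.1 hρρ
      simp [h3]
  have hl : Tendsto (fun s => a' * (1 - bergmanMeasure N s (closedBall 0 ρ₁))) (𝓝[>] (-1))
      (𝓝 (a' * (1 - 0))) :=
    ENNReal.Tendsto.const_mul (ENNReal.Tendsto.sub tendsto_const_nhds
      (tendsto_bergmanMeasure_closedBall hN (le_max_right _ _) hρ₁1) (Or.inl ENNReal.one_ne_top))
      (Or.inl (by simp))
  have hr' : Tendsto (fun s : ℝ => ENNReal.ofReal (kernelQuad (N + s + 1) x p)) (𝓝[>] (-1))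
      (𝓝 (ENNReal.ofReal (kernelQuad N x p))) := by
    refine ENNReal.tendsto_ofReal (tendsto_kernelQuad x hp ?_)
    have : Tendsto (fun t : ℝ => (N : ℝ) + t + 1) (𝓝 (-1)) (𝓝 (N : ℝ)) :=
      (by fun_prop : Continuous fun t : ℝ => (N : ℝ) + t + 1).tendsto' _ _ (by ring)
    exact this.mono_left nhdsWithin_le_nhds
  have := le_of_tendsto_of_tendsto hl hr' hkey
  simpa using this

lemma hardyENorm_kernelSum_sq_le (hN : 0 < N) (x : ι → ℂ) {p : ι → CSpace N}
    (hp : ∀ i, ‖p i‖ < 1) :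
    hardyENorm N (kernelSum N x p) ^ 2 ≤ ENNReal.ofReal (kernelQuad N x p) := by
  rw [← ENNReal.rpow_ofNat, ← ENNReal.le_rpow_inv_iff two_pos, hardyENorm]
  refine iSup₂_le fun r hr => ?_
  rw [ENNReal.le_rpow_inv_iff two_pos, ENNReal.rpow_ofNat]
  have h2 := eLpNorm_nnreal_pow_eq_lintegral (μ := sphereMeasure N)
    (f := fun ξ : sphere (0 : CSpace N) 1 => kernelSum N x p (r • (ξ : CSpace N)))
    (p := 2) two_ne_zero
  simp only [NNReal.coe_ofNat, ENNReal.coe_ofNat, ENNReal.rpow_ofNat] at h2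
  rw [h2]
  exact lintegral_sphere_kernelSum_le hN x hp hr

end HardyKernel

/-! ### Point evaluations and kernel sums on the whole scale -/

section SpaceNorm

variable {N : ℕ} {s : ℝ} {ι : Type*} [Fintype ι]

lemma spaceENorm_congr {f g : CSpace N → ℂ} (h : Set.EqOn f g (ball 0 1)) :
    spaceENorm N s f = spaceENorm N s g := by
  unfold spaceENorm
  split_ifs
  · unfold hardyENorm
    refine iSup_congr fun r => iSup_congr fun hr => ?_
    congr 1
    funext ξ
    have hξ : ‖(ξ : CSpace N)‖ = 1 := by simp
    refine h ?_
    rw [mem_ball_zero_iff, norm_smul, hξ, mul_one, Real.norm_of_nonneg hr.1.le]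
    exact hr.2
  · unfold bergmanENorm
    refine eLpNorm_congr_ae ?_
    filter_upwards [ae_mem_ball_bergmanMeasure N s] with z hz using h hz

lemma spaceENorm_kernelSum_sq_le (hN : 0 < N) (hs : -1 ≤ s) (x : ι → ℂ) {p : ι → CSpace N}
    (hp : ∀ i, ‖p i‖ < 1) :
    spaceENorm N s (kernelSum (N + s + 1) x p) ^ 2 ≤
      ENNReal.ofReal (kernelQuad (N + s + 1) x p) := by
  unfold spaceENorm
  split_ifs with h
  · have h1 : (N : ℝ) + s + 1 = N := by rw [h]; ring
    rw [h1]
    exact hardyENorm_kernelSum_sq_le hN x hp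
  · exact (bergmanENorm_kernelSum hN (lt_of_le_of_ne hs (Ne.symm h)) x hp).le

lemma enorm_apply_le_spaceENorm (hN : 0 < N) (hs : -1 ≤ s) {f : CSpace N → ℂ}
    (hf : DifferentiableOn ℂ f (ball 0 1)) (hfm : Measurable f) {w : CSpace N} (hw : ‖w‖ < 1) :
    ‖f w‖ₑ * ENNReal.ofReal ((1 - ‖w‖ ^ 2) ^ (((N : ℝ) + s + 1) / 2)) ≤ spaceENorm N s f := by
  unfold spaceENorm
  split_ifs with h
  · have h1 : (N : ℝ) + s + 1 = N := by rw [h]; ring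
    rw [h1]
    exact enorm_apply_le_hardyENorm hN hf hfm hw
  · exact enorm_apply_le_bergmanENorm hN (lt_of_le_of_ne hs (Ne.symm h)) hf hfm hw

namespace HolSpace

lemma norm_apply_le (hN : 0 < N) (hs : -1 ≤ s) (f : HolSpace N s) {w : CSpace N}
    (hw : ‖w‖ < 1) :
    ‖f w‖ * (1 - ‖w‖ ^ 2) ^ (((N : ℝ) + s + 1) / 2) ≤ ‖f‖ := by
  have hfm : Measurable f.1 := by
    have h1 := measurable_indicator_of_differentiableOn f.2.1
    rwa [Set.indicator_eq_self.2 fun z hz => by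
      by_contra hcon; exact hz (f.2.2.1 z hcon)] at h1
  have h := enorm_apply_le_spaceENorm hN hs f.2.1 hfm hw
  have h2 := ENNReal.toReal_mono f.2.2.2.ne h
  have h3 := one_sub_norm_sq_pos hw
  rwa [ENNReal.toReal_mul, toReal_enorm, ENNReal.toReal_ofReal (by positivity)] at h2

/-- A linear combination of kernels, as an element of the space. -/
noncomputable def kernelElem (hN : 0 < N) (hs : -1 ≤ s) (x : ι → ℂ) (p : ι → CSpace N)
    (hp : ∀ i, ‖p i‖ < 1) : HolSpace N s :=
  ⟨(ball 0 1).indicator (kernelSum (N + s + 1) x p), by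
    have heq : Set.EqOn ((ball 0 1).indicator (kernelSum (N + s + 1) x p))
        (kernelSum (N + s + 1) x p) (ball 0 1) := fun z hz => Set.indicator_of_mem hz _
    refine ⟨(differentiableOn_kernelSum _ x hp).congr heq,
      fun z hz => Set.indicator_of_notMem hz _, ?_⟩
    rw [spaceENorm_congr heq]
    have := (spaceENorm_kernelSum_sq_le hN hs x hp).trans_lt ENNReal.ofReal_lt_top
    by_contra hcon
    rw [not_lt_top_iff.1 hcon] at this
    simp at this⟩

lemma kernelElem_apply (hN : 0 < N) (hs : -1 ≤ s) (x : ι → ℂ) (p : ι → CSpace N)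
    (hp : ∀ i, ‖p i‖ < 1) {z : CSpace N} (hz : ‖z‖ < 1) :
    kernelElem hN hs x p hp z = kernelSum (N + s + 1) x p z :=
  Set.indicator_of_mem (mem_ball_zero_iff.2 hz) _

/-- The form with `ENNReal.ofReal` on both sides avoids using that the quadratic form is
nonnegative, which is established above only for `s > -1`. -/
lemma norm_kernelElem_sq_le (hN : 0 < N) (hs : -1 ≤ s) (x : ι → ℂ) (p : ι → CSpace N)
    (hp : ∀ i, ‖p i‖ < 1) :
    ENNReal.ofReal (‖kernelElem hN hs x p hp‖ ^ 2) ≤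
      ENNReal.ofReal (kernelQuad (N + s + 1) x p) := by
  have h := spaceENorm_kernelSum_sq_le hN hs x hp
  have heq : spaceENorm N s (kernelElem hN hs x p hp).1 =
      spaceENorm N s (kernelSum (N + s + 1) x p) :=
    spaceENorm_congr fun z hz => Set.indicator_of_mem hz _
  rw [norm_def, ENNReal.ofReal_pow ENNReal.toReal_nonneg,
    ENNReal.ofReal_toReal (kernelElem hN hs x p hp).2.2.2.ne, heq]
  exact h

end HolSpace

end SpaceNorm

/-! ### Compact operators and fibre sums -/

/-- A compact operator maps a bounded sequence, whose members are asymptotically orthogonal in the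
sense of a majorant of the Gram matrix, to a sequence with a subsequence tending to zero. -/
lemma IsCompactOperator.exists_subseq_tendsto_zero {X : Type*} [SeminormedAddCommGroup X]
    [NormedSpace ℂ X] {K : X →L[ℂ] X} (hK : IsCompactOperator K) {f : ℕ → X} {G : ℕ → ℕ → ℝ}
    {M : ℝ} (hG : ∀ (n : ℕ) (u : Fin n → ℕ), ‖∑ k, f (u k)‖ ^ 2 ≤ ∑ k, ∑ l, G (u k) (u l))
    (hsymm : ∀ i j, G i j = G j i) (hdiag : ∀ n, G n n ≤ M)
    (hlim : ∀ i, Tendsto (G i) atTop (𝓝 0)) :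
    ∃ ψ : ℕ → ℕ, StrictMono ψ ∧ Tendsto (fun n => ‖K (f (ψ n))‖) atTop (𝓝 0) := by
  have hfM : ∀ n, ‖f n‖ ^ 2 ≤ M := fun n => by
    have := hG 1 fun _ => n
    simp only [Finset.univ_unique, Finset.sum_singleton] at this
    exact this.trans (hdiag n)
  have hM : 0 ≤ M := (sq_nonneg _).trans (hfM 0)
  obtain ⟨S, hS, hKS⟩ := IsCompactOperator.image_closedBall_subset_compact
    (f := (K : X →ₗ[ℂ] X)) hK (√M)
  obtain ⟨g, -, ψ, hψ, hg⟩ := hS.tendsto_subseq (x := fun n => K (f n)) fun n =>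
    hKS ⟨f n, mem_closedBall_zero_iff.2 (Real.le_sqrt_of_sq_le (hfM n)), rfl⟩
  refine ⟨ψ, hψ, ?_⟩
  -- Let `g` be the limit of the images. A sum of `n` almost orthogonal terms has norm `O(√n)` up to
  -- an error of order `nδ`, whereas its image is within `nδ` of `n g`; this forces `‖g‖` to be of
  -- order `δ`.
  have key : ∀ δ : ℝ, 0 < δ → ‖g‖ ≤ δ * (1 + 2 * ‖K‖) := by
    intro δ hδ
    obtain ⟨v, hv1, hv2⟩ := exists_seq_of_forall_finset_exists
      (fun i => ‖K (f i) - g‖ ≤ δ) (fun i j => G i j ≤ δ ^ 2) (by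
        intro s _
        have h1 : ∀ᶠ k in atTop, ‖K (f (ψ k)) - g‖ ≤ δ := by
          have := (tendsto_iff_norm_sub_tendsto_zero.1 hg).eventually (ge_mem_nhds hδ)
          exact this
        have h2 : ∀ᶠ k in atTop, ∀ i ∈ s, G i (ψ k) ≤ δ ^ 2 :=
          (Filter.eventually_all_finset s).2 fun i _ =>
            ((hlim i).comp hψ.tendsto_atTop).eventually (ge_mem_nhds (by positivity))
        obtain ⟨k, hk1, hk2⟩ := (h1.and h2).exists
        exact ⟨ψ k, hk1, hk2⟩)
    -- This size makes the diagonal contribution `n M` at most `n² δ²`, the bound for the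
    -- off-diagonal one.
    obtain ⟨n, hn⟩ := exists_nat_gt (M / δ ^ 2)
    have hn0 : (0 : ℝ) < n := lt_of_le_of_lt (by positivity) hn
    rw [div_lt_iff₀ (by positivity)] at hn
    set h : X := ∑ k : Fin n, f (v k) with hh
    have hsq : ‖h‖ ^ 2 ≤ (2 * n * δ) ^ 2 := by
      calc ‖h‖ ^ 2 ≤ ∑ k : Fin n, ∑ l : Fin n, G (v k) (v l) := hG n fun k => v k
        _ ≤ ∑ k : Fin n, ∑ l : Fin n, (δ ^ 2 + if k = l then M else 0) := by
            gcongr with k _ l _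
            rcases lt_trichotomy k l with hkl | hkl | hkl
            · rw [if_neg hkl.ne, add_zero]
              exact hv2 _ _ hkl
            · rw [if_pos hkl, hkl]
              exact (hdiag _).trans (le_add_of_nonneg_left (sq_nonneg δ))
            · rw [if_neg hkl.ne', add_zero, hsymm]
              exact hv2 _ _ hkl
        _ = n ^ 2 * δ ^ 2 + n * M := by
            simp [Finset.sum_add_distrib]
            ring
        _ ≤ (2 * n * δ) ^ 2 := by nlinarith [mul_le_mul_of_nonneg_left hn.le hn0.le, sq_nonneg (n * δ)]
    have hle : ‖h‖ ≤ 2 * n * δ := le_of_sq_le_sq hsq (by positivity)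
    have h3 : ‖K h - (n : ℂ) • g‖ ≤ n * δ := by
      have : K h - (n : ℂ) • g = ∑ k : Fin n, (K (f (v k)) - g) := by
        rw [Finset.sum_sub_distrib, hh, map_sum, Finset.sum_const, Finset.card_univ,
          Fintype.card_fin, Nat.cast_smul_eq_nsmul]
      rw [this]
      refine (norm_sum_le_of_le _ fun (k : Fin n) _ => hv1 (k : ℕ)).trans_eq ?_
      simp
    have h4 : (n : ℝ) * ‖g‖ ≤ n * (δ * (1 + 2 * ‖K‖)) := by
      calc (n : ℝ) * ‖g‖ = ‖(n : ℂ) • g‖ := by rw [norm_smul, Complex.norm_natCast]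
        _ ≤ ‖K h‖ + ‖K h - (n : ℂ) • g‖ := by
            have := norm_sub_le (K h) (K h - (n : ℂ) • g)
            rwa [sub_sub_cancel] at this
        _ ≤ ‖K‖ * (2 * n * δ) + n * δ := by
            gcongr
            exact (K.le_opNorm h).trans (by gcongr)
        _ = n * (δ * (1 + 2 * ‖K‖)) := by ring
    exact le_of_mul_le_mul_left h4 hn0
  have hg0 : ‖g‖ = 0 := by
    refine le_antisymm ?_ (norm_nonneg g)
    have h1 : Tendsto (fun δ : ℝ => δ * (1 + 2 * ‖K‖)) (𝓝[>] 0) (𝓝 0) := by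
      refine Tendsto.mono_left ?_ nhdsWithin_le_nhds
      exact (by fun_prop : Continuous fun δ : ℝ => δ * (1 + 2 * ‖K‖)).tendsto' _ _ (by simp)
    exact ge_of_tendsto h1 (by filter_upwards [self_mem_nhdsWithin] with δ hδ using key δ hδ)
  have := hg.norm
  rwa [hg0] at this

/-- A weighted sum of squared moduli of sums over fibres, as a double sum. -/
lemma sum_image_norm_sq_fiber {ι α : Type*} [Fintype ι] (b : ι → α) (P : α → Prop) (c : ι → ℂ)
    (w : α → ℝ) :
    ∑ p ∈ (Finset.univ.filter fun j => P (b j)).image b,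
        ‖∑ l with b l = p, c l‖ ^ 2 * w p =
      (∑ l, ∑ j, starRingEnd ℂ (c l) * c j *
        (if P (b l) ∧ b l = b j then (w (b l) : ℂ) else 0)).re := by
  have h1 : ∀ p, ((‖∑ l with b l = p, c l‖ ^ 2 * w p : ℝ) : ℂ) =
      ∑ l with b l = p, ∑ j with b j = b l, starRingEnd ℂ (c l) * c j * (w (b l) : ℂ) := by
    intro p
    rw [Complex.ofReal_mul, Complex.ofReal_pow, ← Complex.conj_mul', map_sum, Finset.sum_mul,
      Finset.sum_mul]
    refine Finset.sum_congr rfl fun l hl => ?_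
    rw [(Finset.mem_filter.1 hl).2, Finset.mul_sum, Finset.sum_mul]
  have h2 : (∑ l, ∑ j, starRingEnd ℂ (c l) * c j *
        (if P (b l) ∧ b l = b j then (w (b l) : ℂ) else 0)) =
      ∑ l with P (b l), ∑ j with b j = b l, starRingEnd ℂ (c l) * c j * (w (b l) : ℂ) := by
    rw [Finset.sum_filter]
    refine Finset.sum_congr rfl fun l _ => ?_
    split_ifs with hl
    · rw [Finset.sum_filter]
      refine Finset.sum_congr rfl fun j _ => ?_
      simp [hl, eq_comm]
    · simp [hl]
  rw [h2, ← Finset.sum_fiberwise_of_maps_to (g := b)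
    (t := (Finset.univ.filter fun j => P (b j)).image b)
    fun l hl => Finset.mem_image_of_mem b hl, Complex.re_sum]
  refine Finset.sum_congr rfl fun p hp => ?_
  obtain ⟨j, hj, rfl⟩ := Finset.mem_image.1 hp
  have hj' := (Finset.mem_filter.1 hj).2
  rw [← Complex.ofReal_re (‖∑ l with b l = b j, c l‖ ^ 2 * w (b j)), h1, Finset.filter_filter]
  congr 2
  ext l
  simp only [Finset.mem_filter, Finset.mem_univ, true_and]
  exact ⟨fun h => ⟨h ▸ hj', h⟩, fun h => h.2⟩

/-! ### Testing on images of normalized kernels -/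

section EssentialNorm

open scoped ComplexConjugate

variable {N : ℕ} {s : ℝ} {ι κ : Type*} [Fintype ι] [Fintype κ]

/-- A majorant of the inner product of `∑ x_i K_{p_i}` and `∑ y_j K_{q_j}`. -/
noncomputable def kernelGram (β : ℝ) (x : ι → ℂ) (p : ι → CSpace N) (y : κ → ℂ)
    (q : κ → CSpace N) : ℝ :=
  ∑ i, ∑ j, ‖x i‖ * ‖y j‖ * ‖ballKernel β (p i) (q j)‖

lemma norm_ballKernel_comm (β : ℝ) {a z : CSpace N} (ha : ‖a‖ < 1) (hz : ‖z‖ < 1) :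
    ‖ballKernel β a z‖ = ‖ballKernel β z a‖ := by
  rw [← conj_ballKernel β ha hz.le, RCLike.norm_conj]

lemma kernelGram_comm (β : ℝ) (x : ι → ℂ) {p : ι → CSpace N} (y : κ → ℂ)
    {q : κ → CSpace N} (hp : ∀ i, ‖p i‖ < 1) (hq : ∀ j, ‖q j‖ < 1) :
    kernelGram β x p y q = kernelGram β y q x p := by
  unfold kernelGram
  rw [Finset.sum_comm]
  refine Finset.sum_congr rfl fun j _ => Finset.sum_congr rfl fun i _ => ?_
  rw [norm_ballKernel_comm β (hp i) (hq j), mul_comm ‖x i‖]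

lemma kernelQuad_le_kernelGram (β : ℝ) (x : ι → ℂ) (p : ι → CSpace N) :
    kernelQuad β x p ≤ kernelGram β x p x p := by
  refine (Complex.re_le_norm _).trans ?_
  refine (norm_sum_le _ _).trans (Finset.sum_le_sum fun i _ => ?_)
  refine (norm_sum_le _ _).trans_eq (Finset.sum_congr rfl fun j _ => ?_)
  rw [norm_mul, norm_mul, RCLike.norm_conj]

lemma kernelGram_nonneg (β : ℝ) (x : ι → ℂ) (p : ι → CSpace N) (y : κ → ℂ)
    (q : κ → CSpace N) : 0 ≤ kernelGram β x p y q :=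
  Finset.sum_nonneg fun _ _ => Finset.sum_nonneg fun _ _ => by positivity

namespace HolSpace

/-- Evaluation at a point, as a linear form. -/
noncomputable def evalAt (w : CSpace N) : HolSpace N s →ₗ[ℂ] ℂ :=
  (LinearMap.proj w).comp (holSubmodule N s).subtype

lemma evalAt_apply (w : CSpace N) (f : HolSpace N s) : evalAt w f = f w := rfl

lemma ext_ball {f g : HolSpace N s} (h : ∀ z : CSpace N, ‖z‖ < 1 → f z = g z) : f = g := by
  refine Subtype.ext (funext fun z => ?_)
  by_cases hz : z ∈ ball (0 : CSpace N) 1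
  · exact h z (mem_ball_zero_iff.1 hz)
  · rw [f.2.2.1 z hz, g.2.2.1 z hz]

lemma sum_kernelElem (hN : 0 < N) (hs : -1 ≤ s) (x : κ → ι → ℂ) (p : κ → ι → CSpace N)
    (hp : ∀ k i, ‖p k i‖ < 1) :
    ∑ k, kernelElem hN hs (x k) (p k) (hp k) =
      kernelElem hN hs (fun q : κ × ι => x q.1 q.2) (fun q => p q.1 q.2)
        (fun q => hp q.1 q.2) := by
  refine ext_ball fun z hz => ?_
  rw [← evalAt_apply, map_sum, kernelElem_apply hN hs _ _ _ hz, kernelSum,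
    Fintype.sum_prod_type]
  refine Finset.sum_congr rfl fun k _ => ?_
  rw [evalAt_apply, kernelElem_apply hN hs _ _ _ hz, kernelSum]

/-- A sum of kernel sums is a kernel sum over the concatenated family, and the majorant splits into
blocks. This provides the Gram bound for the compactness argument without an inner product on the
space. -/
lemma norm_sum_kernelElem_sq_le (hN : 0 < N) (hs : -1 ≤ s) (x : κ → ι → ℂ)
    (p : κ → ι → CSpace N) (hp : ∀ k i, ‖p k i‖ < 1) :
    ‖∑ k, kernelElem hN hs (x k) (p k) (hp k)‖ ^ 2 ≤
      ∑ k, ∑ l, kernelGram (N + s + 1) (x k) (p k) (x l) (p l) := by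
  rw [sum_kernelElem]
  have h0 := kernelGram_nonneg (N + s + 1) (fun q : κ × ι => x q.1 q.2) (fun q => p q.1 q.2)
    (fun q : κ × ι => x q.1 q.2) (fun q => p q.1 q.2)
  have h1 := norm_kernelElem_sq_le hN hs (fun q : κ × ι => x q.1 q.2) (fun q => p q.1 q.2)
    (fun q => hp q.1 q.2)
  refine ((ENNReal.ofReal_le_ofReal_iff h0).1 (h1.trans (ENNReal.ofReal_le_ofReal
    (kernelQuad_le_kernelGram _ _ _)))).trans_eq ?_
  simp only [kernelGram, Fintype.sum_prod_type]
  exact Finset.sum_congr rfl fun k _ => Finset.sum_comm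

lemma sum_smul_apply {m : ℕ} {φ : Fin m → CSpace N → CSpace N}
    {C : Fin m → (HolSpace N s →L[ℂ] HolSpace N s)}
    (hC : ∀ j, IsCompositionOperator (φ j) (C j)) (c : Fin m → ℂ) (f : HolSpace N s)
    {w : CSpace N} (hw : ‖w‖ < 1) :
    (∑ j, c j • C j) f w = ∑ j, c j * f (φ j w) := by
  rw [← evalAt_apply, _root_.sum_apply, map_sum]
  refine Finset.sum_congr rfl fun j _ => ?_
  rw [_root_.smul_apply, map_smul, evalAt_apply, hC j f w (mem_ball_zero_iff.2 hw),
    smul_eq_mul]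

end HolSpace

/-- Testing a perturbation by a compact operator on the images of normalized kernels. -/
lemma re_sum_limit_le_norm_sub_sq (hN : 0 < N) (hs : -1 ≤ s) {m : ℕ}
    {φ : Fin m → CSpace N → CSpace N} (hmaps : ∀ j, Set.MapsTo (φ j) (ball 0 1) (ball 0 1))
    {C : Fin m → (HolSpace N s →L[ℂ] HolSpace N s)}
    (hC : ∀ j, IsCompositionOperator (φ j) (C j)) (c : Fin m → ℂ)
    {K : HolSpace N s →L[ℂ] HolSpace N s} (hK : IsCompactOperator K)
    {w : ℕ → CSpace N} (hw : ∀ n, ‖w n‖ < 1)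
    (hw1 : Tendsto (fun n => 1 - ‖w n‖ ^ 2) atTop (𝓝 0)) (hβ : 0 < (N : ℝ) + s + 1)
    {L : Fin m → Fin m → ℂ}
    (hL : ∀ l j, Tendsto (fun n => (((1 - ‖w n‖ ^ 2) ^ ((N : ℝ) + s + 1) : ℝ) : ℂ) *
      ballKernel (N + s + 1) (φ l (w n)) (φ j (w n))) atTop (𝓝 (L l j))) :
    (∑ l, ∑ j, conj (c l) * c j * L l j).re ≤ ‖∑ j, c j • C j - K‖ ^ 2 := by
  set β : ℝ := N + s + 1 with hβdef
  set T := ∑ j, c j • C j with hT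
  set ρ : ℕ → ℝ := fun n => (1 - ‖w n‖ ^ 2) ^ (β / 2) with hρ
  have hρ0 : ∀ n, 0 ≤ ρ n := fun n => (Real.rpow_pos_of_pos (one_sub_norm_sq_pos (hw n)) _).le
  have hρρ : ∀ n, ρ n * ρ n = (1 - ‖w n‖ ^ 2) ^ β := fun n => by
    rw [hρ, ← Real.rpow_add (one_sub_norm_sq_pos (hw n)), add_halves]
  have hρlim : Tendsto ρ atTop (𝓝 0) := by
    have := hw1.rpow_const (p := β / 2) (Or.inr (by positivity))
    rwa [Real.zero_rpow (by positivity)] at this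
  -- With these coefficients `f n` is the formal adjoint of `T` applied to the normalized kernel at
  -- `w n`.
  set x : ℕ → Fin m → ℂ := fun n l => conj (c l) * (ρ n : ℂ) with hx
  set p : ℕ → Fin m → CSpace N := fun n l => φ l (w n) with hp
  have hp1 : ∀ n l, ‖p n l‖ < 1 := fun n l =>
    mem_ball_zero_iff.1 (hmaps l (mem_ball_zero_iff.2 (hw n)))
  have hnx : ∀ n l, ‖x n l‖ = ‖c l‖ * ρ n := fun n l => by
    rw [hx, norm_mul, RCLike.norm_conj, Complex.norm_real, Real.norm_of_nonneg (hρ0 n)]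
  set f : ℕ → HolSpace N s := fun n => HolSpace.kernelElem hN hs (x n) (p n) (hp1 n) with hf
  set G : ℕ → ℕ → ℝ := fun n k => kernelGram β (x n) (p n) (x k) (p k) with hGdef
  set S : ℕ → ℂ := fun n => ∑ l, ∑ j, conj (c l) * c j *
    ((((1 - ‖w n‖ ^ 2) ^ β : ℝ) : ℂ) * ballKernel β (p n l) (p n j)) with hS
  have hSlim : Tendsto S atTop (𝓝 (∑ l, ∑ j, conj (c l) * c j * L l j)) :=
    tendsto_finsetSum _ fun l _ => tendsto_finsetSum _ fun j _ => (hL l j).const_mul _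
  have hQ : ∀ n, kernelQuad β (x n) (p n) = (S n).re := fun n => by
    rw [kernelQuad, hS]
    congr 1
    refine Finset.sum_congr rfl fun l _ => Finset.sum_congr rfl fun j _ => ?_
    rw [hx, ← hρρ, map_mul, Complex.conj_conj, Complex.conj_ofReal]
    push_cast
    ring
  -- Evaluating `T (f n)` at `w n`, with the weight `ρ n`, reproduces the quadratic form of `f n`;
  -- the sharp point evaluation bound then applies.
  have hTf : ∀ n, ‖S n‖ ≤ ‖T (f n)‖ := fun n => by
    refine le_of_eq_of_le ?_ (HolSpace.norm_apply_le hN hs (T (f n)) (hw n))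
    have : (ρ n : ℂ) * T (f n) (w n) = S n := by
      rw [hT, HolSpace.sum_smul_apply hC c _ (hw n), Finset.mul_sum]
      simp only [hS]
      rw [Finset.sum_comm]
      refine Finset.sum_congr rfl fun j _ => ?_
      rw [hf, HolSpace.kernelElem_apply hN hs _ _ _ (hp1 n j), kernelSum, Finset.mul_sum,
        Finset.mul_sum]
      refine Finset.sum_congr rfl fun l _ => ?_
      rw [hx, ← hρρ]
      push_cast
      ring
    rw [← this, norm_mul, Complex.norm_real, Real.norm_of_nonneg (hρ0 n), mul_comm]
  have hfn : ∀ n, ‖f n‖ ≤ √(max (S n).re 0) := fun n => by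
    refine Real.le_sqrt_of_sq_le ((ENNReal.ofReal_le_ofReal_iff (le_max_right _ _)).1 ?_)
    refine (HolSpace.norm_kernelElem_sq_le hN hs (x n) (p n) (hp1 n)).trans ?_
    rw [hQ]
    exact ENNReal.ofReal_le_ofReal (le_max_left _ _)
  obtain ⟨M, hM⟩ : ∃ M, ∀ n, G n n ≤ M := by
    have h1 : Tendsto (fun n => G n n) atTop (𝓝 (∑ l, ∑ j, ‖c l‖ * ‖c j‖ * ‖L l j‖)) := by
      refine tendsto_finsetSum _ fun l _ => tendsto_finsetSum _ fun j _ => ?_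
      refine ((hL l j).norm.const_mul (‖c l‖ * ‖c j‖)).congr fun n => ?_
      rw [norm_mul, Complex.norm_real, ← hρρ, Real.norm_of_nonneg (mul_nonneg (hρ0 n) (hρ0 n)),
        hnx, hnx]
      ring
    obtain ⟨M, hM⟩ := h1.bddAbove_range
    exact ⟨M, fun n => hM ⟨n, rfl⟩⟩
  obtain ⟨ψ, hψ, hKψ⟩ := hK.exists_subseq_tendsto_zero (f := f) (G := G)
    (fun n u => HolSpace.norm_sum_kernelElem_sq_le hN hs (fun k => x (u k)) (fun k => p (u k))
      fun k => hp1 (u k))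
    (fun i j => kernelGram_comm β _ _ (hp1 i) (hp1 j)) hM (fun n => by
      -- For fixed `n` the kernels at the points `p n l` are bounded on the ball, while the
      -- coefficients `x k` carry the factor `ρ k → 0`.
      have hb : Tendsto (fun k => ∑ l, ∑ j, ‖x n l‖ * (‖c j‖ * ρ k) * (1 - ‖p n l‖) ^ (-β))
          atTop (𝓝 (∑ l : Fin m, ∑ j : Fin m, ‖x n l‖ * (‖c j‖ * 0) * (1 - ‖p n l‖) ^ (-β))) :=
        tendsto_finsetSum _ fun l _ => tendsto_finsetSum _ fun j _ =>
          ((hρlim.const_mul _).const_mul _).mul_const _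
      simp only [mul_zero, zero_mul, Finset.sum_const_zero] at hb
      refine squeeze_zero (fun k => kernelGram_nonneg β _ _ _ _) (fun k => ?_) hb
      refine Finset.sum_le_sum fun l _ => Finset.sum_le_sum fun j _ => ?_
      rw [hnx k]
      exact mul_le_mul_of_nonneg_left (norm_ballKernel_le hβ.le (hp1 n l) (hp1 k j).le)
        (mul_nonneg (norm_nonneg _) (mul_nonneg (norm_nonneg _) (hρ0 k))))
  set Λ : ℝ := (∑ l, ∑ j, conj (c l) * c j * L l j).re with hΛ
  have hre : Tendsto (fun n => (S (ψ n)).re) atTop (𝓝 Λ) :=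
    (Complex.continuous_re.tendsto _).comp (hSlim.comp hψ.tendsto_atTop)
  -- X
  have hlimle : Λ ≤ ‖T - K‖ * √(max Λ 0) + 0 := by
    refine le_of_tendsto_of_tendsto' hre
      (((hre.max tendsto_const_nhds).sqrt.const_mul ‖T - K‖).add hKψ) fun n => ?_
    calc (S (ψ n)).re ≤ ‖S (ψ n)‖ := Complex.re_le_norm _
      _ ≤ ‖T (f (ψ n))‖ := hTf _
      _ = ‖(T - K) (f (ψ n)) + K (f (ψ n))‖ := by
          rw [_root_.sub_apply, sub_add_cancel]
      _ ≤ ‖T - K‖ * √(max (S (ψ n)).re 0) + ‖K (f (ψ n))‖ := by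
          refine (norm_add_le _ _).trans ?_
          gcongr
          exact ((T - K).le_opNorm _).trans (by gcongr; exact hfn _)
  rcases le_or_gt Λ 0 with h0 | h0
  · exact h0.trans (sq_nonneg _)
  · rw [max_eq_left h0.le, add_zero] at hlimle
    have h1 : √Λ * √Λ ≤ ‖T - K‖ * √Λ := by rwa [Real.mul_self_sqrt h0.le]
    have h2 := le_of_mul_le_mul_right h1 (Real.sqrt_pos.2 h0)
    calc Λ = √Λ ^ 2 := (Real.sq_sqrt h0.le).symm
      _ ≤ ‖T - K‖ ^ 2 := by gcongr

end EssentialNorm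

/-! ### Boundary data and the limit of large slope -/

section BoundaryData

open scoped ComplexConjugate

variable {N : ℕ} {s : ℝ} {φ : CSpace N → CSpace N} {ζ η : CSpace N} {d : ℝ}

lemma IsJuliaPoint.tendsto_radial (h : IsJuliaPoint φ ζ η d) :
    Tendsto (fun r : ℝ => φ (r • ζ)) (𝓝[<] 1) (𝓝 η) := by
  have h1 : Tendsto (fun r : ℝ => 1 - r) (𝓝[<] 1) (𝓝[>] 0) := by
    refine tendsto_nhdsWithin_iff.2 ⟨Tendsto.mono_left ?_ nhdsWithin_le_nhds, ?_⟩
    · exact (by fun_prop : Continuous fun r : ℝ => 1 - r).tendsto' _ _ (by norm_num)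
    · filter_upwards [self_mem_nhdsWithin] with r hr
      exact sub_pos.2 (Set.mem_Iio.1 hr)
  refine ((h.tendsto_apply_stolzPath (κ := 1) Complex.one_re).comp h1).congr fun r => ?_
  simp only [Function.comp, stolzPath]
  congr 1
  rw [← Complex.coe_smul]
  congr 1
  push_cast
  ring

lemma isJuliaPoint_radialLimit (hφ : DifferentiableOn ℂ φ (ball 0 1))
    (hmaps : Set.MapsTo φ (ball 0 1) (ball 0 1)) (hζ : ‖ζ‖ = 1) (h : angularLiminf φ ζ < ∞) :
    IsJuliaPoint φ ζ (radialLimit φ ζ) (angularLiminf φ ζ).toReal := by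
  obtain ⟨η, hη⟩ := exists_isJuliaPoint hφ hmaps hζ h
  rwa [radialLimit, hη.tendsto_radial.limUnder_eq]

/-- For `κ = 1 + Mi` the base has imaginary part `(d' - d) M / 2`. It is the constant `d` when `d =
d'`, and otherwise its modulus tends to infinity and the negative power to zero. -/
lemma tendsto_cpow_stolz_slope {β d d' : ℝ} (hβ : 0 < β) (hd : 0 < d) :
    Tendsto (fun M : ℝ => (((d' : ℂ) * (1 + M * Complex.I) + d * conj (1 + M * Complex.I)) / 2) ^
      ((-β : ℝ) : ℂ)) atTop (𝓝 (if d = d' then ((1 / d ^ β : ℝ) : ℂ) else 0)) := by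
  split_ifs with h
  · subst h
    refine tendsto_const_nhds.congr fun M => ?_
    have : ((d : ℂ) * (1 + M * Complex.I) + d * conj (1 + M * Complex.I)) / 2 = (d : ℂ) := by
      simp only [map_add, map_one, map_mul, Complex.conj_ofReal, Complex.conj_I]
      ring
    rw [this, ← Complex.ofReal_cpow hd.le, Real.rpow_neg hd.le, one_div]
  · rw [tendsto_zero_iff_norm_tendsto_zero]
    simp only [Complex.norm_cpow_real]
    refine (tendsto_rpow_neg_atTop hβ).comp ?_
    have hpos : 0 < |d' - d| / 2 := by
      have := abs_pos.2 (sub_ne_zero.2 (Ne.symm h))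
      positivity
    refine tendsto_atTop_mono' _ ?_ (tendsto_id.const_mul_atTop hpos)
    filter_upwards [eventually_ge_atTop 0] with M hM
    refine le_trans (le_of_eq ?_) (Complex.abs_im_le_norm _)
    have : (((d' : ℂ) * (1 + M * Complex.I) + d * conj (1 + M * Complex.I)) / 2).im =
        (d' - d) / 2 * M := by
      simp
      ring
    rw [this, abs_mul, abs_div, abs_of_nonneg hM, abs_two, id]

/-- The limit of the normalized kernels along the path of slope `κ`. -/
noncomputable def kernelLimit (β : ℝ) (φ ψ : CSpace N → CSpace N) (ζ : CSpace N) (κ : ℂ) : ℂ :=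
  if (angularLiminf φ ζ < ∞ ∧ angularLiminf ψ ζ < ∞) ∧ radialLimit φ ζ = radialLimit ψ ζ then
    (((angularLiminf ψ ζ).toReal * κ + (angularLiminf φ ζ).toReal * conj κ) / 2) ^
      ((-β : ℝ) : ℂ)
  else 0

variable {ψ : CSpace N → CSpace N}

lemma tendsto_normalized_ballKernel {β : ℝ} (hβ : 0 < β)
    (hφ : DifferentiableOn ℂ φ (ball 0 1)) (hφm : Set.MapsTo φ (ball 0 1) (ball 0 1))
    (hψ : DifferentiableOn ℂ ψ (ball 0 1)) (hψm : Set.MapsTo ψ (ball 0 1) (ball 0 1))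
    (hζ : ‖ζ‖ = 1) {κ : ℂ} (hκ : κ.re = 1) :
    Tendsto (fun t : ℝ => (((1 - ‖stolzPath ζ κ t‖ ^ 2) ^ β : ℝ) : ℂ) *
      ballKernel β (φ (stolzPath ζ κ t)) (ψ (stolzPath ζ κ t))) (𝓝[>] 0)
      (𝓝 (kernelLimit β φ ψ ζ κ)) := by
  unfold kernelLimit
  by_cases hfin : angularLiminf φ ζ < ∞ ∧ angularLiminf ψ ζ < ∞
  · have h1 := isJuliaPoint_radialLimit hφ hφm hζ hfin.1
    have h2 := isJuliaPoint_radialLimit hψ hψm hζ hfin.2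
    by_cases heq : radialLimit φ ζ = radialLimit ψ ζ
    · rw [if_pos ⟨hfin, heq⟩]
      rw [← heq] at h2
      exact tendsto_normalized_ballKernel_same β h1 h2 hκ
    · rw [if_neg fun h => heq h.2]
      exact tendsto_normalized_ballKernel_ne hβ h1 h2 heq hκ
  · rw [if_neg fun h => hfin h.1]
    refine tendsto_normalized_ballKernel_top hβ hφm hψm hζ ?_ hκ
    simpa only [not_and_or, not_lt_top_iff] using hfin

lemma tendsto_kernelLimit {β : ℝ} (hβ : 0 < β)
    (hφ : DifferentiableOn ℂ φ (ball 0 1)) (hφm : Set.MapsTo φ (ball 0 1) (ball 0 1))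
    (hζ : ‖ζ‖ = 1) :
    Tendsto (fun M : ℝ => kernelLimit β φ ψ ζ (1 + M * Complex.I)) atTop
      (𝓝 (if (boundaryData φ ζ).2 < ∞ ∧ boundaryData φ ζ = boundaryData ψ ζ then
        ((1 / (boundaryData φ ζ).2.toReal ^ β : ℝ) : ℂ) else 0)) := by
  unfold kernelLimit boundaryData
  simp only [Prod.mk.injEq]
  by_cases h : (angularLiminf φ ζ < ∞ ∧ angularLiminf ψ ζ < ∞) ∧
      radialLimit φ ζ = radialLimit ψ ζ
  · simp only [if_pos h]
    have := tendsto_cpow_stolz_slope (d' := (angularLiminf ψ ζ).toReal) hβ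
      (isJuliaPoint_radialLimit hφ hφm hζ h.1.1).pos
    simpa only [h.1.1, h.2, true_and, ENNReal.toReal_eq_toReal_iff' h.1.1.ne h.1.2.ne] using this
  · simp only [if_neg h]
    rw [if_neg]
    · exact tendsto_const_nhds
    · rintro ⟨h1, h2, h3⟩
      exact h ⟨⟨h1, h3 ▸ h1⟩, h2⟩

end BoundaryData

/-! ### The lower bound for the essential norm -/

theorem theorem2p3 (N : ℕ) (s : ℝ) (hs : -1 ≤ s) (m : ℕ)
    (φ : Fin m → CSpace N → CSpace N)
    (hφ : ∀ j, DifferentiableOn ℂ (φ j) (ball 0 1))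
    (hφ_maps : ∀ j, Set.MapsTo (φ j) (ball 0 1) (ball 0 1))
    (C : Fin m → (HolSpace N s →L[ℂ] HolSpace N s))
    (hC : ∀ j, IsCompositionOperator (φ j) (C j))
    (c : Fin m → ℂ) (ζ : CSpace N) (hζ : ‖ζ‖ = 1) :
    (∀ j, angularLiminf (φ j) ζ < ∞ → 0 < angularLiminf (φ j) ζ ∧
      ∃ η : CSpace N, ‖η‖ = 1 ∧ Tendsto (fun r : ℝ => φ j (r • ζ)) (𝓝[<] 1) (𝓝 η)) ∧
    ∑ p ∈ finiteBoundaryData φ ζ,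
        ‖∑ l with boundaryData (φ l) ζ = p, c l‖ ^ 2 * (1 / p.2.toReal ^ ((N : ℝ) + s + 1)) ≤
      essentialNorm (∑ j, c j • C j) ^ 2 := by
  have hN : 0 < N := by
    rcases Nat.eq_zero_or_pos N with rfl | h
    · rw [Subsingleton.elim ζ 0, norm_zero] at hζ
      exact absurd hζ zero_ne_one
    · exact h
  have hβ : 0 < (N : ℝ) + s + 1 := by
    have : (0 : ℝ) < N := by exact_mod_cast hN
    linarith
  refine ⟨fun j hj => ?_, ?_⟩
  · obtain ⟨η, hη⟩ := exists_isJuliaPoint (hφ j) (hφ_maps j) hζ hj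
    exact ⟨(ENNReal.toReal_pos_iff.1 hη.pos).1, η, hη.norm_target, hη.tendsto_radial⟩
  set A := ∑ p ∈ finiteBoundaryData φ ζ,
    ‖∑ l with boundaryData (φ l) ζ = p, c l‖ ^ 2 * (1 / p.2.toReal ^ ((N : ℝ) + s + 1)) with hA
  have hA0 : 0 ≤ A := Finset.sum_nonneg fun p _ => by positivity
  have key : ∀ K : HolSpace N s →L[ℂ] HolSpace N s, IsCompactOperator K →
      A ≤ ‖∑ j, c j • C j - K‖ ^ 2 := by
    intro K hK
    have hslope : ∀ κ : ℂ, κ.re = 1 → (∑ l, ∑ j, starRingEnd ℂ (c l) * c j *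
        kernelLimit (N + s + 1) (φ l) (φ j) ζ κ).re ≤ ‖∑ j, c j • C j - K‖ ^ 2 := by
      intro κ hκ
      obtain ⟨t, ht⟩ := exists_seq_tendsto (𝓝[>] (0 : ℝ))
      obtain ⟨n₀, hn₀⟩ := eventually_atTop.1 (ht.eventually (eventually_norm_stolzPath_lt hζ hκ))
      -- Initial terms are dropped so that every point of the sequence lies in the ball.
      have ht' := ht.comp (tendsto_add_atTop_nat n₀)
      exact re_sum_limit_le_norm_sub_sq hN hs hφ_maps hC c hK
        (w := fun n => stolzPath ζ κ (t (n + n₀))) (fun n => hn₀ _ (Nat.le_add_left _ _))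
        ((tendsto_one_sub_norm_stolzPath_sq hζ hκ).comp ht') hβ fun l j =>
          (tendsto_normalized_ballKernel hβ (hφ l) (hφ_maps l) (hφ j) (hφ_maps j) hζ hκ).comp ht'
    -- The slope tends to infinity only after `t → 0`: the bound by `‖T - K‖²` is already
    -- independent of the path.
    have hlim : Tendsto (fun M : ℝ => (∑ l, ∑ j, starRingEnd ℂ (c l) * c j *
        kernelLimit (N + s + 1) (φ l) (φ j) ζ (1 + M * Complex.I)).re) atTop (𝓝 A) := by
      have hAsum := sum_image_norm_sq_fiber (fun j => boundaryData (φ j) ζ) (fun p => p.2 < ∞) c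
        fun p => 1 / p.2.toReal ^ ((N : ℝ) + s + 1)
      rw [show A = _ from hA.trans (Eq.trans (by unfold finiteBoundaryData; congr!) hAsum)]
      refine (Complex.continuous_re.tendsto _).comp ?_
      exact tendsto_finsetSum _ fun l _ => tendsto_finsetSum _ fun j _ => by
        convert (tendsto_kernelLimit (ψ := φ j) hβ (hφ l) (hφ_maps l) hζ).const_mul _
    exact le_of_tendsto' hlim fun M => hslope _ (by simp)
  have hle : √A ≤ essentialNorm (∑ j, c j • C j) := by
    refine le_csInf ⟨_, 0, isCompactOperator_zero, rfl⟩ ?_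
    rintro _ ⟨K, hK, rfl⟩
    exact Real.sqrt_le_iff.2 ⟨norm_nonneg _, key K hK⟩
  calc A = √A ^ 2 := (Real.sq_sqrt hA0).symm
    _ ≤ _ := by gcongr
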